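/- Let $G$ be a connected complex Lie group whose Lie algebra $\mathfrak g$ is simple, let $\operatorname{tr}(\,\cdot\,\cdot\,)$ be a non-degenerate invariant symmetric bilinear form on $\mathfrak g$, and let $r:\mathfrak g\to\mathfrak g$ be an $r$-matrix: a linear map, antisymmetric for $\operatorname{tr}$, with $r[rX,Y]+r[X,rY]-[rX,rY]=\alpha[X,Y]$ for some $\alpha\in\mathbb C$. Let $\Pi^r$ be the bivector field on $G$ whose contraction with the right-invariant forms $\theta_R(X)=\operatorname{tr}(dg\,g^{-1}X)$ is $$\pi^r_g(X,Y)=\tfrac12\operatorname{tr}\bigl(X\,rY-X\,\mathrm{Ad}_g\,r\,\mathrm{Ad}_g^{-1}Y\bigr).$$ Let $\mathfrak g_r$ be $\mathfrak g$ with the bracket $[X,Y]_r=\tfrac12([X,rY]+[rX,Y])$, and let $(G_r,\Pi_r)$ be a dual Poisson–Lie group: a connected complex Lie group with Lie algebra identified with $\mathfrak g_r$, and a Poisson–Lie structure $\Pi_r$ on it whose linearization at the unit gives the Lie bracket of $\mathfrak g\cong\mathfrak g_r^*$ (identified by $\operatorname{tr}$). Let $\mathfrak h\subset\mathfrak g$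 be a simple Lie subalgebra with $r\mathfrak h\subseteq\mathfrak h$, and let $H\subset G$ and $H_r\subset G_r$ be the connected (immersed) Lie subgroups with Lie algebras $\mathfrak h$ and $\mathfrak h_r=(\mathfrak h,[\cdot,\cdot]_r)$. A submanifold $N$ of $(M,\Pi)$ is called Poisson–Dirac if $\Pi_p^\sharp(T_pN^0)\cap T_pN=0$ for all $p\in N$ and the maps $\hat\Pi^\sharp_p:T_p^*N\to T_pN$ determined by $i_*\hat\Pi^\sharp_p(i^*\beta)=\Pi^\sharp_p\beta$ for $\beta\in(\Pi_p^{\sharp})^{-1}(T_pN)$ form a (holomorphic) Poisson structure on $N$, the Dirac bracket. Then: 1. $(G,\Pi^r)$ is a Poisson–Lie group, $H$ is a Poisson–Dirac submanifold of it, and $H_r$ is a Poisson–Dirac submanifold of $(G_r,\Pi_r)$. 2. The Dirac bracket on $H$ is the one given by $r|_{\mathfrak h}$: its contraction with the right-invariant forms $\theta_R(X),\theta_R(Y)$, $X,Y\in\mathfrak h$, at $h\in H$ is $\tfrac12\operatorname{tr}(X\,r|_{\mathfrak h}Y-X\,\mathrm{Ad}_h\,r|_{\mathfrak h}\,\mathrm{Ad}_h^{-1}Y)$.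 3. The Dirac bracket on $H_r$ is the dual structure given by $r|_{\mathfrak h}$, explicitly, for $X,Y\in\mathfrak h$: * Factorizable case: if $\alpha=c^2\neq0$, $r_\pm=\tfrac12(r\pm c)$ and $u\mapsto(g_+,g_-)$ is a holomorphic homomorphism $G_r\to G\times G$ with derivative $X\mapsto(r_+X,r_-X)$ at the unit, then its contraction at $u\in H_r$ with the forms $\operatorname{tr}((dg_+g_+^{-1}-dg_-g_-^{-1})X)$ and the same for $Y$ is $$\operatorname{tr}\bigl(X(\mathrm{Ad}_{g_+}-\mathrm{Ad}_{g_-})(r_-\mathrm{Ad}_{g_+}^{-1}-r_+\mathrm{Ad}_{g_-}^{-1})Y\bigr).$$ * Triangular case: if $\alpha=0$ and $u\mapsto(h,Z)$ is a holomorphic homomorphism from $G_r$ to $G\ltimes\mathfrak g$, with product $(g,X)(g',X')=(gg',\mathrm{Ad}_gX'+X)$ and with derivative $X\mapsto(\tfrac12rX,\tfrac12X)$ at the unit, then its contraction at $u\in H_r$ with the forms $\operatorname{tr}((dZ+[Z,dh\,h^{-1}])X)$ and the same for $Y$ is $$-\tfrac12\operatorname{tr}\bigl(X[Z,Y]-[Z,X]\,\mathrm{Ad}_h\,r\,\mathrm{Ad}_h^{-1}[Z,Y]\bigr).$$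 4. With their Dirac brackets, $H$ and $H_r$ are Poisson–Lie groups dual to each other through the pairing of their Lie algebras by $\operatorname{tr}|_{\mathfrak h}$: this pairing is non-degenerate, and the linearization at the unit of the Poisson structure of each group gives the Lie bracket of the other. -/

import Mathlib

open scoped Manifold ContDiff

noncomputable section

namespace PoissonLie

section Manifolds

variable {E : Type*} [NormedAddCommGroup E] [NormedSpace ℂ E] [FiniteDimensional ℂ E]
  {M : Type*} [TopologicalSpace M] [ChartedSpace E M]
  {F : Type*} [NormedAddCommGroup F] [NormedSpace ℂ F] [FiniteDimensional ℂ F]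
  {N : Type*} [TopologicalSpace N] [ChartedSpace F N]

instance instFiniteDimensionalTangentSpace (p : M) :
    FiniteDimensional ℂ (TangentSpace 𝓘(ℂ, E) p) :=
  inferInstanceAs (FiniteDimensional ℂ E)

/-- The holomorphic cotangent space `T_p^* M` of a complex manifold. -/
abbrev Cotangent (E : Type*) [NormedAddCommGroup E] [NormedSpace ℂ E]
    {M : Type*} [TopologicalSpace M] [ChartedSpace E M] (p : M) : Type _ :=
  Module.Dual ℂ (TangentSpace 𝓘(ℂ, E) p)

/-- A field of bilinear forms on the cotangent spaces, `Π_p(α, β) = ι(Π_p)(α ∧ β)`. It is a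
holomorphic bivector field when it is alternating and holomorphic, see `IsPoisson`. -/
abbrev TwoTensor (E : Type*) [NormedAddCommGroup E] [NormedSpace ℂ E]
    (M : Type*) [TopologicalSpace M] [ChartedSpace E M] : Type _ :=
  ∀ p : M, Cotangent E p →ₗ[ℂ] Cotangent E p →ₗ[ℂ] ℂ

/-- The differential at `p` of a complex valued function. -/
def diff (E : Type*) [NormedAddCommGroup E] [NormedSpace ℂ E]
    {M : Type*} [TopologicalSpace M] [ChartedSpace E M] (f : M → ℂ) (p : M) : Cotangent E p :=
  (mvfderiv 𝓘(ℂ, E) f p).toLinearMap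

/-- The differential at `p` of a map of complex manifolds, as a linear map. -/
def tangentMapAt (E F : Type*) [NormedAddCommGroup E] [NormedSpace ℂ E]
    [NormedAddCommGroup F] [NormedSpace ℂ F]
    {N : Type*} [TopologicalSpace N] [ChartedSpace F N]
    {M : Type*} [TopologicalSpace M] [ChartedSpace E M] (i : N → M) (p : N) :
    TangentSpace 𝓘(ℂ, F) p →ₗ[ℂ] TangentSpace 𝓘(ℂ, E) (i p) :=
  (mfderiv 𝓘(ℂ, F) 𝓘(ℂ, E) i p : TangentSpace 𝓘(ℂ, F) p →L[ℂ] TangentSpace 𝓘(ℂ, E) (i p))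

/-- `f` is holomorphic near `p`. -/
def HolAt (E : Type*) [NormedAddCommGroup E] [NormedSpace ℂ E]
    {M : Type*} [TopologicalSpace M] [ChartedSpace E M] (f : M → ℂ) (p : M) : Prop :=
  ContMDiffAt 𝓘(ℂ, E) 𝓘(ℂ, ℂ) ω f p

/-- The bracket `{f, h}(p) = Π_p(d_p f, d_p h)`. -/
def bracket (P : TwoTensor E M) (f h : M → ℂ) (p : M) : ℂ :=
  P p (diff E f p) (diff E h p)

/-- A holomorphic Poisson structure. Locally defined holomorphic functions are used because a
complex manifold may have too few global ones. -/
structure IsPoisson (P : TwoTensor E M) : Prop where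
  alternating : ∀ p α, P p α α = 0
  holomorphic : ∀ p f h, HolAt E f p → HolAt E h p → HolAt E (bracket P f h) p
  jacobi : ∀ p f g h, HolAt E f p → HolAt E g p → HolAt E h p →
    bracket P f (bracket P g h) p + bracket P g (bracket P h f) p
      + bracket P h (bracket P f g) p = 0

/-- The map `Π_p^♯ : T_p^* M → T_p M`, determined by `β (Π_p^♯ α) = Π_p(α, β)`. -/
def sharp (P : TwoTensor E M) (p : M) : Cotangent E p →ₗ[ℂ] TangentSpace 𝓘(ℂ, E) p :=
  (Module.evalEquiv ℂ (TangentSpace 𝓘(ℂ, E) p)).symm.toLinearMap ∘ₗ P p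

theorem apply_sharp (P : TwoTensor E M) (p : M) (α β : Cotangent E p) :
    β (sharp P p α) = P p α β := by
  simp [sharp]

/-- `i : N → M` exhibits `N` as an immersed submanifold of `M`. -/
structure IsImmersedSubmanifold (i : N → M) : Prop where
  holomorphic : ContMDiff 𝓘(ℂ, F) 𝓘(ℂ, E) ω i
  injective : Function.Injective i
  immersion : ∀ p, Function.Injective (tangentMapAt E F i p)

/-- `Q` completes the diagram defining the tensor induced by `P` on `N`: for every
`α ∈ (Π^♯)⁻¹(T_p N)` one has `i_* (Q^♯ (i^* α)) = Π^♯ α`. -/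
def IsDiracBracket (i : N → M) (P : TwoTensor E M) (Q : TwoTensor F N) : Prop :=
  ∀ (p : N) (α : Cotangent E (i p)),
    sharp P (i p) α ∈ LinearMap.range (tangentMapAt E F i p) →
    tangentMapAt E F i p (sharp Q p (α ∘ₗ tangentMapAt E F i p)) = sharp P (i p) α

/-- Poisson-Dirac submanifolds: `Π^♯(T_p N^0) ∩ T_p N = 0` at all points of `N`, and the
maps induced on the cotangent spaces of `N` form a holomorphic Poisson structure. -/
structure IsPoissonDirac (i : N → M) (P : TwoTensor E M) : Prop where
  submanifold : IsImmersedSubmanifold (E := E) (F := F) i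
  pointwise : ∀ p : N,
    Submodule.map (sharp P (i p)) (LinearMap.range (tangentMapAt E F i p)).dualAnnihilator ⊓
      LinearMap.range (tangentMapAt E F i p) = ⊥
  induced : ∃ Q : TwoTensor F N, IsDiracBracket i P Q ∧ IsPoisson Q

end Manifolds

section Groups

variable {E : Type*} [NormedAddCommGroup E] [NormedSpace ℂ E] [FiniteDimensional ℂ E]
  {G : Type*} [TopologicalSpace G] [ChartedSpace E G] [Group G]
  {F : Type*} [NormedAddCommGroup F] [NormedSpace ℂ F] [FiniteDimensional ℂ F]
  {K : Type*} [TopologicalSpace K] [ChartedSpace F K] [Group K]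

/-- The Lie algebra of a complex Lie group, with the bracket of left-invariant fields. -/
abbrev Lie (E : Type*) [NormedAddCommGroup E] [NormedSpace ℂ E]
    (G : Type*) [TopologicalSpace G] [ChartedSpace E G] [Group G] : Type _ :=
  GroupLieAlgebra 𝓘(ℂ, E) G

/-- The adjoint action `Ad_g` of `g` on the Lie algebra. -/
def Ad (E : Type*) [NormedAddCommGroup E] [NormedSpace ℂ E]
    {G : Type*} [TopologicalSpace G] [ChartedSpace E G] [Group G] (g : G) :
    Lie E G →ₗ[ℂ] Lie E G :=
  tangentMapAt E E (fun x : G => g * x * g⁻¹) 1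

/-- The derivative at the unit of a homomorphism of Lie groups. -/
def lieMap (F E : Type*) [NormedAddCommGroup E] [NormedSpace ℂ E]
    [NormedAddCommGroup F] [NormedSpace ℂ F]
    {K : Type*} [TopologicalSpace K] [ChartedSpace F K] [Group K]
    {G : Type*} [TopologicalSpace G] [ChartedSpace E G] [Group G] (f : K →* G) :
    Lie F K →ₗ[ℂ] Lie E G :=
  tangentMapAt E F f 1

/-- The derivative at the unit of right translation by `g`, a map `𝔤 → T_g G`. -/
def rightTranslation (E : Type*) [NormedAddCommGroup E] [NormedSpace ℂ E]
    {G : Type*} [TopologicalSpace G] [ChartedSpace E G] [Group G] (g : G) :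
    Lie E G →ₗ[ℂ] TangentSpace 𝓘(ℂ, E) g :=
  tangentMapAt E E (fun x : G => x * g) 1

/-- The `𝔤`-valued form `df f⁻¹` of a map `f : N → G`, at a point `p`. -/
def rightLog (F E : Type*) [NormedAddCommGroup E] [NormedSpace ℂ E]
    [NormedAddCommGroup F] [NormedSpace ℂ F]
    {N : Type*} [TopologicalSpace N] [ChartedSpace F N]
    {G : Type*} [TopologicalSpace G] [ChartedSpace E G] [Group G] (f : N → G) (p : N) :
    TangentSpace 𝓘(ℂ, F) p →ₗ[ℂ] Lie E G :=
  (tangentMapAt E E (fun x : G => x * (f p)⁻¹) (f p) :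
    TangentSpace 𝓘(ℂ, E) (f p) →ₗ[ℂ] Lie E G) ∘ₗ tangentMapAt E F f p

/-- Multiplicativity: `G × G → G` is a Poisson map. -/
structure IsPoissonLie (P : TwoTensor E G) : Prop where
  poisson : IsPoisson P
  multiplicative : ∀ (a b : G) (f h : G → ℂ), HolAt E f (a * b) → HolAt E h (a * b) →
    bracket P f h (a * b) =
      bracket P (fun x => f (x * b)) (fun x => h (x * b)) a +
      bracket P (fun x => f (a * x)) (fun x => h (a * x)) b

/-- Given a pairing `B` of the Lie algebras of `G` and `K`, the bracket
`[d_e f, d_e h] = d_e {f, h}` on the dual of the Lie algebra of `G` is the Lie bracket of the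
Lie algebra of `K`. -/
def LinearizesTo (P : TwoTensor E G) (B : Lie E G →ₗ[ℂ] Lie F K →ₗ[ℂ] ℂ) : Prop :=
  ∀ (ξ ζ : Lie F K) (f h : G → ℂ), HolAt E f 1 → HolAt E h 1 →
    diff E f 1 = B.flip ξ → diff E h 1 = B.flip ζ → diff E (bracket P f h) 1 = B.flip ⁅ξ, ζ⁆

/-- `(G, P)` and `(K, Q)` are Poisson-Lie groups dual to each other through the pairing `B` of
their Lie algebras. -/
structure IsDualPair (P : TwoTensor E G) (Q : TwoTensor F K)
    (B : Lie E G →ₗ[ℂ] Lie F K →ₗ[ℂ] ℂ) : Prop where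
  left : IsPoissonLie P
  right : IsPoissonLie Q
  perfect : B.Nondegenerate
  linearizes_left : LinearizesTo P B
  linearizes_right : LinearizesTo Q B.flip

/-- `i` exhibits `K` as the connected (immersed) Lie subgroup of `G` with tangent space `V` at
the unit. -/
structure IsLieSubgroup (i : K →* G) (V : Submodule ℂ (Lie E G)) : Prop where
  connected : ConnectedSpace K
  submanifold : IsImmersedSubmanifold (E := E) (F := F) i
  range_eq : LinearMap.range (lieMap F E i) = V

/-- An `r`-matrix with constant `α`: antisymmetric for `B`, and satisfying the modified
Yang-Baxter identity. -/
structure IsRMatrix (B : LinearMap.BilinForm ℂ (Lie E G)) (r : Lie E G →ₗ[ℂ] Lie E G)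
    (α : ℂ) : Prop where
  antisymm : ∀ X Y, B (r X) Y = -B X (r Y)
  yangBaxter : ∀ X Y, r ⁅r X, Y⁆ + r ⁅X, r Y⁆ - ⁅r X, r Y⁆ = α • ⁅X, Y⁆

/-- The bracket `[X, Y]_r = ½ ([X, rY] + [rX, Y])`. -/
def rBracket (r : Lie E G →ₗ[ℂ] Lie E G) (X Y : Lie E G) : Lie E G :=
  (1 / 2 : ℂ) • (⁅X, r Y⁆ + ⁅r X, Y⁆)

/-- `π_g^r(X, Y) = ½ tr(X rY - X Ad_g r Ad_g⁻¹ Y)`. -/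
def piR (B : LinearMap.BilinForm ℂ (Lie E G)) (r : Lie E G →ₗ[ℂ] Lie E G) (g : G) :
    Lie E G →ₗ[ℂ] Lie E G →ₗ[ℂ] ℂ :=
  (1 / 2 : ℂ) • B.compl₂ (r - Ad E g ∘ₗ r ∘ₗ Ad E g⁻¹)

/-- The right-invariant form `θ_R(X) = tr(df f⁻¹ X)`, pulled back along `f : N → G`. -/
def thetaR (F : Type*) [NormedAddCommGroup F] [NormedSpace ℂ F]
    {N : Type*} [TopologicalSpace N] [ChartedSpace F N]
    (B : LinearMap.BilinForm ℂ (Lie E G)) (f : N → G) (p : N) (X : Lie E G) : Cotangent F p :=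
  B.flip X ∘ₗ rightLog F E f p

/-- The Poisson-Lie tensor of `r` on `G`: its contraction with the right-invariant forms
`θ_R(X)`, `θ_R(Y)` is `π_g^r(X, Y)`, see `poissonLieTensor_thetaR`. A covector `α` at `g` is
`θ_R(X)` for the element `X` that represents `α ∘ (right translation by g)` through `B`. -/
def poissonLieTensor (B : LinearMap.BilinForm ℂ (Lie E G)) (hB : B.Nondegenerate)
    (r : Lie E G →ₗ[ℂ] Lie E G) : TwoTensor E G := fun g =>
  (piR B r g).compl₁₂
    ((B.toDual hB).symm.toLinearMap ∘ₗ (rightTranslation E g).dualMap)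
    ((B.toDual hB).symm.toLinearMap ∘ₗ (rightTranslation E g).dualMap)

theorem rightLog_rightTranslation [LieGroup 𝓘(ℂ, E) ω G] (g : G) (v : Lie E G) :
    rightLog E E (id : G → G) g (rightTranslation E g v) = v := by
  have h1 : ContMDiff 𝓘(ℂ, E) 𝓘(ℂ, E) ω (fun x : G => x * g) := contMDiff_mul_right
  have h2 : ContMDiff 𝓘(ℂ, E) 𝓘(ℂ, E) ω (fun x : G => x * g⁻¹) := contMDiff_mul_right
  have hc : (fun x : G => x * g⁻¹) ∘ (fun x : G => x * g) = id := by
    funext x; simp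
  have h3 := mfderiv_comp (I := 𝓘(ℂ, E)) (I' := 𝓘(ℂ, E)) (I'' := 𝓘(ℂ, E)) (1 : G)
    (g := fun x : G => x * g⁻¹) (f := fun x : G => x * g)
    (h2.mdifferentiableAt (by simp)) (h1.mdifferentiableAt (by simp))
  rw [hc, mfderiv_id] at h3
  have h4 : mfderiv 𝓘(ℂ, E) 𝓘(ℂ, E) (id : G → G) g = ContinuousLinearMap.id ℂ _ := mfderiv_id
  have h5 : (1 : G) * g = g := one_mul g
  have h6 : mfderiv 𝓘(ℂ, E) 𝓘(ℂ, E) (fun x : G => x * g⁻¹) ((fun x : G => x * g) 1)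
      (mfderiv 𝓘(ℂ, E) 𝓘(ℂ, E) (fun x : G => x * g) 1 v) = v :=
    (DFunLike.congr_fun h3 v).symm
  have h7 : ∀ (q : G), q = g → ∀ w : E,
      (mfderiv 𝓘(ℂ, E) 𝓘(ℂ, E) (fun x : G => x * g⁻¹) g : E →L[ℂ] E) w =
        (mfderiv 𝓘(ℂ, E) 𝓘(ℂ, E) (fun x : G => x * g⁻¹) q : E →L[ℂ] E) w := by
    rintro q rfl w; rfl
  have h8 : rightLog E E (id : G → G) g (rightTranslation E g v) =
      (mfderiv 𝓘(ℂ, E) 𝓘(ℂ, E) (fun x : G => x * g⁻¹) g : E →L[ℂ] E)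
        ((mfderiv 𝓘(ℂ, E) 𝓘(ℂ, E) (id : G → G) g : E →L[ℂ] E)
          (mfderiv 𝓘(ℂ, E) 𝓘(ℂ, E) (fun x : G => x * g) 1 v)) := rfl
  rw [h8, h4]
  exact (h7 _ h5 _).trans h6

/-- The contraction of `poissonLieTensor` with the right-invariant forms. -/
theorem poissonLieTensor_thetaR [LieGroup 𝓘(ℂ, E) ω G] (B : LinearMap.BilinForm ℂ (Lie E G))
    (hB : B.Nondegenerate) (hs : B.IsSymm) (r : Lie E G →ₗ[ℂ] Lie E G) (g : G)
    (X Y : Lie E G) :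
    poissonLieTensor B hB r g (thetaR E B id g X) (thetaR E B id g Y) =
      (1 / 2 : ℂ) * (B X (r Y) - B X (Ad E g (r (Ad E g⁻¹ Y)))) := by
  have key : ∀ Z : Lie E G, (B.toDual hB).symm
      ((rightTranslation E g).dualMap (thetaR E B id g Z)) = Z := by
    intro Z
    rw [LinearEquiv.symm_apply_eq]
    refine LinearMap.ext fun v => ?_
    change B (rightLog E E (id : G → G) g (rightTranslation E g v)) Z = B Z v
    rw [rightLog_rightTranslation]
    exact hs.eq v Z
  simp only [poissonLieTensor, piR, LinearMap.compl₁₂_apply, LinearMap.comp_apply,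
    LinearEquiv.coe_coe, key]
  simp [mul_sub]

/-- `(K, Q)` is the dual Poisson-Lie group of `G` with the Poisson-Lie structure defined by `r`:
the Lie algebra of `K` is identified by `φ` with `(𝔤, [·,·]_r)`, and the linearization of `Q` at
the unit gives the Lie bracket of `𝔤`, where `𝔤` is the dual of `(𝔤, [·,·]_r)` through `B`. -/
structure IsDualGroup (B : LinearMap.BilinForm ℂ (Lie E G)) (r : Lie E G →ₗ[ℂ] Lie E G)
    (φ : Lie E G ≃ₗ[ℂ] Lie F K) (Q : TwoTensor F K) : Prop where
  map_rBracket : ∀ X Y, φ (rBracket r X Y) = ⁅φ X, φ Y⁆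
  poissonLie : IsPoissonLie Q
  linearizes : LinearizesTo Q (B.compl₂ φ.symm.toLinearMap).flip

/-- The operators `r_± = ½ (r ± c)`, for `c` a square root of `α`: take `c` and `-c`. -/
def rShift (r : Lie E G →ₗ[ℂ] Lie E G) (c : ℂ) : Lie E G →ₗ[ℂ] Lie E G :=
  (1 / 2 : ℂ) • (r + c • LinearMap.id)

/-- `u ↦ (p u, m u)` realizes the dual group `K` in the double `G × G` of a factorizable
bialgebra: its derivative at the unit is `X ↦ (r_+ X, r_- X)`. -/
structure IsFactorizableRealization (r : Lie E G →ₗ[ℂ] Lie E G) (c : ℂ)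
    (φ : Lie E G ≃ₗ[ℂ] Lie F K) (p m : K →* G) : Prop where
  holomorphic_left : ContMDiff 𝓘(ℂ, F) 𝓘(ℂ, E) ω p
  holomorphic_right : ContMDiff 𝓘(ℂ, F) 𝓘(ℂ, E) ω m
  deriv_left : ∀ X, lieMap F E p (φ X) = rShift r c X
  deriv_right : ∀ X, lieMap F E m (φ X) = rShift r (-c) X

/-- The form `tr ((dp p⁻¹ - dm m⁻¹) X)` for a pair of maps `(p, m) : N → G × G`. -/
def thetaFactorizable (F : Type*) [NormedAddCommGroup F] [NormedSpace ℂ F]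
    {N : Type*} [TopologicalSpace N] [ChartedSpace F N]
    (B : LinearMap.BilinForm ℂ (Lie E G)) (p m : N → G) (u : N) (X : Lie E G) : Cotangent F u :=
  B.flip X ∘ₗ (rightLog F E p u - rightLog F E m u)

/-- `π_{(a,b)}(X, Y) = tr (X (Ad_a - Ad_b) (r_- Ad_a⁻¹ - r_+ Ad_b⁻¹) Y)`. -/
def piFactorizable (B : LinearMap.BilinForm ℂ (Lie E G)) (r : Lie E G →ₗ[ℂ] Lie E G) (c : ℂ)
    (a b : G) (X Y : Lie E G) : ℂ :=
  B X ((Ad E a - Ad E b) (rShift r (-c) (Ad E a⁻¹ Y) - rShift r c (Ad E b⁻¹ Y)))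

/-- The Lie algebra is the model space `E` as a vector space. -/
def ofModel (E : Type*) [NormedAddCommGroup E] [NormedSpace ℂ E]
    (G : Type*) [TopologicalSpace G] [ChartedSpace E G] [Group G] : E →ₗ[ℂ] Lie E G :=
  (LinearMap.id : E →ₗ[ℂ] E)

/-- `u ↦ (p u, x u)` realizes the dual group `K` in the double `G ⋉ 𝔤` of a triangular
bialgebra, with product `(g, X) (g', X') = (g g', Ad_g X' + X)`: its derivative at the unit is
`X ↦ (½ r X, ½ X)`. The map `x` takes values in `𝔤`, which is `E` as a normed space. -/
structure IsTriangularRealization (r : Lie E G →ₗ[ℂ] Lie E G)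
    (φ : Lie E G ≃ₗ[ℂ] Lie F K) (p : K →* G) (x : K → E) : Prop where
  holomorphic_left : ContMDiff 𝓘(ℂ, F) 𝓘(ℂ, E) ω p
  holomorphic_right : ContMDiff 𝓘(ℂ, F) 𝓘(ℂ, E) ω x
  map_mul : ∀ u v, ofModel E G (x (u * v)) =
    Ad E (p u) (ofModel E G (x v)) + ofModel E G (x u)
  deriv_left : ∀ X, lieMap F E p (φ X) = (1 / 2 : ℂ) • r X
  deriv_right : ∀ X, ofModel E G (mvfderiv 𝓘(ℂ, F) x 1 (φ X)) = (1 / 2 : ℂ) • X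

/-- The form `tr ((dx + [x, dp p⁻¹]) X)` for a pair of maps `(p, x) : N → G × 𝔤`. -/
def thetaTriangular (F : Type*) [NormedAddCommGroup F] [NormedSpace ℂ F]
    {N : Type*} [TopologicalSpace N] [ChartedSpace F N] [LieGroup 𝓘(ℂ, E) ω G]
    (B : LinearMap.BilinForm ℂ (Lie E G)) (p : N → G) (x : N → E) (u : N) (X : Lie E G) :
    Cotangent F u :=
  B.flip X ∘ₗ (ofModel E G ∘ₗ (mvfderiv 𝓘(ℂ, F) x u).toLinearMap +
    LieAlgebra.ad ℂ (Lie E G) (ofModel E G (x u)) ∘ₗ rightLog F E p u)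

/-- `π_{(g,Z)}(X, Y) = -½ tr (X [Z, Y] - [Z, X] Ad_g r Ad_g⁻¹ [Z, Y])`. -/
def piTriangular (B : LinearMap.BilinForm ℂ (Lie E G)) (r : Lie E G →ₗ[ℂ] Lie E G)
    (g : G) (Z X Y : Lie E G) : ℂ :=
  -(1 / 2 : ℂ) * (B X ⁅Z, Y⁆ - B ⁅Z, X⁆ (Ad E g (r (Ad E g⁻¹ ⁅Z, Y⁆))))

end Groups

end PoissonLie

end

/-! Right translations turn a two-tensor on a Lie group into a function `η` with values in bilinear
forms on the dual of the Lie algebra. In these terms multiplicativity is the cocycle identity `η (a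
* b) = η a + Ad_a (η b)`. For a cocycle the second derivatives in the Jacobi identity cancel, up to
commutators of right-invariant fields, and an algebraic Maurer-Cartan equation remains (`mcForm`,
`jacobiator_eq`). For `π^r`, which is a coboundary, this equation is the difference of the modified
Yang-Baxter identities of `r` and of `Ad_g r Ad_g⁻¹`, which have the same constant
(`maurerCartan_rMatrix`). For the dual group the cocycle and its Maurer-Cartan equation are
extracted from the given Poisson-Lie structure.

The subalgebra `𝔥` enters through an orthogonal projection. The form `B` is a multiple of the
Killing form of `𝔤`, so its restriction to `𝔥` is proportional to the trace form of `𝔥` on `𝔤`, up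
to a factor that may be inverted. That trace form is non-zero by Cartan's criterion, and the radical
of `B` on `𝔥` is an ideal, so `B` is non-degenerate on the simple algebra `𝔥`. The projection `p`
commutes with `ad 𝔥`, and with `r` because `r` preserves `𝔥` and is antisymmetric. Consequently the
linearizations of both cocycles, in directions of `𝔥`, have no mixed terms between `𝔥` and its
complement.

Integrating over the connected subgroup, the Poisson tensor itself has no mixed terms at its points
(`IsReduction.apply_eq_zero`). Linear algebra then shows that the subgroup is Poisson-Dirac and that
its Dirac bracket is unique, namely the projection of the tensor. The projection inherits the
cocycle identity, the Maurer-Cartan equation and the linearization, and this gives the duality of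
`H` and `H_r`.

The explicit formulas on `G_r` rest on the fact that a cocycle on a connected group is determined by
its derivative at the unit (`IsCocycle.apply_eq_of_hasDerivAt`). It suffices that the proposed
expressions satisfy the cocycle identity for the coadjoint action (`piFactorizable_mul`,
`piTriangular_mul`) and have the right derivative. They restrict to `H_r` because forms labelled by
elements of `𝔥` vanish on the complement. -/

set_option linter.unusedSectionVars false

noncomputable section

namespace PoissonLie

/-! ### Derivatives in the preferred chart and symmetry of mixed derivatives -/

section ChartDeriv
open Filter Topology

variable {E : Type*} [NormedAddCommGroup E] [NormedSpace ℂ E]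
  {M : Type*} [TopologicalSpace M] [ChartedSpace E M]
  {F : Type*} [NormedAddCommGroup F] [NormedSpace ℂ F]
  {N : Type*} [TopologicalSpace N] [ChartedSpace F N]
  {V : Type*} [NormedAddCommGroup V] [NormedSpace ℂ V]

/-- The derivative of a vector valued function on a manifold, in the preferred chart at `a`. -/
def chartDeriv (E : Type*) [NormedAddCommGroup E] [NormedSpace ℂ E]
    {M : Type*} [TopologicalSpace M] [ChartedSpace E M]
    {V : Type*} [NormedAddCommGroup V] [NormedSpace ℂ V] (f : M → V) (a : M) : E →L[ℂ] V :=
  fderiv ℂ (fun s => f ((extChartAt 𝓘(ℂ, E) a).symm s)) (extChartAt 𝓘(ℂ, E) a a)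

/-- The differential of a map of manifolds, as a map of the model spaces. -/
def modelDeriv (E F : Type*) [NormedAddCommGroup E] [NormedSpace ℂ E]
    [NormedAddCommGroup F] [NormedSpace ℂ F]
    {M : Type*} [TopologicalSpace M] [ChartedSpace E M]
    {N : Type*} [TopologicalSpace N] [ChartedSpace F N] (f : M → N) (a : M) : E →L[ℂ] F :=
  mfderiv 𝓘(ℂ, E) 𝓘(ℂ, F) f a

theorem modelDeriv_eq_chartDeriv {f : M → V} {a : M}
    (hf : MDifferentiableAt 𝓘(ℂ, E) 𝓘(ℂ, V) f a) : modelDeriv E V f a = chartDeriv E f a := by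
  refine Eq.trans (b := fderivWithin ℂ (writtenInExtChartAt 𝓘(ℂ, E) 𝓘(ℂ, V) a f)
    (Set.range 𝓘(ℂ, E)) (extChartAt 𝓘(ℂ, E) a a)) hf.mfderiv ?_
  rw [ModelWithCorners.range_eq_univ, fderivWithin_univ]
  rfl

/-- The base point `b` is a variable with an equation, here and below, so that points such as `1 *
u` and `u` can be exchanged without transport between tangent spaces. -/
theorem modelDeriv_eq_chartDeriv_extChartAt {f : M → N} {a : M} {b : N} (hb : f a = b)
    (hf : MDifferentiableAt 𝓘(ℂ, E) 𝓘(ℂ, F) f a) :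
    modelDeriv E F f a = chartDeriv E (fun m => extChartAt 𝓘(ℂ, F) b (f m)) a := by
  subst hb
  refine Eq.trans (b := fderivWithin ℂ (writtenInExtChartAt 𝓘(ℂ, E) 𝓘(ℂ, F) a f)
    (Set.range 𝓘(ℂ, E)) (extChartAt 𝓘(ℂ, E) a a)) hf.mfderiv ?_
  rw [ModelWithCorners.range_eq_univ, fderivWithin_univ]
  rfl

theorem modelDeriv_comp {P : Type*} [NormedAddCommGroup P] [NormedSpace ℂ P]
    {Q : Type*} [TopologicalSpace Q] [ChartedSpace P Q] {g : M → N} {f : N → Q} {a : M} {b : N}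
    (hb : g a = b) (hf : MDifferentiableAt 𝓘(ℂ, F) 𝓘(ℂ, P) f b)
    (hg : MDifferentiableAt 𝓘(ℂ, E) 𝓘(ℂ, F) g a) :
    modelDeriv E P (fun m => f (g m)) a = (modelDeriv F P f b).comp (modelDeriv E F g a) := by
  subst hb
  exact mfderiv_comp a hf hg

theorem chartDeriv_comp {g : M → N} {f : N → V} {a : M} {b : N} (hb : g a = b)
    (hf : MDifferentiableAt 𝓘(ℂ, F) 𝓘(ℂ, V) f b)
    (hg : MDifferentiableAt 𝓘(ℂ, E) 𝓘(ℂ, F) g a) :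
    chartDeriv E (fun m => f (g m)) a = (chartDeriv F f b).comp (modelDeriv E F g a) := by
  subst hb
  have h : MDifferentiableAt 𝓘(ℂ, E) 𝓘(ℂ, V) (fun m => f (g m)) a := hf.comp a hg
  rw [← modelDeriv_eq_chartDeriv h, ← modelDeriv_eq_chartDeriv hf]
  exact modelDeriv_comp rfl hf hg

theorem mdifferentiableAt_comp {P : Type*} [NormedAddCommGroup P] [NormedSpace ℂ P]
    {Q : Type*} [TopologicalSpace Q] [ChartedSpace P Q] {g : M → N} {f : N → Q} {a : M} {b : N}
    (hb : g a = b) (hf : MDifferentiableAt 𝓘(ℂ, F) 𝓘(ℂ, P) f b)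
    (hg : MDifferentiableAt 𝓘(ℂ, E) 𝓘(ℂ, F) g a) :
    MDifferentiableAt 𝓘(ℂ, E) 𝓘(ℂ, P) (fun m => f (g m)) a := by
  subst hb
  exact hf.comp a hg

theorem chartDeriv_congr {f g : M → V} {a : M} (h : f =ᶠ[𝓝 a] g) :
    chartDeriv E f a = chartDeriv E g a := by
  unfold chartDeriv
  refine Filter.EventuallyEq.fderiv_eq ?_
  have h1 : Tendsto (extChartAt 𝓘(ℂ, E) a).symm (𝓝 (extChartAt 𝓘(ℂ, E) a a)) (𝓝 a) := by
    simpa using (continuousAt_extChartAt_symm (I := 𝓘(ℂ, E)) a).tendsto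
  exact h1.eventually h

/-- Functions that are differentiable in the preferred chart. -/
theorem differentiableAt_chart {f : M → V} {a : M}
    (hf : MDifferentiableAt 𝓘(ℂ, E) 𝓘(ℂ, V) f a) :
    DifferentiableAt ℂ (fun s => f ((extChartAt 𝓘(ℂ, E) a).symm s)) (extChartAt 𝓘(ℂ, E) a a) := by
  have := hf.differentiableWithinAt_writtenInExtChartAt
  rw [ModelWithCorners.range_eq_univ, differentiableWithinAt_univ] at this
  exact this

/-- The straight curve through `a` in the preferred chart. -/
def chartCurve (E : Type*) [NormedAddCommGroup E] [NormedSpace ℂ E]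
    {M : Type*} [TopologicalSpace M] [ChartedSpace E M] (a : M) (x : E) (t : ℂ) : M :=
  (extChartAt 𝓘(ℂ, E) a).symm (extChartAt 𝓘(ℂ, E) a a + t • x)

@[simp] theorem chartCurve_zero (a : M) (x : E) : chartCurve E a x 0 = a := by
  simp [chartCurve]

theorem hasDerivAt_chartCurve {f : M → V} {a : M}
    (hf : MDifferentiableAt 𝓘(ℂ, E) 𝓘(ℂ, V) f a) (x : E) :
    HasDerivAt (fun t => f (chartCurve E a x t)) (chartDeriv E f a x) 0 := by
  have h1 := (differentiableAt_chart hf).hasFDerivAt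
  have h2 : HasDerivAt (fun t : ℂ => extChartAt 𝓘(ℂ, E) a a + t • x) x 0 := by
    simpa using ((hasDerivAt_id (0 : ℂ)).smul_const x).const_add (extChartAt 𝓘(ℂ, E) a a)
  have h3 := HasFDerivAt.comp_hasDerivAt_of_eq (0 : ℂ) h1 h2 (by simp)
  exact h3

/-- Both sides are values of the second derivative of `f` at `(a, b)` on the vectors `(x, 0)` and
`(0, y)`, and the second derivative is symmetric. -/
theorem fderiv_fderiv_swap {f : E × F → V} {a : E} {b : F} (hf : ContDiffAt ℂ ω f (a, b))
    (x : E) (y : F) :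
    fderiv ℂ (fun s => fderiv ℂ (fun t => f (s, t)) b y) a x =
      fderiv ℂ (fun t => fderiv ℂ (fun s => f (s, t)) a x) b y := by
  have hd : ∀ᶠ p in 𝓝 (a, b), DifferentiableAt ℂ f p := by
    filter_upwards [(hf.of_le (m := 1) (by simp)).eventually (by simp)] with p hp
    exact hp.differentiableAt (by simp)
  have h1 : ∀ᶠ s in 𝓝 a, fderiv ℂ (fun t => f (s, t)) b y = fderiv ℂ f (s, b) (0, y) := by
    have : Tendsto (fun s : E => (s, b)) (𝓝 a) (𝓝 (a, b)) :=
      (Continuous.prodMk_left b).tendsto a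
    filter_upwards [this.eventually hd] with s hs
    have := hs.hasFDerivAt.comp b (hasFDerivAt_prodMk_right s b)
    exact (congrArg (fun L : F →L[ℂ] V => L y) this.fderiv).trans (by simp)
  have h2 : ∀ᶠ t in 𝓝 b, fderiv ℂ (fun s => f (s, t)) a x = fderiv ℂ f (a, t) (x, 0) := by
    have : Tendsto (fun t : F => (a, t)) (𝓝 b) (𝓝 (a, b)) :=
      (Continuous.prodMk_right a).tendsto b
    filter_upwards [this.eventually hd] with t ht
    have := HasFDerivAt.comp (f := fun s : E => (s, t)) a ht.hasFDerivAt (hasFDerivAt_prodMk_left a t)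
    exact (congrArg (fun L : E →L[ℂ] V => L x) this.fderiv).trans (by simp)
  rw [Filter.EventuallyEq.fderiv_eq h1, Filter.EventuallyEq.fderiv_eq h2]
  have hdd : DifferentiableAt ℂ (fderiv ℂ f) (a, b) :=
    (hf.fderiv_right (m := 1) (by exact le_top)).differentiableAt (by simp)
  have e1 := (HasFDerivAt.comp (f := fun s : E => (s, b)) a hdd.hasFDerivAt
    (hasFDerivAt_prodMk_left a b)).clm_apply
    (hasFDerivAt_const ((0 : E), y) a)
  have e2 := (HasFDerivAt.comp (f := fun t : F => (a, t)) b hdd.hasFDerivAt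
    (hasFDerivAt_prodMk_right a b)).clm_apply
    (hasFDerivAt_const (x, (0 : F)) b)
  have e3 := (congrArg (fun L : E →L[ℂ] V => L x) e1.fderiv)
  have e4 := (congrArg (fun L : F →L[ℂ] V => L y) e2.fderiv)
  refine e3.trans (Eq.trans ?_ e4.symm)
  have hs : IsSymmSndFDerivAt ℂ f (a, b) :=
    hf.isSymmSndFDerivAt (by simp)
  simpa using hs (x, 0) (0, y)

/-- The partial derivative is the total derivative restricted to one factor. This is the source of
the holomorphy of `Ad` and of invariant derivatives, both being partial derivatives of functions on
`G × G`. -/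
theorem contDiffAt_fderiv_right {f : E × F → V} {a : E} {b : F} (hf : ContDiffAt ℂ ω f (a, b)) :
    ContDiffAt ℂ ω (fun s => fderiv ℂ (fun t => f (s, t)) b) a := by
  have hd : ∀ᶠ p in 𝓝 (a, b), DifferentiableAt ℂ f p := by
    filter_upwards [(hf.of_le (m := 1) (by simp)).eventually (by simp)] with p hp
    exact hp.differentiableAt (by simp)
  have h1 : ∀ᶠ s in 𝓝 a, fderiv ℂ (fun t => f (s, t)) b =
      (fderiv ℂ f (s, b)).comp (ContinuousLinearMap.inr ℂ E F) := by
    have : Tendsto (fun s : E => (s, b)) (𝓝 a) (𝓝 (a, b)) :=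
      (Continuous.prodMk_left b).tendsto a
    filter_upwards [this.eventually hd] with s hs
    exact (hs.hasFDerivAt.comp b (hasFDerivAt_prodMk_right s b)).fderiv
  refine ContDiffAt.congr_of_eventuallyEq ?_ h1
  have h2 : ContDiffAt ℂ ω (fderiv ℂ f) (a, b) := hf.fderiv_right (by exact le_top)
  exact (h2.comp a (contDiffAt_id.prodMk contDiffAt_const)).clm_comp contDiffAt_const

theorem chartDeriv_extChartAt (a : M) (x : E) :
    chartDeriv E (extChartAt 𝓘(ℂ, E) a) a x = x := by
  unfold chartDeriv
  have : (fun s => extChartAt 𝓘(ℂ, E) a ((extChartAt 𝓘(ℂ, E) a).symm s)) =ᶠ[𝓝 (extChartAt 𝓘(ℂ, E) a a)] id := by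
    filter_upwards [extChartAt_target_mem_nhds (I := 𝓘(ℂ, E)) a] with s hs
    exact (extChartAt 𝓘(ℂ, E) a).right_inv hs
  rw [this.fderiv_eq]; simp

variable [IsManifold 𝓘(ℂ, E) ω M] [IsManifold 𝓘(ℂ, F) ω N]

theorem contDiffAt_chart_prod {f : M × N → V} {a : M} {b : N}
    (hf : ContMDiffAt (𝓘(ℂ, E).prod 𝓘(ℂ, F)) 𝓘(ℂ, V) ω f (a, b)) :
    ContDiffAt ℂ ω (fun p : E × F => f ((extChartAt 𝓘(ℂ, E) a).symm p.1,
      (extChartAt 𝓘(ℂ, F) b).symm p.2)) (extChartAt 𝓘(ℂ, E) a a, extChartAt 𝓘(ℂ, F) b b) := by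
  have h := (contMDiffAt_iff.1 hf).2
  rw [ModelWithCorners.range_eq_univ, contDiffWithinAt_univ] at h
  exact h

theorem chartDeriv_swap {f : M × N → V} {a : M} {b : N}
    (hf : ContMDiffAt (𝓘(ℂ, E).prod 𝓘(ℂ, F)) 𝓘(ℂ, V) ω f (a, b)) (x : E) (y : F) :
    chartDeriv E (fun m => chartDeriv F (fun n => f (m, n)) b y) a x =
      chartDeriv F (fun n => chartDeriv E (fun m => f (m, n)) a x) b y :=
  fderiv_fderiv_swap (contDiffAt_chart_prod hf) x y

theorem contMDiffAt_chartDeriv {f : M × N → V} {a : M} {b : N}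
    (hf : ContMDiffAt (𝓘(ℂ, E).prod 𝓘(ℂ, F)) 𝓘(ℂ, V) ω f (a, b)) :
    ContMDiffAt 𝓘(ℂ, E) 𝓘(ℂ, F →L[ℂ] V) ω
      (fun m => chartDeriv F (fun n => f (m, n)) b) a := by
  have h1 := contDiffAt_fderiv_right (contDiffAt_chart_prod hf)
  have h2 := h1.contMDiffAt.comp a (contMDiffAt_extChartAt (I := 𝓘(ℂ, E)) (n := ω) (x := a))
  refine h2.congr_of_eventuallyEq ?_
  filter_upwards [extChartAt_source_mem_nhds (I := 𝓘(ℂ, E)) a] with m hm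
  simp only [Function.comp_apply, (extChartAt 𝓘(ℂ, E) a).left_inv hm]
  rfl

end ChartDeriv

/-! ### Invariant derivatives on a group, and the Lie bracket as derivative of `Ad` -/

section GroupDeriv
open Filter Topology

variable {E : Type*} [NormedAddCommGroup E] [NormedSpace ℂ E]
  {M : Type*} [TopologicalSpace M] [ChartedSpace E M]
  {F : Type*} [NormedAddCommGroup F] [NormedSpace ℂ F]
  {N : Type*} [TopologicalSpace N] [ChartedSpace F N]
  {V : Type*} [NormedAddCommGroup V] [NormedSpace ℂ V]

variable {G : Type*} [TopologicalSpace G] [ChartedSpace E G] [Group G]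
  {K : Type*} [TopologicalSpace K] [ChartedSpace F K] [Group K]

/-- The derivative along right-invariant fields. -/
def rightDeriv (E : Type*) [NormedAddCommGroup E] [NormedSpace ℂ E]
    {G : Type*} [TopologicalSpace G] [ChartedSpace E G] [Group G]
    {V : Type*} [NormedAddCommGroup V] [NormedSpace ℂ V] (f : G → V) (u : G) : E →L[ℂ] V :=
  chartDeriv E (fun s => f (s * u)) 1

/-- The derivative along left-invariant fields. -/
def leftDeriv (E : Type*) [NormedAddCommGroup E] [NormedSpace ℂ E]
    {G : Type*} [TopologicalSpace G] [ChartedSpace E G] [Group G]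
    {V : Type*} [NormedAddCommGroup V] [NormedSpace ℂ V] (f : G → V) (u : G) : E →L[ℂ] V :=
  chartDeriv E (fun s => f (u * s)) 1

@[simp] theorem rightDeriv_one (f : G → V) : rightDeriv E f 1 = chartDeriv E f 1 := by
  simp [rightDeriv]

@[simp] theorem leftDeriv_one (f : G → V) : leftDeriv E f 1 = chartDeriv E f 1 := by
  simp [leftDeriv]

variable [LieGroup 𝓘(ℂ, E) ω G] [LieGroup 𝓘(ℂ, F) ω K]

theorem mdifferentiable_mul_right (u : G) :
    MDifferentiable 𝓘(ℂ, E) 𝓘(ℂ, E) (fun x : G => x * u) :=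
  (contMDiff_mul_right (n := ω)).mdifferentiable (by simp)

theorem mdifferentiable_mul_left (u : G) :
    MDifferentiable 𝓘(ℂ, E) 𝓘(ℂ, E) (fun x : G => u * x) :=
  (contMDiff_mul_left (n := ω)).mdifferentiable (by simp)

theorem mdifferentiable_conj (g : G) :
    MDifferentiable 𝓘(ℂ, E) 𝓘(ℂ, E) (fun x : G => g * x * g⁻¹) :=
  ((contMDiff_const.mul contMDiff_id).mul contMDiff_const : ContMDiff 𝓘(ℂ, E) 𝓘(ℂ, E) ω
    (fun x : G => g * x * g⁻¹)).mdifferentiable (by simp)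

theorem chartDeriv_rightTranslation {f : G → V} {u : G}
    (hf : MDifferentiableAt 𝓘(ℂ, E) 𝓘(ℂ, V) f u) :
    (chartDeriv E f u).comp (modelDeriv E E (fun x : G => x * u) 1) = rightDeriv E f u :=
  (chartDeriv_comp (g := fun x : G => x * u) (one_mul u) hf (mdifferentiable_mul_right u 1)).symm

/-- The adjoint action as a continuous linear map of the model space. -/
def AdCLM (E : Type*) [NormedAddCommGroup E] [NormedSpace ℂ E]
    {G : Type*} [TopologicalSpace G] [ChartedSpace E G] [Group G] (g : G) : E →L[ℂ] E :=
  modelDeriv E E (fun s : G => g * s * g⁻¹) 1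

theorem AdCLM_eq (g : G) :
    AdCLM E g = chartDeriv E (fun s : G => extChartAt 𝓘(ℂ, E) (1 : G) (g * s * g⁻¹)) 1 :=
  modelDeriv_eq_chartDeriv_extChartAt (by simp) (mdifferentiable_conj g 1)

theorem chartDeriv_conj {f : G → V} (hf : MDifferentiableAt 𝓘(ℂ, E) 𝓘(ℂ, V) f 1) (g : G) :
    chartDeriv E (fun s : G => f (g * s * g⁻¹)) 1 = (chartDeriv E f 1).comp (AdCLM E g) :=
  chartDeriv_comp (by simp) hf (mdifferentiable_conj g 1)

/-- Write `u * s = (u * s * u⁻¹) * u`. -/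
theorem leftDeriv_eq_rightDeriv {f : G → V} {u : G}
    (hf : MDifferentiableAt 𝓘(ℂ, E) 𝓘(ℂ, V) f u) :
    leftDeriv E f u = (rightDeriv E f u).comp (AdCLM E u) := by
  rw [rightDeriv, ← chartDeriv_conj (mdifferentiableAt_comp (one_mul u) hf
    (mdifferentiable_mul_right u 1))]
  simp [leftDeriv]

theorem mdifferentiableAt_extChartAt_one :
    MDifferentiableAt 𝓘(ℂ, E) 𝓘(ℂ, E) (extChartAt 𝓘(ℂ, E) (1 : G)) 1 :=
  (contMDiffAt_extChartAt (n := ω)).mdifferentiableAt (by simp)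

theorem AdCLM_one : AdCLM E (1 : G) = ContinuousLinearMap.id ℂ E := by
  ext x
  rw [AdCLM_eq]
  simpa using chartDeriv_extChartAt (1 : G) x

theorem AdCLM_mul (g h : G) : AdCLM E (g * h) = (AdCLM E g).comp (AdCLM E h) := by
  have := modelDeriv_comp (E := E) (F := E) (P := E) (f := fun s : G => g * s * g⁻¹)
    (g := fun s : G => h * s * h⁻¹) (a := 1) (b := 1) (by simp)
    (mdifferentiable_conj g 1) (mdifferentiable_conj h 1)
  rw [AdCLM, AdCLM, AdCLM, ← this]
  simp [mul_assoc]

theorem contMDiff_AdCLM : ContMDiff 𝓘(ℂ, E) 𝓘(ℂ, E →L[ℂ] E) ω (AdCLM E : G → E →L[ℂ] E) := by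
  have h0 : (AdCLM E : G → E →L[ℂ] E) = fun g =>
      chartDeriv E (fun s : G => extChartAt 𝓘(ℂ, E) (1 : G) (g * s * g⁻¹)) 1 := funext AdCLM_eq
  rw [h0]
  intro g
  refine contMDiffAt_chartDeriv (f := fun p : G × G =>
    extChartAt 𝓘(ℂ, E) (1 : G) (p.1 * p.2 * p.1⁻¹)) ?_
  have h1 : ContMDiffAt 𝓘(ℂ, E) 𝓘(ℂ, E) ω (extChartAt 𝓘(ℂ, E) (1 : G)) (g * 1 * g⁻¹) := by
    rw [mul_one, mul_inv_cancel]; exact contMDiffAt_extChartAt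
  have h2 : ContMDiff (𝓘(ℂ, E).prod 𝓘(ℂ, E)) 𝓘(ℂ, E) ω
      (fun p : G × G => p.1 * p.2 * p.1⁻¹) :=
    (contMDiff_fst.mul contMDiff_snd).mul contMDiff_fst.inv
  exact ContMDiffAt.comp (g := extChartAt 𝓘(ℂ, E) (1 : G)) (g, (1 : G)) h1 h2.contMDiffAt

theorem contMDiffAt_mul_uncurry {f : G → V} {a b : G}
    (hf : ContMDiffAt 𝓘(ℂ, E) 𝓘(ℂ, V) ω f (a * b)) :
    ContMDiffAt (𝓘(ℂ, E).prod 𝓘(ℂ, E)) 𝓘(ℂ, V) ω (fun p : G × G => f (p.1 * p.2)) (a, b) :=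
  ContMDiffAt.comp (g := f) (a, b) hf (contMDiff_fst.mul contMDiff_snd).contMDiffAt

theorem contMDiffAt_mul_uncurry' {f : G → V} {a b : G}
    (hf : ContMDiffAt 𝓘(ℂ, E) 𝓘(ℂ, V) ω f (b * a)) :
    ContMDiffAt (𝓘(ℂ, E).prod 𝓘(ℂ, E)) 𝓘(ℂ, V) ω (fun p : G × G => f (p.2 * p.1)) (a, b) :=
  ContMDiffAt.comp (g := f) (a, b) hf (contMDiff_snd.mul contMDiff_fst).contMDiffAt

theorem contMDiffAt_rightDeriv {f : G → V} {u : G} (hf : ContMDiffAt 𝓘(ℂ, E) 𝓘(ℂ, V) ω f u) :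
    ContMDiffAt 𝓘(ℂ, E) 𝓘(ℂ, E →L[ℂ] V) ω (rightDeriv E f) u :=
  contMDiffAt_chartDeriv (f := fun p : G × G => f (p.2 * p.1))
    (contMDiffAt_mul_uncurry' (by rwa [one_mul]))

theorem eventually_contMDiffAt {f : G → V} {u : G} (hf : ContMDiffAt 𝓘(ℂ, E) 𝓘(ℂ, V) ω f u) :
    ∀ᶠ v in 𝓝 u, ContMDiffAt 𝓘(ℂ, E) 𝓘(ℂ, V) ω f v :=
  (contMDiffAt_iff_contMDiffAt_nhds (by simp)).1 hf

/-- Commutation of left and right derivatives at the unit. -/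
theorem chartDeriv_leftDeriv_swap {f : G → V} (hf : ContMDiffAt 𝓘(ℂ, E) 𝓘(ℂ, V) ω f 1) (x y : E) :
    chartDeriv E (fun g => leftDeriv E f g y) 1 x = chartDeriv E (fun g => rightDeriv E f g x) 1 y :=
  chartDeriv_swap (f := fun p : G × G => f (p.1 * p.2)) (contMDiffAt_mul_uncurry (by simpa)) x y

/-- The derivative of the adjoint action at the unit. -/
def adDeriv (E : Type*) [NormedAddCommGroup E] [NormedSpace ℂ E]
    {G : Type*} [TopologicalSpace G] [ChartedSpace E G] [Group G] (x y : E) : E :=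
  chartDeriv E (AdCLM E : G → E →L[ℂ] E) 1 x y

theorem hasDerivAt_AdCLM (x : E) :
    HasDerivAt (fun t => AdCLM E (chartCurve E (1 : G) x t))
      (chartDeriv E (AdCLM E : G → E →L[ℂ] E) 1 x) 0 :=
  hasDerivAt_chartCurve (contMDiff_AdCLM.mdifferentiableAt (by simp)) x

/-- Near the unit the left derivative along `y` at `g` is the right derivative along `Ad_g y`. The
product rule gives one term where `Ad` is differentiated, and one where left and right derivatives
commute. -/
theorem chartDeriv_leftDeriv {f : G → V} (hf : ContMDiffAt 𝓘(ℂ, E) 𝓘(ℂ, V) ω f 1) (x y : E) :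
    chartDeriv E (fun g => leftDeriv E f g y) 1 x =
      chartDeriv E (fun g => leftDeriv E f g x) 1 y + chartDeriv E f 1 (adDeriv E (G := G) x y) := by
  have e1 : (fun g : G => leftDeriv E f g y) =ᶠ[𝓝 1] fun g => rightDeriv E f g (AdCLM E g y) := by
    filter_upwards [eventually_contMDiffAt hf] with g hg
    rw [leftDeriv_eq_rightDeriv (hg.mdifferentiableAt (by simp))]
    rfl
  rw [chartDeriv_congr e1]
  have d1 := hasDerivAt_chartCurve
    ((contMDiffAt_rightDeriv hf).mdifferentiableAt (by simp)) x
  have d2 := (hasDerivAt_AdCLM (G := G) x).clm_apply (hasDerivAt_const 0 y)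
  have d3 := d1.clm_apply d2
  have m1 : ContMDiffAt 𝓘(ℂ, E) 𝓘(ℂ, V) ω (fun g : G => rightDeriv E f g (AdCLM E g y)) 1 :=
    (contMDiffAt_rightDeriv hf).clm_apply (contMDiff_AdCLM.contMDiffAt.clm_apply contMDiffAt_const)
  have d4 := hasDerivAt_chartCurve (m1.mdifferentiableAt (by simp)) x
  rw [d4.unique d3]
  have d5 := d1.clm_apply (hasDerivAt_const 0 y)
  have d6 := hasDerivAt_chartCurve (f := fun g => rightDeriv E f g y)
    (((contMDiffAt_rightDeriv hf).clm_apply contMDiffAt_const).mdifferentiableAt (by simp)) x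
  have d7 := d6.unique d5
  rw [chartDeriv_leftDeriv_swap hf, d7]
  simp [AdCLM_one, adDeriv]

variable [CompleteSpace E] [CompleteSpace F]

/-- The Lie bracket on the model space. -/
def modelLie (G : Type*) [TopologicalSpace G] [ChartedSpace E G] [Group G] (x y : E) : E :=
  (⁅(show Lie E G from x), (show Lie E G from y)⁆ : Lie E G)

/-- The bracket is that of left-invariant fields, computed in the chart at the unit. There the field
of `z` has as coefficients the left derivative along `z` of the chart itself. -/
theorem modelLie_eq_chartDeriv (x y : E) :
    modelLie G x y = chartDeriv E (fun g => leftDeriv E (extChartAt 𝓘(ℂ, E) (1 : G)) g y) 1 x -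
      chartDeriv E (fun g => leftDeriv E (extChartAt 𝓘(ℂ, E) (1 : G)) g x) 1 y := by
  have h1 : ∀ z : E, (VectorField.mpullbackWithin 𝓘(ℂ, E) 𝓘(ℂ, E)
      (extChartAt 𝓘(ℂ, E) (1 : G)).symm
      (mulInvariantVectorField (I := 𝓘(ℂ, E)) (G := G) z) (Set.range 𝓘(ℂ, E)) : E → E)
        =ᶠ[𝓝 (extChartAt 𝓘(ℂ, E) (1 : G) 1)]
      fun s => leftDeriv E (extChartAt 𝓘(ℂ, E) (1 : G)) ((extChartAt 𝓘(ℂ, E) (1 : G)).symm s) z := by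
    intro z
    filter_upwards [extChartAt_target_mem_nhds (I := 𝓘(ℂ, E)) (1 : G)] with s hs
    have i1 := ContinuousLinearMap.inverse_eq
      (mfderivWithin_extChartAt_symm_comp_mfderiv_extChartAt hs)
      (mfderiv_extChartAt_comp_mfderivWithin_extChartAt_symm hs)
    have d1 : MDifferentiableAt 𝓘(ℂ, E) 𝓘(ℂ, E) (extChartAt 𝓘(ℂ, E) (1 : G))
        ((extChartAt 𝓘(ℂ, E) (1 : G)).symm s) :=
      mdifferentiableAt_extChartAt (by
        simpa using (extChartAt 𝓘(ℂ, E) (1 : G)).map_target hs)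
    have d2 := chartDeriv_comp (g := fun t : G => (extChartAt 𝓘(ℂ, E) (1 : G)).symm s * t)
      (mul_one _) d1 (mdifferentiable_mul_left _ 1)
    rw [← modelDeriv_eq_chartDeriv d1] at d2
    refine Eq.trans ?_ (congrArg (fun L : E →L[ℂ] E => L z) d2).symm
    exact congrArg (fun L : E →L[ℂ] E => L _) i1
  have h2 : ∀ z : E, leftDeriv E (extChartAt 𝓘(ℂ, E) (1 : G))
      ((extChartAt 𝓘(ℂ, E) (1 : G)).symm (extChartAt 𝓘(ℂ, E) (1 : G) 1)) z = z := by
    intro z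
    rw [extChartAt_to_inv, leftDeriv_one, chartDeriv_extChartAt]
  have h3 : modelDeriv E E (extChartAt 𝓘(ℂ, E) (1 : G)) 1 =
      ContinuousLinearMap.id ℂ E := by
    refine (modelDeriv_eq_chartDeriv mdifferentiableAt_extChartAt_one).trans ?_
    ext z; exact chartDeriv_extChartAt (1 : G) z
  -- The pulled back fields become an opaque `W`, of which only the germs matter; the definition of
  -- the bracket is unfolded just here.
  obtain ⟨W, hW, h4⟩ : ∃ W : E → E → E, (∀ z, W z =ᶠ[𝓝 (extChartAt 𝓘(ℂ, E) (1 : G) 1)]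
      fun s => leftDeriv E (extChartAt 𝓘(ℂ, E) (1 : G)) ((extChartAt 𝓘(ℂ, E) (1 : G)).symm s) z) ∧
      modelLie G x y = (modelDeriv E E (extChartAt 𝓘(ℂ, E) (1 : G)) 1).inverse
        (VectorField.lieBracketWithin ℂ (W x) (W y)
          ((extChartAt 𝓘(ℂ, E) (1 : G)).symm ⁻¹' Set.univ ∩ Set.range 𝓘(ℂ, E))
          (extChartAt 𝓘(ℂ, E) (1 : G) 1)) := ⟨_, h1, rfl⟩
  rw [h4, h3, ContinuousLinearMap.inverse_id, ModelWithCorners.range_eq_univ, Set.preimage_univ,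
    Set.univ_inter, VectorField.lieBracketWithin_univ,
    Filter.EventuallyEq.lieBracket_vectorField_eq (hW x) (hW y)]
  simp only [VectorField.lieBracket, h2]
  rfl

/-- Apply `chartDeriv_leftDeriv` to the chart at the unit, whose derivative is the identity. -/
theorem adDeriv_eq_modelLie (x y : E) : adDeriv E (G := G) x y = modelLie G x y := by
  rw [modelLie_eq_chartDeriv, chartDeriv_leftDeriv contMDiffAt_extChartAt x y, chartDeriv_extChartAt]
  abel

end GroupDeriv

/-! ### Derivatives in finite-dimensional spaces, tested on functionals so that no norm is needed -/

section WeakDerivative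

variable {W : Type*} [AddCommGroup W] [Module ℂ W]
  {W₁ : Type*} [AddCommGroup W₁] [Module ℂ W₁]
  {W₂ : Type*} [AddCommGroup W₂] [Module ℂ W₂]

/-- Derivative at `0` of a curve in a finite dimensional complex vector space, tested on
linear functionals. -/
def HasWDeriv (w : ℂ → W) (w' : W) : Prop :=
  ∀ l : Module.Dual ℂ W, HasDerivAt (fun t => l (w t)) (l w') 0

theorem hasWDeriv_iff {f : ℂ → ℂ} {f' : ℂ} : HasWDeriv f f' ↔ HasDerivAt f f' 0 := by
  refine ⟨fun h => h LinearMap.id, fun h l => ?_⟩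
  obtain ⟨c, e⟩ : ∃ c, ∀ z : ℂ, l z = c * z := ⟨l 1, fun z => by
    have := l.map_smul z 1
    simpa [mul_comm] using this⟩
  simp only [e]
  exact h.const_mul _

theorem HasWDeriv.unique {w : ℂ → W} {a b : W} (ha : HasWDeriv w a) (hb : HasWDeriv w b) :
    a = b := by
  refine (Module.forall_dual_apply_eq_zero_iff ℂ (a - b)).1 (fun l => ?_) |> sub_eq_zero.1
  rw [map_sub, (ha l).unique (hb l), sub_self]

theorem hasWDeriv_const (c : W) : HasWDeriv (fun _ => c) 0 := fun l => by
  simpa using hasDerivAt_const (0 : ℂ) (l c)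

theorem HasWDeriv.add {v w : ℂ → W} {v' w' : W} (hv : HasWDeriv v v') (hw : HasWDeriv w w') :
    HasWDeriv (fun t => v t + w t) (v' + w') := fun l => by
  simpa only [map_add] using (hv l).fun_add (hw l)

theorem HasWDeriv.sub {v w : ℂ → W} {v' w' : W} (hv : HasWDeriv v v') (hw : HasWDeriv w w') :
    HasWDeriv (fun t => v t - w t) (v' - w') := fun l => by
  simpa only [map_sub] using (hv l).fun_sub (hw l)

theorem HasWDeriv.map {w : ℂ → W} {w' : W} (hw : HasWDeriv w w') (T : W →ₗ[ℂ] W₁) :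
    HasWDeriv (fun t => T (w t)) (T w') := fun l => hw (l ∘ₗ T)

theorem HasWDeriv.congr_deriv {w : ℂ → W} {a b : W} (h : HasWDeriv w a) (e : a = b) :
    HasWDeriv w b := e ▸ h

/-- Expanding the first argument in a basis reduces the statement to the product rule for scalar
functions. Evaluation and composition of linear maps are special cases. -/
theorem HasWDeriv.bilin [FiniteDimensional ℂ W₁] [FiniteDimensional ℂ W₂]
    (β : W₁ →ₗ[ℂ] W₂ →ₗ[ℂ] W) {v : ℂ → W₁} {w : ℂ → W₂} {v' : W₁} {w' : W₂}
    (hv : HasWDeriv v v') (hw : HasWDeriv w w') :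
    HasWDeriv (fun t => β (v t) (w t)) (β v' (w 0) + β (v 0) w') := fun l => by
  let b := Module.finBasis ℂ W₁
  have e : ∀ (x : W₁) (y : W₂), l (β x y) = ∑ i, b.coord i x * l (β (b i) y) := fun x y => by
    conv_lhs => rw [← b.sum_repr x]
    simp only [map_sum, map_smul, LinearMap.sum_apply, LinearMap.smul_apply, smul_eq_mul,
      Module.Basis.coord_apply]
  rw [show (fun t => l (β (v t) (w t))) = _ from funext fun t => e _ _, map_add, e v', e (v 0),
    ← Finset.sum_add_distrib]
  refine HasDerivAt.fun_sum fun i _ => ?_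
  exact (hv (b.coord i)).mul (hw (l ∘ₗ β (b i)))

/-- A functional on linear maps is a sum of functionals of the values on a basis. -/
theorem hasWDeriv_linearMap [FiniteDimensional ℂ W₁] {A : ℂ → W₁ →ₗ[ℂ] W₂}
    {A' : W₁ →ₗ[ℂ] W₂} (h : ∀ v, HasWDeriv (fun t => A t v) (A' v)) : HasWDeriv A A' := fun l => by
  let b := Module.finBasis ℂ W₁
  have e : ∀ T : W₁ →ₗ[ℂ] W₂, l T =
      ∑ i, (l ∘ₗ LinearMap.smulRightₗ (b.coord i)) (T (b i)) := fun T => by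
    have : T = ∑ i, LinearMap.smulRightₗ (b.coord i) (T (b i)) := by
      refine b.ext fun j => ?_
      simp [Finsupp.single_apply]
    conv_lhs => rw [this]
    simp
  simp only [e]
  exact HasDerivAt.fun_sum fun i _ => h (b i) _

theorem HasWDeriv.apply {A : ℂ → W₁ →ₗ[ℂ] W₂} {A' : W₁ →ₗ[ℂ] W₂} (h : HasWDeriv A A') (v : W₁) :
    HasWDeriv (fun t => A t v) (A' v) := h.map (LinearMap.applyₗ v)

theorem HasWDeriv.eval [FiniteDimensional ℂ W₁] [FiniteDimensional ℂ W₂]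
    {A : ℂ → W₁ →ₗ[ℂ] W₂} {A' : W₁ →ₗ[ℂ] W₂} {v : ℂ → W₁} {v' : W₁}
    (h : HasWDeriv A A') (hv : HasWDeriv v v') :
    HasWDeriv (fun t => A t (v t)) (A' (v 0) + A 0 v') :=
  HasWDeriv.bilin LinearMap.id h hv

theorem HasWDeriv.comp [FiniteDimensional ℂ W₁] [FiniteDimensional ℂ W₂] [FiniteDimensional ℂ W]
    {A : ℂ → W₁ →ₗ[ℂ] W₂} {A' : W₁ →ₗ[ℂ] W₂} {C : ℂ → W →ₗ[ℂ] W₁} {C' : W →ₗ[ℂ] W₁}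
    (h : HasWDeriv A A') (hv : HasWDeriv C C') :
    HasWDeriv (fun t => A t ∘ₗ C t) (A' ∘ₗ C 0 + A 0 ∘ₗ C') :=
  HasWDeriv.bilin (LinearMap.llcomp ℂ W W₁ W₂) h hv

end WeakDerivative

/-! ### Holomorphic maps to finite-dimensional spaces, tested on functionals -/

section WeakHolomorphic

variable {E : Type*} [NormedAddCommGroup E] [NormedSpace ℂ E]
  {M : Type*} [TopologicalSpace M] [ChartedSpace E M]
  {W : Type*} [AddCommGroup W] [Module ℂ W]
  {W₁ : Type*} [AddCommGroup W₁] [Module ℂ W₁]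
  {W₂ : Type*} [AddCommGroup W₂] [Module ℂ W₂]

/-- Holomorphy near a point of a map into a finite dimensional complex vector space, tested on
linear functionals. -/
def WHolAt (E : Type*) [NormedAddCommGroup E] [NormedSpace ℂ E]
    {M : Type*} [TopologicalSpace M] [ChartedSpace E M] (w : M → W) (p : M) : Prop :=
  ∀ l : Module.Dual ℂ W, HolAt E (fun q => l (w q)) p

theorem wHolAt_iff {f : M → ℂ} {p : M} : WHolAt E f p ↔ HolAt E f p := by
  refine ⟨fun h => h LinearMap.id, fun h l => ?_⟩
  obtain ⟨c, e⟩ : ∃ c, ∀ z : ℂ, l z = c * z := ⟨l 1, fun z => by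
    have := l.map_smul z 1
    simpa [mul_comm] using this⟩
  simp only [e]
  exact contMDiffAt_const.mul h

theorem wHolAt_const (c : W) (p : M) : WHolAt E (fun _ => c) p := fun _ => contMDiffAt_const

theorem WHolAt.add {v w : M → W} {p : M} (hv : WHolAt E v p) (hw : WHolAt E w p) :
    WHolAt E (fun t => v t + w t) p := fun l => by
  simp only [map_add]
  exact ContMDiffAt.add (hv l) (hw l)

theorem WHolAt.sub {v w : M → W} {p : M} (hv : WHolAt E v p) (hw : WHolAt E w p) :
    WHolAt E (fun t => v t - w t) p := fun l => by
  simp only [map_sub]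
  exact ContMDiffAt.sub (hv l) (hw l)

theorem WHolAt.map {w : M → W} {p : M} (hw : WHolAt E w p) (T : W →ₗ[ℂ] W₁) :
    WHolAt E (fun t => T (w t)) p := fun l => hw (l ∘ₗ T)

theorem HolAt.sum {ι : Type*} {s : Finset ι} {f : ι → M → ℂ} {p : M}
    (h : ∀ i ∈ s, HolAt E (f i) p) : HolAt E (fun q => ∑ i ∈ s, f i q) p :=
  contMDiffAt_finsetSum h

theorem WHolAt.bilin [FiniteDimensional ℂ W₁] [FiniteDimensional ℂ W₂]
    (β : W₁ →ₗ[ℂ] W₂ →ₗ[ℂ] W) {v : M → W₁} {w : M → W₂} {p : M}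
    (hv : WHolAt E v p) (hw : WHolAt E w p) : WHolAt E (fun t => β (v t) (w t)) p := fun l => by
  let b := Module.finBasis ℂ W₁
  have e : ∀ (x : W₁) (y : W₂), l (β x y) = ∑ i, b.coord i x * l (β (b i) y) := fun x y => by
    conv_lhs => rw [← b.sum_repr x]
    simp only [map_sum, map_smul, LinearMap.sum_apply, LinearMap.smul_apply, smul_eq_mul,
      Module.Basis.coord_apply]
  rw [show (fun t => l (β (v t) (w t))) = _ from funext fun t => e _ _]
  refine HolAt.sum fun i _ => ?_
  exact ContMDiffAt.mul (hv (b.coord i)) (hw (l ∘ₗ β (b i)))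

theorem wHolAt_linearMap [FiniteDimensional ℂ W₁] {A : M → W₁ →ₗ[ℂ] W₂} {p : M}
    (h : ∀ v, WHolAt E (fun t => A t v) p) : WHolAt E A p := fun l => by
  let b := Module.finBasis ℂ W₁
  have e : ∀ T : W₁ →ₗ[ℂ] W₂, l T =
      ∑ i, (l ∘ₗ LinearMap.smulRightₗ (b.coord i)) (T (b i)) := fun T => by
    have : T = ∑ i, LinearMap.smulRightₗ (b.coord i) (T (b i)) := by
      refine b.ext fun j => ?_
      simp [Finsupp.single_apply]
    conv_lhs => rw [this]
    simp
  simp only [e]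
  exact HolAt.sum fun i _ => h (b i) _

theorem WHolAt.apply {A : M → W₁ →ₗ[ℂ] W₂} {p : M} (h : WHolAt E A p) (v : W₁) :
    WHolAt E (fun t => A t v) p := h.map (LinearMap.applyₗ v)

theorem WHolAt.eval [FiniteDimensional ℂ W₁] [FiniteDimensional ℂ W₂]
    {A : M → W₁ →ₗ[ℂ] W₂} {v : M → W₁} {p : M}
    (h : WHolAt E A p) (hv : WHolAt E v p) : WHolAt E (fun t => A t (v t)) p :=
  WHolAt.bilin LinearMap.id h hv

theorem WHolAt.comp [FiniteDimensional ℂ W₁] [FiniteDimensional ℂ W₂] [FiniteDimensional ℂ W]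
    {A : M → W₁ →ₗ[ℂ] W₂} {C : M → W →ₗ[ℂ] W₁} {p : M}
    (h : WHolAt E A p) (hv : WHolAt E C p) : WHolAt E (fun t => A t ∘ₗ C t) p :=
  WHolAt.bilin (LinearMap.llcomp ℂ W W₁ W₂) h hv

theorem wHolAt_of_contMDiffAt {V : Type*} [NormedAddCommGroup V] [NormedSpace ℂ V]
    [FiniteDimensional ℂ V] {f : M → V} {p : M} (hf : ContMDiffAt 𝓘(ℂ, E) 𝓘(ℂ, V) ω f p) :
    WHolAt E f p := fun l =>
  ContMDiffAt.comp (g := fun v : V => LinearMap.toContinuousLinearMap l v) p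
    (LinearMap.toContinuousLinearMap l).contMDiff.contMDiffAt hf

end WeakHolomorphic

/-! ### Right-trivialized differentials, derivatives of `Ad`, and constancy on connected groups -/

section LieLevel
open Filter Topology

variable {E : Type*} [NormedAddCommGroup E] [NormedSpace ℂ E] [FiniteDimensional ℂ E]
  {G : Type*} [TopologicalSpace G] [ChartedSpace E G] [Group G]

theorem HolAt.mdiff {f : G → ℂ} {u : G} (hf : HolAt E f u) :
    MDifferentiableAt 𝓘(ℂ, E) 𝓘(ℂ, ℂ) f u := hf.mdifferentiableAt (by simp)

/-- The straight curve through the unit in the preferred chart. -/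
def curve (x : Lie E G) (t : ℂ) : G := chartCurve E (1 : G) (x : E) t

@[simp] theorem curve_zero (x : Lie E G) : curve x 0 = 1 := chartCurve_zero _ _

/-- The right-trivialized differential of a function. -/
def rcov (E : Type*) [NormedAddCommGroup E] [NormedSpace ℂ E]
    {G : Type*} [TopologicalSpace G] [ChartedSpace E G] [Group G] (f : G → ℂ) (u : G) :
    Module.Dual ℂ (Lie E G) := (rightDeriv E f u).toLinearMap

variable [CompleteSpace E] [LieGroup 𝓘(ℂ, E) ω G]

theorem hasDerivAt_mul_right {f : G → ℂ} {u : G} (hf : HolAt E f u) (x : Lie E G) :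
    HasDerivAt (fun t => f (curve x t * u)) (rcov E f u x) 0 :=
  hasDerivAt_chartCurve (E := E) (f := fun s => f (s * u)) (mdifferentiableAt_comp
    (g := fun s => s * u) (one_mul u) hf.mdiff (mdifferentiable_mul_right u 1)) x

theorem Ad_eq_AdCLM (g : G) : (Ad E g : Lie E G →ₗ[ℂ] Lie E G) = (AdCLM E g).toLinearMap := rfl

theorem Ad_one : Ad E (1 : G) = LinearMap.id := by
  rw [Ad_eq_AdCLM, AdCLM_one]; rfl

theorem Ad_mul (g h : G) : Ad E (g * h) = Ad E g ∘ₗ Ad E h := by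
  rw [Ad_eq_AdCLM, AdCLM_mul]; rfl

theorem Ad_inv_comp (g : G) : Ad E g⁻¹ ∘ₗ Ad E g = LinearMap.id := by
  rw [← Ad_mul, inv_mul_cancel, Ad_one]

theorem Ad_comp_inv (g : G) : Ad E g ∘ₗ Ad E g⁻¹ = LinearMap.id := by
  rw [← Ad_mul, mul_inv_cancel, Ad_one]

theorem Ad_inv_Ad (g : G) (x : Lie E G) : Ad E g⁻¹ (Ad E g x) = x :=
  LinearMap.congr_fun (Ad_inv_comp g) x

theorem Ad_Ad_inv (g : G) (x : Lie E G) : Ad E g (Ad E g⁻¹ x) = x :=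
  LinearMap.congr_fun (Ad_comp_inv g) x

theorem hasDerivAt_mul_left {f : G → ℂ} {u : G} (hf : HolAt E f u) (x : Lie E G) :
    HasDerivAt (fun t => f (u * curve x t)) (rcov E f u (Ad E u x)) 0 := by
  have h := hasDerivAt_chartCurve (E := E) (f := fun s => f (u * s)) (mdifferentiableAt_comp
    (g := fun s => u * s) (mul_one u) hf.mdiff (mdifferentiable_mul_left u 1)) x
  have e := congrArg (fun L : E →L[ℂ] ℂ => L x) (leftDeriv_eq_rightDeriv hf.mdiff)
  exact h.congr_deriv e

theorem rcov_mul_right (f : G → ℂ) (a b : G) : rcov E (fun x => f (x * b)) a = rcov E f (a * b) := by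
  simp only [rcov, rightDeriv, mul_assoc]
  rfl

theorem rcov_mul_left {f : G → ℂ} {a b : G} (hf : HolAt E f (a * b)) :
    rcov E (fun x => f (a * x)) b = rcov E f (a * b) ∘ₗ Ad E a := by
  have h := chartDeriv_conj (f := fun s => f (s * (a * b)))
    (mdifferentiableAt_comp (one_mul (a * b)) hf.mdiff (mdifferentiable_mul_right (a * b) 1)) a
  have e : (fun s => f (a * s * a⁻¹ * (a * b))) = fun s => f (a * (s * b)) := by
    funext s; simp [mul_assoc]
  rw [e] at h
  exact congrArg ContinuousLinearMap.toLinearMap h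

theorem diff_comp_rightTranslation {f : G → ℂ} {u : G} (hf : HolAt E f u) :
    diff E f u ∘ₗ rightTranslation E u = rcov E f u := by
  have h := chartDeriv_rightTranslation hf.mdiff
  rw [← modelDeriv_eq_chartDeriv hf.mdiff] at h
  exact congrArg ContinuousLinearMap.toLinearMap h

theorem HolAt.eventually {f : G → ℂ} {u : G} (hf : HolAt E f u) : ∀ᶠ v in 𝓝 u, HolAt E f v :=
  eventually_contMDiffAt hf

theorem contMDiffAt_rightDeriv_apply {f : G → ℂ} {u : G} (hf : HolAt E f u) (v : E) :
    HolAt E (fun w => rightDeriv E f w v) u :=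
  ContMDiffAt.clm_apply (contMDiffAt_rightDeriv hf) contMDiffAt_const

theorem HolAt.rcov {f : G → ℂ} {u : G} (hf : HolAt E f u) : WHolAt E (rcov E f) u :=
  wHolAt_linearMap fun v => wHolAt_iff.2 <|
    contMDiffAt_rightDeriv_apply (E := E) hf v

theorem contMDiff_AdCLM_apply (v : E) :
    ContMDiff 𝓘(ℂ, E) 𝓘(ℂ, E) ω (fun g : G => AdCLM E g v) :=
  contMDiff_AdCLM.clm_apply contMDiff_const

theorem contMDiff_AdCLM_inv : ContMDiff 𝓘(ℂ, E) 𝓘(ℂ, E →L[ℂ] E) ω (fun g : G => AdCLM E g⁻¹) :=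
  contMDiff_AdCLM.comp (contMDiff_inv 𝓘(ℂ, E) ω)

theorem contMDiff_AdCLM_inv_apply (v : E) :
    ContMDiff 𝓘(ℂ, E) 𝓘(ℂ, E) ω (fun g : G => AdCLM E g⁻¹ v) :=
  contMDiff_AdCLM_inv.clm_apply contMDiff_const

theorem wHolAt_Ad (u : G) : WHolAt E (fun g : G => Ad E g) u :=
  wHolAt_linearMap fun v => wHolAt_of_contMDiffAt (V := E) (f := fun g => AdCLM E g v)
    (contMDiff_AdCLM_apply (E := E) v).contMDiffAt

theorem wHolAt_Ad_inv (u : G) : WHolAt E (fun g : G => Ad E g⁻¹) u :=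
  wHolAt_linearMap fun v => wHolAt_of_contMDiffAt (V := E) (f := fun g => AdCLM E g⁻¹ v)
    (contMDiff_AdCLM_inv_apply (E := E) v).contMDiffAt

theorem hasWDeriv_of_hasDerivAt {f : ℂ → E} {f' : E} (h : HasDerivAt f f' 0) : HasWDeriv f f' :=
  fun l => (LinearMap.toContinuousLinearMap l).hasFDerivAt.comp_hasDerivAt 0 h

theorem hasWDeriv_Ad (x : Lie E G) :
    HasWDeriv (fun t => Ad E (curve x t)) (LieAlgebra.ad ℂ (Lie E G) x) :=
  hasWDeriv_linearMap fun v => by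
    have h := hasWDeriv_of_hasDerivAt (E := E)
      ((hasDerivAt_AdCLM (E := E) (G := G) x).clm_apply (hasDerivAt_const (F := E) 0 v))
    refine HasWDeriv.congr_deriv h ?_
    rw [map_zero, add_zero]
    exact adDeriv_eq_modelLie (E := E) (G := G) x v

theorem hasWDeriv_Ad_inv (x : Lie E G) :
    HasWDeriv (fun t => Ad E (curve x t)⁻¹) (-LieAlgebra.ad ℂ (Lie E G) x) := by
  obtain ⟨D, hD⟩ : ∃ D : Lie E G →ₗ[ℂ] Lie E G, HasWDeriv (fun t => Ad E (curve x t)⁻¹) D := by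
    have h1 := hasDerivAt_chartCurve (E := E) ((contMDiff_AdCLM_inv (G := G)).mdifferentiableAt (x := 1) (by simp)) x
    refine ⟨(chartDeriv E (fun g : G => AdCLM E g⁻¹) 1 x).toLinearMap,
      hasWDeriv_linearMap fun v => ?_⟩
    have h := hasWDeriv_of_hasDerivAt (E := E) (h1.clm_apply (hasDerivAt_const (F := E) 0 v))
    refine HasWDeriv.congr_deriv h ?_
    rw [map_zero, add_zero]
    rfl
  -- The derivative `D` exists by holomorphy; its value is found by differentiating `Ad_g⁻¹ Ad_g =
  -- id`.
  have h := hD.comp (hasWDeriv_Ad x)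
  simp only [Ad_inv_comp, curve_zero, inv_one, Ad_one, LinearMap.comp_id, LinearMap.id_comp] at h
  have e := h.unique (hasWDeriv_const _)
  rwa [eq_neg_of_add_eq_zero_left e] at hD

/-- Right translation by `u` moves the question to the unit. There an iterated right derivative is
an iterated left derivative in the opposite order, hence the minus sign. -/
theorem chartDeriv_rightDeriv_sub {f : G → ℂ} {u : G} (hf : HolAt E f u) (x y : E) :
    chartDeriv E (fun s : G => rightDeriv E f (s * u) y) 1 x -
      chartDeriv E (fun s : G => rightDeriv E f (s * u) x) 1 y =
      -rightDeriv E f u (modelLie G x y) := by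
  have hg : HolAt E (fun s => f (s * u)) 1 := by
    have h1 : ContMDiff 𝓘(ℂ, E) 𝓘(ℂ, E) ω (fun x : G => x * u) := contMDiff_mul_right
    exact ContMDiffAt.comp (g := f) (f := fun s : G => s * u) (1 : G)
      (by rw [one_mul]; exact hf) h1.contMDiffAt
  have key : ∀ x y : E, chartDeriv E (fun s : G => rightDeriv E f (s * u) y) 1 x =
      chartDeriv E (fun g => leftDeriv E (fun s => f (s * u)) g x) 1 y := by
    intro x y
    rw [chartDeriv_leftDeriv_swap hg]
    simp [rightDeriv, mul_assoc]
  have h2 := chartDeriv_leftDeriv hg x y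
  rw [adDeriv_eq_modelLie, ← key, ← key] at h2
  rw [h2, rightDeriv]; abel

/-- Right-invariant fields commute up to the Lie bracket. -/
theorem rcov_rcov_sub {f : G → ℂ} {u : G} (hf : HolAt E f u) (x y : Lie E G) :
    rcov E (fun v => rcov E f v y) u x - rcov E (fun v => rcov E f v x) u y =
      -rcov E f u ⁅x, y⁆ :=
  chartDeriv_rightDeriv_sub (E := E) hf x y

/-- Compose the functional with the chart. Identities for brackets of local functions thereby become
identities for all covectors. -/
theorem exists_diff_eq (u : G) (ξ : Cotangent E u) : ∃ f : G → ℂ, HolAt E f u ∧ diff E f u = ξ := by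
  let l : E →L[ℂ] ℂ := LinearMap.toContinuousLinearMap (show E →ₗ[ℂ] ℂ from ξ)
  have h1 : ContMDiffAt 𝓘(ℂ, E) 𝓘(ℂ, E) ω (extChartAt 𝓘(ℂ, E) u) u := contMDiffAt_extChartAt
  have h2 : HolAt E (fun x => l (extChartAt 𝓘(ℂ, E) u x)) u :=
    ContMDiffAt.comp (g := l) u l.contMDiff.contMDiffAt h1
  refine ⟨_, h2, ?_⟩
  have h3 := modelDeriv_eq_chartDeriv h2.mdiff
  have h4 : HasFDerivAt (fun s => l (extChartAt 𝓘(ℂ, E) u ((extChartAt 𝓘(ℂ, E) u).symm s)))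
      (l.comp (chartDeriv E (extChartAt 𝓘(ℂ, E) u) u)) (extChartAt 𝓘(ℂ, E) u u) :=
    l.hasFDerivAt.comp _ (differentiableAt_chart (h1.mdifferentiableAt (by simp))).hasFDerivAt
  have h5 : modelDeriv E ℂ (fun x => l (extChartAt 𝓘(ℂ, E) u x)) u = l := by
    refine h3.trans (h4.fderiv.trans ?_)
    ext x
    exact congrArg l (chartDeriv_extChartAt u x)
  exact congrArg ContinuousLinearMap.toLinearMap h5

/-- The right translation as an equivalence. -/
def rightEquiv (u : G) : Lie E G ≃ₗ[ℂ] TangentSpace 𝓘(ℂ, E) u :=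
  LinearEquiv.ofBijective (rightTranslation E u) (by
    have hi : Function.Injective (rightTranslation E u) :=
      Function.LeftInverse.injective (rightLog_rightTranslation u)
    exact ⟨hi, LinearMap.injective_iff_surjective (V := Lie E G)
      (f := show Lie E G →ₗ[ℂ] Lie E G from rightTranslation E u) |>.1 hi⟩)

theorem exists_rcov_eq (u : G) (ξ : Module.Dual ℂ (Lie E G)) :
    ∃ f : G → ℂ, HolAt E f u ∧ rcov E f u = ξ := by
  obtain ⟨f, hf, h⟩ := exists_diff_eq u (ξ ∘ₗ (rightEquiv u).symm.toLinearMap)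
  refine ⟨f, hf, ?_⟩
  rw [← diff_comp_rightTranslation hf, h]
  ext x
  exact congrArg ξ ((rightEquiv u).symm_apply_apply x)

/-- A holomorphic function on a connected group with vanishing derivative is constant. -/
theorem eq_of_diff_eq_zero [ConnectedSpace G] {f : G → ℂ} (hf : ∀ u, HolAt E f u)
    (h : ∀ u, diff E f u = 0) (u v : G) : f u = f v := by
  refine IsLocallyConstant.apply_eq_of_preconnectedSpace
    ((IsLocallyConstant.iff_eventually_eq f).2 fun u => ?_) u v
  set e := extChartAt 𝓘(ℂ, E) u
  have h0 : ∀ v, modelDeriv E ℂ f v = 0 := fun v => by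
    ext x
    exact LinearMap.congr_fun (h v) x
  have h1 : ∀ s ∈ e.target, MDifferentiableAt 𝓘(ℂ, E) 𝓘(ℂ, E) e.symm s := fun s hs =>
    ((contMDiffOn_extChartAt_symm (n := ω) u).contMDiffAt
      ((isOpen_extChartAt_target u).mem_nhds hs)).mdifferentiableAt (by simp)
  obtain ⟨ε, hε, hb⟩ := Metric.isOpen_iff.1 (isOpen_extChartAt_target (I := 𝓘(ℂ, E)) u) _
    (mem_extChartAt_target u)
  have h2 : ∀ s ∈ Metric.ball (e u) ε, HasFDerivAt (fun s => f (e.symm s)) (0 : E →L[ℂ] ℂ) s := by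
    intro s hs
    have d := mdifferentiableAt_comp rfl (hf (e.symm s)).mdiff (h1 s (hb hs))
    have e2 := modelDeriv_comp (P := ℂ) rfl (hf (e.symm s)).mdiff (h1 s (hb hs))
    rw [h0, ContinuousLinearMap.zero_comp] at e2
    have e3 : modelDeriv E ℂ (fun s => f (e.symm s)) s = fderiv ℂ (fun s => f (e.symm s)) s :=
      mfderiv_eq_fderiv
    rw [← e2, e3]
    exact d.differentiableAt.hasFDerivAt
  have h3 : ∀ s ∈ Metric.ball (e u) ε, f (e.symm s) = f (e.symm (e u)) := fun s hs =>
    Metric.isOpen_ball.is_const_of_fderiv_eq_zero (convex_ball _ _).isPreconnected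
      (fun s hs => (h2 s hs).differentiableAt.differentiableWithinAt)
      (fun s hs => (h2 s hs).fderiv) hs (Metric.mem_ball_self hε)
  filter_upwards [extChartAt_source_mem_nhds (I := 𝓘(ℂ, E)) u,
    (continuousAt_extChartAt (I := 𝓘(ℂ, E)) u).preimage_mem_nhds (Metric.ball_mem_nhds _ hε)] with v hv hv'
  have := h3 _ hv'
  rwa [e.left_inv hv, extChartAt_to_inv] at this

theorem eq_of_rcov_eq_zero [ConnectedSpace G] {f : G → ℂ} (hf : ∀ u, HolAt E f u)
    (h : ∀ u, rcov E f u = 0) (u : G) : f u = f 1 := by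
  refine eq_of_diff_eq_zero hf (fun u => ?_) u 1
  refine LinearMap.ext fun x => ?_
  obtain ⟨y, rfl⟩ := (rightEquiv u).surjective x
  exact (LinearMap.congr_fun (diff_comp_rightTranslation (hf u)) y).trans
    (LinearMap.congr_fun (h u) y)

/-- Constancy, from the derivatives along the right-invariant fields. -/
theorem eq_of_hasDerivAt_right [ConnectedSpace G] {f : G → ℂ} (hf : ∀ u, HolAt E f u)
    (h : ∀ (u : G) (x : Lie E G), HasDerivAt (fun t => f (curve x t * u)) 0 0) (u : G) :
    f u = f 1 :=
  eq_of_rcov_eq_zero hf (fun u => LinearMap.ext fun x =>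
    (hasDerivAt_mul_right (hf u) x).unique (h u x)) u

/-- Constancy, from the derivatives along the left-invariant fields. -/
theorem eq_of_hasDerivAt_left [ConnectedSpace G] {f : G → ℂ} (hf : ∀ u, HolAt E f u)
    (h : ∀ (u : G) (x : Lie E G), HasDerivAt (fun t => f (u * curve x t)) 0 0) (u : G) :
    f u = f 1 :=
  eq_of_rcov_eq_zero hf (fun u => LinearMap.ext fun x => by
    have := (hasDerivAt_mul_left (hf u) (Ad E u⁻¹ x)).unique (h u (Ad E u⁻¹ x))
    rwa [Ad_Ad_inv] at this) u

end LieLevel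

/-! ### Cocycles, and the Jacobi identity as a Maurer-Cartan equation -/

section Trivialization
open Filter Topology

variable {E : Type*} [NormedAddCommGroup E] [NormedSpace ℂ E] [FiniteDimensional ℂ E]
  [CompleteSpace E]
  {G : Type*} [TopologicalSpace G] [ChartedSpace E G] [Group G]

/-- Bilinear forms on the dual of the Lie algebra. -/
abbrev LieTwoTensor (E : Type*) [NormedAddCommGroup E] [NormedSpace ℂ E]
    (G : Type*) [TopologicalSpace G] [ChartedSpace E G] [Group G] : Type _ :=
  Module.Dual ℂ (Lie E G) →ₗ[ℂ] Module.Dual ℂ (Lie E G) →ₗ[ℂ] ℂ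

/-- The map from a vector space to another one, determined by a bilinear form on the dual. -/
def sh {W : Type*} [AddCommGroup W] [Module ℂ W] [FiniteDimensional ℂ W]
    (η : Module.Dual ℂ W →ₗ[ℂ] Module.Dual ℂ W →ₗ[ℂ] ℂ) : Module.Dual ℂ W →ₗ[ℂ] W :=
  (Module.evalEquiv ℂ W).symm.toLinearMap ∘ₗ η

theorem apply_sh {W : Type*} [AddCommGroup W] [Module ℂ W] [FiniteDimensional ℂ W]
    (η : Module.Dual ℂ W →ₗ[ℂ] Module.Dual ℂ W →ₗ[ℂ] ℂ) (ξ θ : Module.Dual ℂ W) :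
    θ (sh η ξ) = η ξ θ := by
  simp [sh]

/-- Pull back of the arguments of a bilinear form along the dual of a linear map. -/
def twist {W W' : Type*} [AddCommGroup W] [Module ℂ W] [AddCommGroup W'] [Module ℂ W']
    (A : W →ₗ[ℂ] W') (η : Module.Dual ℂ W →ₗ[ℂ] Module.Dual ℂ W →ₗ[ℂ] ℂ) :
    Module.Dual ℂ W' →ₗ[ℂ] Module.Dual ℂ W' →ₗ[ℂ] ℂ :=
  η.compl₁₂ A.dualMap A.dualMap

@[simp] theorem twist_apply {W W' : Type*} [AddCommGroup W] [Module ℂ W] [AddCommGroup W']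
    [Module ℂ W'] (A : W →ₗ[ℂ] W') (η : Module.Dual ℂ W →ₗ[ℂ] Module.Dual ℂ W →ₗ[ℂ] ℂ)
    (ξ ζ : Module.Dual ℂ W') : twist A η ξ ζ = η (ξ ∘ₗ A) (ζ ∘ₗ A) := rfl

/-- The two-tensor with a given right trivialization. -/
def ofTriv (η : G → LieTwoTensor E G) : TwoTensor E G := fun u =>
  (η u).compl₁₂ (rightTranslation E u).dualMap (rightTranslation E u).dualMap

theorem ofTriv_apply (η : G → LieTwoTensor E G) (u : G) (α β : Cotangent E u) :
    ofTriv η u α β = η u (α ∘ₗ rightTranslation E u) (β ∘ₗ rightTranslation E u) := rfl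

/-- The linearization at the unit. -/
def lin (η : G → LieTwoTensor E G) (ξ ζ : Module.Dual ℂ (Lie E G)) : Module.Dual ℂ (Lie E G) :=
  rcov E (fun u => η u ξ ζ) 1

variable [LieGroup 𝓘(ℂ, E) ω G]

theorem exists_hasWDeriv {W : Type*} [AddCommGroup W] [Module ℂ W] [FiniteDimensional ℂ W]
    {w : G → W} {u : G} (hw : WHolAt E w u) (x : Lie E G) :
    ∃ w' : W, HasWDeriv (fun t => w (curve x t * u)) w' ∧
      ∀ l : Module.Dual ℂ W, l w' = rcov E (fun v => l (w v)) u x := by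
  let b := Module.finBasis ℂ W
  have h : HasWDeriv (fun t => w (curve x t * u))
      (∑ i, rcov E (fun v => b.coord i (w v)) u x • b i) := fun l => by
    have e : ∀ y : W, l y = ∑ i, b.coord i y * l (b i) := fun y => by
      conv_lhs => rw [← b.sum_repr y]
      simp only [map_sum, map_smul, smul_eq_mul, Module.Basis.coord_apply]
    rw [show (fun t => l (w (curve x t * u))) = _ from funext fun t => e _]
    simp only [map_sum, map_smul, smul_eq_mul]
    exact HasDerivAt.fun_sum fun i _ => (hasDerivAt_mul_right (hw (b.coord i)) x).mul_const _
  exact ⟨_, h, fun l => (h l).unique (hasDerivAt_mul_right (hw l) x)⟩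

theorem bracket_ofTriv (η : G → LieTwoTensor E G) {f h : G → ℂ} {u : G} (hf : HolAt E f u)
    (hh : HolAt E h u) : bracket (ofTriv η) f h u = η u (rcov E f u) (rcov E h u) := by
  rw [bracket, ofTriv_apply, diff_comp_rightTranslation hf, diff_comp_rightTranslation hh]

theorem bracket_ofTriv_eventually (η : G → LieTwoTensor E G) {f h : G → ℂ} {u : G}
    (hf : HolAt E f u) (hh : HolAt E h u) :
    bracket (ofTriv η) f h =ᶠ[𝓝 u] fun v => η v (rcov E f v) (rcov E h v) := by
  filter_upwards [hf.eventually, hh.eventually] with v h1 h2 using bracket_ofTriv η h1 h2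

theorem rcov_congr {f h : G → ℂ} {u : G} (e : f =ᶠ[𝓝 u] h) : rcov E f u = rcov E h u := by
  have h1 : Tendsto (fun s : G => s * u) (𝓝 1) (𝓝 u) := by
    have h2 : ContMDiff 𝓘(ℂ, E) 𝓘(ℂ, E) ω (fun x : G => x * u) := contMDiff_mul_right
    simpa using h2.continuous.tendsto 1
  exact congrArg ContinuousLinearMap.toLinearMap (chartDeriv_congr (h1.eventually e))

theorem HolAt.congr {f h : G → ℂ} {u : G} (hf : HolAt E f u) (e : h =ᶠ[𝓝 u] f) : HolAt E h u :=
  ContMDiffAt.congr_of_eventuallyEq hf e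

theorem holAt_comp_mul_right {f : G → ℂ} {a b : G} (hf : HolAt E f (a * b)) :
    HolAt E (fun x => f (x * b)) a :=
  ContMDiffAt.comp (f := fun x : G => x * b) a hf
    (contMDiff_mul_right (n := ω) (I := 𝓘(ℂ, E))).contMDiffAt

theorem holAt_comp_mul_left {f : G → ℂ} {a b : G} (hf : HolAt E f (a * b)) :
    HolAt E (fun x => f (a * x)) b :=
  ContMDiffAt.comp (f := fun x : G => a * x) b hf
    (contMDiff_mul_left (n := ω) (I := 𝓘(ℂ, E))).contMDiffAt

/-- Holomorphic alternating cocycles on a Lie group. -/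
structure IsCocycle (η : G → LieTwoTensor E G) : Prop where
  alternating : ∀ u ξ, η u ξ ξ = 0
  holomorphic : ∀ u, WHolAt E η u
  map_mul : ∀ a b, η (a * b) = η a + twist (Ad E a) (η b)

/-- The obstruction to the Jacobi identity for the two-tensor defined by a cocycle. -/
def mcForm (η : G → LieTwoTensor E G) (u : G) (ξ ζ χ : Module.Dual ℂ (Lie E G)) : ℂ :=
  lin η ζ χ (sh (η u) ξ) + lin η χ ξ (sh (η u) ζ) + lin η ξ ζ (sh (η u) χ) +
    ξ ⁅sh (η u) ζ, sh (η u) χ⁆ + ζ ⁅sh (η u) χ, sh (η u) ξ⁆ + χ ⁅sh (η u) ξ, sh (η u) ζ⁆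

namespace IsCocycle

variable {η : G → LieTwoTensor E G} (hη : IsCocycle η)
include hη

theorem map_one : η 1 = 0 := by
  have h := hη.map_mul 1 1
  have e : twist (Ad E (1 : G)) (η 1) = η 1 := by
    rw [Ad_one]; rfl
  rw [one_mul, e] at h
  simpa using h

theorem neg_swap (u : G) (ξ ζ : Module.Dual ℂ (Lie E G)) : η u ξ ζ = -η u ζ ξ := by
  have h := hη.alternating u (ξ + ζ)
  simp only [map_add, LinearMap.add_apply, hη.alternating] at h
  linear_combination h

theorem hasWDeriv_one (x : Lie E G) : ∃ δ : LieTwoTensor E G,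
    HasWDeriv (fun t => η (curve x t)) δ ∧ ∀ ξ ζ, δ ξ ζ = lin η ξ ζ x := by
  obtain ⟨δ, h1, h2⟩ := exists_hasWDeriv (hη.holomorphic 1) x
  simp only [mul_one] at h1
  exact ⟨δ, h1, fun ξ ζ => h2 (LinearMap.applyₗ ζ ∘ₗ LinearMap.applyₗ ξ)⟩

theorem hasWDeriv_twist {A : ℂ → Lie E G →ₗ[ℂ] Lie E G} {A' : Lie E G →ₗ[ℂ] Lie E G}
    (hA : HasWDeriv A A') (hA0 : A 0 = LinearMap.id) (β : LieTwoTensor E G) :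
    HasWDeriv (fun t => twist (A t) β)
      (β.compl₁₂ A'.dualMap LinearMap.id + β.compl₁₂ LinearMap.id A'.dualMap) := by
  refine hasWDeriv_linearMap fun ξ => hasWDeriv_linearMap fun ζ => ?_
  have h1 : ∀ θ : Module.Dual ℂ (Lie E G), HasWDeriv (fun t => θ ∘ₗ A t) (θ ∘ₗ A') := fun θ =>
    hA.map (LinearMap.llcomp ℂ _ _ _ θ)
  have h2 := HasWDeriv.bilin β (h1 ξ) (h1 ζ)
  rw [hA0] at h2
  exact h2

/-- The derivative of a cocycle along right-invariant fields. -/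
theorem hasWDeriv_mul (u : G) (x : Lie E G) : ∃ δ : LieTwoTensor E G,
    HasWDeriv (fun t => η (curve x t * u)) δ ∧ ∀ ξ ζ, δ ξ ζ = lin η ξ ζ x +
      η u (ξ ∘ₗ LieAlgebra.ad ℂ (Lie E G) x) ζ + η u ξ (ζ ∘ₗ LieAlgebra.ad ℂ (Lie E G) x) := by
  obtain ⟨δ, h1, h2⟩ := hη.hasWDeriv_one x
  have h3 := hη.hasWDeriv_twist (hasWDeriv_Ad x) (by simp [Ad_one]) (η u)
  simp only [hη.map_mul]
  refine ⟨_, h1.add h3, fun ξ ζ => ?_⟩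
  simp only [LinearMap.add_apply, h2, add_assoc]
  rfl

theorem holAt_bracket {f h : G → ℂ} {u : G} (hf : HolAt E f u) (hh : HolAt E h u) :
    HolAt E (bracket (ofTriv η) f h) u :=
  HolAt.congr (wHolAt_iff.1 (((hη.holomorphic u).eval hf.rcov).eval hh.rcov))
    (bracket_ofTriv_eventually η hf hh)

/-- The product rule for `η v (rcov f v) (rcov h v)`. The covectors `ξ'` and `ζ'` are the
derivatives of the two differentials along `x`. -/
theorem rcov_bracket {f h : G → ℂ} {u : G} (hf : HolAt E f u) (hh : HolAt E h u) (x : Lie E G) :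
    ∃ ξ' ζ' : Module.Dual ℂ (Lie E G),
      (∀ y, ξ' y = rcov E (fun v => rcov E f v y) u x) ∧
      (∀ y, ζ' y = rcov E (fun v => rcov E h v y) u x) ∧
      rcov E (bracket (ofTriv η) f h) u x = lin η (rcov E f u) (rcov E h u) x +
        η u (rcov E f u ∘ₗ LieAlgebra.ad ℂ (Lie E G) x) (rcov E h u) +
        η u (rcov E f u) (rcov E h u ∘ₗ LieAlgebra.ad ℂ (Lie E G) x) +
        η u ξ' (rcov E h u) + η u (rcov E f u) ζ' := by
  obtain ⟨ξ', h1, h2⟩ := exists_hasWDeriv hf.rcov x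
  obtain ⟨ζ', h3, h4⟩ := exists_hasWDeriv hh.rcov x
  obtain ⟨δ, h5, h6⟩ := hη.hasWDeriv_mul u x
  refine ⟨ξ', ζ', fun y => h2 (LinearMap.applyₗ y), fun y => h4 (LinearMap.applyₗ y), ?_⟩
  have h7 := hasWDeriv_iff.1 ((h5.eval h1).eval h3)
  have h8 := hasDerivAt_mul_right (wHolAt_iff.1
    (((hη.holomorphic u).eval hf.rcov).eval hh.rcov)) x
  rw [rcov_congr (bracket_ofTriv_eventually η hf hh), h8.unique h7]
  simp only [curve_zero, one_mul, LinearMap.add_apply, h6]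

/-- Skew symmetry brings every term of the product rule into the form of a covector evaluated on a
vector `sh (η u) _`. The last two terms are second derivatives of `g` and `h`, set apart for
cancellation in the cyclic sum. -/
theorem bracket_bracket {f g h : G → ℂ} {u : G} (hf : HolAt E f u) (hg : HolAt E g u)
    (hh : HolAt E h u) :
    bracket (ofTriv η) f (bracket (ofTriv η) g h) u =
      lin η (rcov E g u) (rcov E h u) (sh (η u) (rcov E f u))
      - rcov E g u ⁅sh (η u) (rcov E f u), sh (η u) (rcov E h u)⁆
      + rcov E h u ⁅sh (η u) (rcov E f u), sh (η u) (rcov E g u)⁆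
      - rcov E (fun v => rcov E g v (sh (η u) (rcov E h u))) u (sh (η u) (rcov E f u))
      + rcov E (fun v => rcov E h v (sh (η u) (rcov E g u))) u (sh (η u) (rcov E f u)) := by
  rw [bracket_ofTriv η hf (hη.holAt_bracket hg hh), ← apply_sh]
  obtain ⟨ζ', χ', h1, h2, h3⟩ := hη.rcov_bracket hg hh (sh (η u) (rcov E f u))
  rw [h3, hη.neg_swap u (_ ∘ₗ _), hη.neg_swap u ζ']
  simp only [← apply_sh (η u), ← h1, ← h2, LinearMap.comp_apply, LieAlgebra.ad_apply]
  ring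

/-- In the cyclic sum the second derivatives of each function occur twice, with opposite signs and
exchanged directions. By `rcov_rcov_sub` they leave a first derivative along a bracket, so only the
differentials at `u` survive. -/
theorem jacobiator_eq {f g h : G → ℂ} {u : G} (hf : HolAt E f u) (hg : HolAt E g u)
    (hh : HolAt E h u) :
    bracket (ofTriv η) f (bracket (ofTriv η) g h) u
      + bracket (ofTriv η) g (bracket (ofTriv η) h f) u
      + bracket (ofTriv η) h (bracket (ofTriv η) f g) u =
    mcForm η u (rcov E f u) (rcov E g u) (rcov E h u) := by
  rw [hη.bracket_bracket hf hg hh, hη.bracket_bracket hg hh hf, hη.bracket_bracket hh hf hg, mcForm]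
  set a := sh (η u) (rcov E f u)
  set b := sh (η u) (rcov E g u)
  set c := sh (η u) (rcov E h u)
  have e1 := rcov_rcov_sub hf b c
  have e2 := rcov_rcov_sub hg c a
  have e3 := rcov_rcov_sub hh a b
  rw [← lie_skew a c, ← lie_skew b a, ← lie_skew c b]
  simp only [map_neg]
  linear_combination e1 + e2 + e3

theorem multiplicative (a b : G) {f h : G → ℂ} (hf : HolAt E f (a * b))
    (hh : HolAt E h (a * b)) :
    bracket (ofTriv η) f h (a * b) =
      bracket (ofTriv η) (fun x => f (x * b)) (fun x => h (x * b)) a +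
      bracket (ofTriv η) (fun x => f (a * x)) (fun x => h (a * x)) b := by
  rw [bracket_ofTriv η hf hh,
    bracket_ofTriv η (holAt_comp_mul_right hf) (holAt_comp_mul_right hh),
    bracket_ofTriv η (holAt_comp_mul_left hf) (holAt_comp_mul_left hh),
    hη.map_mul, rcov_mul_right, rcov_mul_right, rcov_mul_left hf, rcov_mul_left hh]
  rfl

/-- A cocycle that satisfies the Maurer-Cartan equation defines a Poisson-Lie structure. -/
theorem isPoissonLie (h : ∀ u ξ ζ χ, mcForm η u ξ ζ χ = 0) : IsPoissonLie (ofTriv η) where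
  poisson :=
    { alternating := fun u α => hη.alternating u _
      holomorphic := fun u f h hf hh => hη.holAt_bracket hf hh
      jacobi := fun u f g k hf hg hk => by rw [hη.jacobiator_eq hf hg hk, h] }
  multiplicative := fun a b f h hf hh => hη.multiplicative a b hf hh

/-- The linearization at the unit. -/
theorem diff_bracket_one {f h : G → ℂ} (hf : HolAt E f 1) (hh : HolAt E h 1) :
    rcov E (bracket (ofTriv η) f h) 1 = lin η (rcov E f 1) (rcov E h 1) := by
  refine LinearMap.ext fun x => ?_
  obtain ⟨_, _, _, _, e⟩ := hη.rcov_bracket hf hh x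
  rw [e]
  simp [hη.map_one]

end IsCocycle

/-- The differential at the unit does not see the trivialization. -/
theorem diff_one {f : G → ℂ} (hf : HolAt E f 1) : diff E f 1 = rcov E f 1 := by
  have h := modelDeriv_eq_chartDeriv hf.mdiff
  refine (congrArg ContinuousLinearMap.toLinearMap h).trans ?_
  rw [rcov, rightDeriv_one]

end Trivialization

/-! ### Extraction of a cocycle from a Poisson-Lie structure -/

section FromPoissonLie
open Filter Topology

variable {E : Type*} [NormedAddCommGroup E] [NormedSpace ℂ E] [FiniteDimensional ℂ E]
  [CompleteSpace E]
  {G : Type*} [TopologicalSpace G] [ChartedSpace E G] [Group G]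

theorem WHolAt.twist {M : Type*} [TopologicalSpace M] [ChartedSpace E M]
    {W W' : Type*} [AddCommGroup W] [Module ℂ W] [AddCommGroup W'] [Module ℂ W']
    [FiniteDimensional ℂ W] [FiniteDimensional ℂ W'] {A : M → W →ₗ[ℂ] W'}
    {β : M → Module.Dual ℂ W →ₗ[ℂ] Module.Dual ℂ W →ₗ[ℂ] ℂ} {p : M}
    (hA : WHolAt E A p) (hβ : WHolAt E β p) : WHolAt E (fun q => twist (A q) (β q)) p :=
  wHolAt_linearMap fun ξ => wHolAt_linearMap fun ζ => by
    have h1 : ∀ θ : Module.Dual ℂ W', WHolAt E (fun q => θ ∘ₗ A q) p := fun θ =>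
      hA.map (LinearMap.llcomp ℂ _ _ _ θ)
    exact (hβ.eval (h1 ξ)).eval (h1 ζ)

theorem WHolAt.comp_map {F : Type*} [NormedAddCommGroup F] [NormedSpace ℂ F]
    {M : Type*} [TopologicalSpace M] [ChartedSpace E M]
    {N : Type*} [TopologicalSpace N] [ChartedSpace F N]
    {W : Type*} [AddCommGroup W] [Module ℂ W] {w : M → W} {i : N → M} {p : N}
    (hw : WHolAt E w (i p)) (hi : ContMDiffAt 𝓘(ℂ, F) 𝓘(ℂ, E) ω i p) :
    WHolAt F (fun q => w (i q)) p := fun l =>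
  ContMDiffAt.comp (g := fun q => l (w q)) p (hw l) hi

theorem WHolAt.congr {M : Type*} [TopologicalSpace M] [ChartedSpace E M]
    {W : Type*} [AddCommGroup W] [Module ℂ W] {v w : M → W} {p : M}
    (hw : WHolAt E w p) (e : v =ᶠ[𝓝 p] w) : WHolAt E v p := fun l =>
  ContMDiffAt.congr_of_eventuallyEq (hw l) (e.fun_comp l)

variable [LieGroup 𝓘(ℂ, E) ω G]

/-- The right trivialization of a two-tensor. -/
def triv (P : TwoTensor E G) : G → LieTwoTensor E G := fun u =>
  twist (rightEquiv u).symm.toLinearMap (P u)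

theorem ofTriv_triv (P : TwoTensor E G) : ofTriv (triv P) = P := by
  funext u
  refine LinearMap.ext fun α => LinearMap.ext fun β => ?_
  have h : ∀ α : Cotangent E u, (α ∘ₗ rightTranslation E u) ∘ₗ (rightEquiv u).symm.toLinearMap = α :=
    fun α => LinearMap.ext fun x => congrArg α ((rightEquiv u).apply_symm_apply x)
  rw [ofTriv_apply, triv, twist_apply, h, h]

/-- Brackets of chart coordinates are holomorphic. They are the components of `η v` twisted by the
matrix `T v` of the right-invariant fields in the chart. Since `T 1` is the identity, `T` has a
holomorphic inverse `S` near the unit, which undoes the twist. -/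
theorem wHolAt_one_of_isPoisson {η : G → LieTwoTensor E G} (hP : IsPoisson (ofTriv η)) :
    WHolAt E η 1 := by
  let T : G → E →L[ℂ] E := rightDeriv E (extChartAt 𝓘(ℂ, E) (1 : G))
  have hφ : ContMDiffAt 𝓘(ℂ, E) 𝓘(ℂ, E) ω (extChartAt 𝓘(ℂ, E) (1 : G)) 1 := contMDiffAt_extChartAt
  have hT : ContMDiffAt 𝓘(ℂ, E) 𝓘(ℂ, E →L[ℂ] E) ω T 1 := contMDiffAt_rightDeriv hφ
  have hT1 : T 1 = 1 := by
    ext x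
    simp only [T, rightDeriv_one]
    exact chartDeriv_extChartAt (1 : G) x
  let S : G → E →L[ℂ] E := fun v => Ring.inverse (T v)
  have hS : ContMDiffAt 𝓘(ℂ, E) 𝓘(ℂ, E →L[ℂ] E) ω S 1 :=
    ContMDiffAt.comp (1 : G) (g := Ring.inverse)
      (by rw [hT1]; exact (contDiffAt_ringInverse ℂ (1 : (E →L[ℂ] E)ˣ)).contMDiffAt) hT
  have hST : ∀ᶠ v in 𝓝 (1 : G), S v * T v = 1 := by
    have h1 : ∀ᶠ A in 𝓝 (T 1), IsUnit A := by
      rw [hT1]; exact Units.nhds (1 : (E →L[ℂ] E)ˣ)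
    filter_upwards [hT.continuousAt.eventually h1] with v hv
    exact Ring.inverse_mul_cancel _ hv
  have hf : ∀ (l : E →ₗ[ℂ] ℂ) (v : G),
      ContMDiffAt 𝓘(ℂ, E) 𝓘(ℂ, E) ω (extChartAt 𝓘(ℂ, E) (1 : G)) v →
      HolAt E (fun g : G => l (extChartAt 𝓘(ℂ, E) (1 : G) g)) v ∧
      rcov E (fun g : G => l (extChartAt 𝓘(ℂ, E) (1 : G) g)) v = l ∘ₗ (T v).toLinearMap := by
    intro l v hv
    have h1 : HolAt E (fun g : G => l (extChartAt 𝓘(ℂ, E) (1 : G) g)) v :=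
      wHolAt_of_contMDiffAt hv l
    refine ⟨h1, LinearMap.ext fun x => ?_⟩
    have h2 := hasDerivAt_chartCurve (E := E) (mdifferentiableAt_comp (g := fun s => s * v)
      (one_mul v) (hv.mdifferentiableAt (by simp)) (mdifferentiable_mul_right v 1)) x
    exact (hasDerivAt_mul_right h1 x).unique (hasWDeriv_of_hasDerivAt h2 l)
  have hβ : WHolAt E (fun v => twist (W := Lie E G) (W' := E) (T v).toLinearMap (η v)) 1 := by
    refine wHolAt_linearMap fun l => wHolAt_linearMap fun l' => wHolAt_iff.2 ?_
    refine HolAt.congr (hP.holomorphic 1 _ _ (hf l 1 hφ).1 (hf l' 1 hφ).1) ?_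
    filter_upwards [eventually_contMDiffAt hφ] with v hv
    rw [bracket_ofTriv η (hf l v hv).1 (hf l' v hv).1, (hf l v hv).2, (hf l' v hv).2]
    rfl
  have hS' : WHolAt E (fun v => (S v).toLinearMap) 1 :=
    wHolAt_linearMap fun x => wHolAt_of_contMDiffAt (hS.clm_apply contMDiffAt_const)
  refine WHolAt.congr (hS'.twist hβ) ?_
  filter_upwards [hST] with v hv
  refine LinearMap.ext fun ξ => LinearMap.ext fun ζ => ?_
  have h : ∀ θ : Module.Dual ℂ (Lie E G), (θ ∘ₗ (S v).toLinearMap) ∘ₗ (T v).toLinearMap = θ :=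
    fun θ => LinearMap.ext fun x => congrArg θ (congrArg (fun L : E →L[ℂ] E => L x) hv)
  exact (congrArg₂ (fun a b => η v a b) (h ξ) (h ζ)).symm

/-- Testing multiplicativity on functions with prescribed differentials gives the cocycle identity.
Holomorphy at `u` follows from holomorphy at the unit by writing `v = u * (u⁻¹ * v)`. -/
theorem isCocycle_of_isPoissonLie {η : G → LieTwoTensor E G} (hP : IsPoissonLie (ofTriv η)) :
    IsCocycle η := by
  have hmul : ∀ a b, η (a * b) = η a + twist (Ad E a) (η b) := by
    intro a b
    refine LinearMap.ext fun ξ => LinearMap.ext fun ζ => ?_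
    obtain ⟨f, hf, rfl⟩ := exists_rcov_eq (a * b) ξ
    obtain ⟨h, hh, rfl⟩ := exists_rcov_eq (a * b) ζ
    have := hP.multiplicative a b f h hf hh
    rw [bracket_ofTriv η hf hh,
      bracket_ofTriv η (holAt_comp_mul_right hf) (holAt_comp_mul_right hh),
      bracket_ofTriv η (holAt_comp_mul_left hf) (holAt_comp_mul_left hh),
      rcov_mul_right, rcov_mul_right, rcov_mul_left hf, rcov_mul_left hh] at this
    exact this
  refine ⟨fun u ξ => ?_, fun u => ?_, hmul⟩
  · obtain ⟨f, hf, rfl⟩ := exists_rcov_eq u ξ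
    rw [← bracket_ofTriv η hf hf]
    exact hP.poisson.alternating u _
  · have e : η = fun v => η u + twist (Ad E u) (η (u⁻¹ * v)) := by
      funext v
      rw [← hmul, mul_inv_cancel_left]
    rw [e]
    refine (wHolAt_const _ _).add (WHolAt.twist (wHolAt_const _ _) ?_)
    refine WHolAt.comp_map (w := η) (i := fun v => u⁻¹ * v) ?_
      (contMDiff_mul_left (n := ω) (I := 𝓘(ℂ, E))).contMDiffAt
    rw [inv_mul_cancel]
    exact wHolAt_one_of_isPoisson hP.poisson

theorem mcForm_eq_zero_of_isPoissonLie {η : G → LieTwoTensor E G} (hP : IsPoissonLie (ofTriv η))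
    (u : G) (ξ ζ χ : Module.Dual ℂ (Lie E G)) : mcForm η u ξ ζ χ = 0 := by
  obtain ⟨f, hf, rfl⟩ := exists_rcov_eq u ξ
  obtain ⟨g, hg, rfl⟩ := exists_rcov_eq u ζ
  obtain ⟨h, hh, rfl⟩ := exists_rcov_eq u χ
  rw [← (isCocycle_of_isPoissonLie hP).jacobiator_eq hf hg hh]
  exact hP.poisson.jacobi u f g h hf hg hh

theorem IsCocycle.linearizesTo_iff {F : Type*} [NormedAddCommGroup F] [NormedSpace ℂ F]
    {K : Type*} [TopologicalSpace K] [ChartedSpace F K] [Group K]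
    {η : G → LieTwoTensor E G} (hη : IsCocycle η) (B : Lie E G →ₗ[ℂ] Lie F K →ₗ[ℂ] ℂ) :
    LinearizesTo (ofTriv η) B ↔ ∀ ξ ζ, lin η (B.flip ξ) (B.flip ζ) = B.flip ⁅ξ, ζ⁆ := by
  constructor
  · intro h ξ ζ
    obtain ⟨f, hf, e1⟩ := exists_rcov_eq 1 (B.flip ξ)
    obtain ⟨k, hk, e2⟩ := exists_rcov_eq 1 (B.flip ζ)
    have := h ξ ζ f k hf hk ((diff_one hf).trans e1) ((diff_one hk).trans e2)
    rw [diff_one (hη.holAt_bracket hf hk), hη.diff_bracket_one hf hk, e1, e2] at this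
    exact this
  · intro h ξ ζ f k hf hk e1 e2
    rw [diff_one hf] at e1
    rw [diff_one hk] at e2
    rw [diff_one (hη.holAt_bracket hf hk), hη.diff_bracket_one hf hk, e1, e2, h]

end FromPoissonLie

/-! ### Naturality under homomorphisms of Lie groups -/

section Homomorphisms

variable {E : Type*} [NormedAddCommGroup E] [NormedSpace ℂ E] [FiniteDimensional ℂ E]
  [CompleteSpace E]
  {G : Type*} [TopologicalSpace G] [ChartedSpace E G] [Group G] [LieGroup 𝓘(ℂ, E) ω G]
  {F : Type*} [NormedAddCommGroup F] [NormedSpace ℂ F] [FiniteDimensional ℂ F]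
  [CompleteSpace F]
  {K : Type*} [TopologicalSpace K] [ChartedSpace F K] [Group K] [LieGroup 𝓘(ℂ, F) ω K]
  {i : K →* G} (hi : ContMDiff 𝓘(ℂ, F) 𝓘(ℂ, E) ω i)
include hi

theorem mdifferentiable_hom : MDifferentiable 𝓘(ℂ, F) 𝓘(ℂ, E) i := hi.mdifferentiable (by simp)

theorem rcov_comp_hom {f : G → ℂ} {u : K} (hf : HolAt E f (i u)) :
    rcov F (fun x => f (i x)) u = rcov E f (i u) ∘ₗ lieMap F E i := by
  have h := chartDeriv_comp (E := F) (g := i) (f := fun s : G => f (s * i u)) (a := 1) (b := 1)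
    i.map_one (mdifferentiableAt_comp (g := fun s => s * i u) (one_mul (i u)) hf.mdiff
      (mdifferentiable_mul_right (i u) 1)) (mdifferentiable_hom hi 1)
  simp only [← map_mul] at h
  exact congrArg ContinuousLinearMap.toLinearMap h

theorem lieMap_comp_Ad (u : K) : lieMap F E i ∘ₗ Ad F u = Ad E (i u) ∘ₗ lieMap F E i := by
  have h1 := modelDeriv_comp (E := F) (F := F) (P := E) (f := i) (g := fun s : K => u * s * u⁻¹)
    (a := 1) (b := 1) (by simp) (mdifferentiable_hom hi 1) (mdifferentiable_conj u 1)
  have h2 := modelDeriv_comp (E := F) (F := E) (P := E) (f := fun s : G => i u * s * (i u)⁻¹)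
    (g := i) (a := 1) (b := 1) i.map_one (mdifferentiable_conj (i u) 1) (mdifferentiable_hom hi 1)
  have e : (fun s : K => i (u * s * u⁻¹)) = fun s => i u * i s * (i u)⁻¹ := by
    funext s; simp
  rw [e] at h1
  exact congrArg ContinuousLinearMap.toLinearMap (h1.symm.trans h2)

theorem lieMap_Ad (u : K) (x : Lie F K) :
    lieMap F E i (Ad F u x) = Ad E (i u) (lieMap F E i x) :=
  LinearMap.congr_fun (lieMap_comp_Ad hi u) x

/-- Derivatives along a homomorphism of Lie groups. -/
theorem HasWDeriv.comp_hom {W : Type*} [AddCommGroup W] [Module ℂ W] {w : G → W} {w' : W}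
    {x : Lie F K} (hw : WHolAt E w 1)
    (h : HasWDeriv (fun t => w (curve (lieMap F E i x) t)) w') :
    HasWDeriv (fun t => w (i (curve x t))) w' := fun l => by
  have h0 : HolAt E (fun g => l (w g)) (i 1) := by rw [i.map_one]; exact hw l
  have h1 : HolAt F (fun g => l (w (i g))) 1 :=
    ContMDiffAt.comp (g := fun g => l (w g)) (1 : K) h0 hi.contMDiffAt
  have h2 := hasDerivAt_mul_right h1 x
  have h3 := hasDerivAt_mul_right (hw l) (lieMap F E i x)
  rw [rcov_comp_hom hi h0, i.map_one] at h2
  simp only [mul_one] at h2 h3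
  exact h2.congr_deriv (h3.unique (h l))

/-- Differentiate the intertwining relation `lieMap_Ad` at the unit. -/
theorem lieMap_lie (x y : Lie F K) :
    lieMap F E i ⁅x, y⁆ = ⁅lieMap F E i x, lieMap F E i y⁆ := by
  have h1 := (hasWDeriv_Ad x).apply y |>.map (lieMap F E i)
  simp only [lieMap_Ad hi] at h1
  have h2 := HasWDeriv.comp_hom hi (w := fun g => Ad E g (lieMap F E i y)) (x := x)
    ((wHolAt_Ad 1).apply _) ((hasWDeriv_Ad (lieMap F E i x)).apply _)
  exact h1.unique h2

theorem tangentMapAt_rightTranslation (u : K) (x : Lie F K) :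
    tangentMapAt E F i u (rightTranslation F u x) =
      rightTranslation E (i u) (lieMap F E i x) := by
  have h1 := modelDeriv_comp (E := F) (F := F) (P := E) (f := i) (g := fun s : K => s * u)
    (a := 1) (b := u) (one_mul u) (mdifferentiable_hom hi u) (mdifferentiable_mul_right u 1)
  have h2 := modelDeriv_comp (E := F) (F := E) (P := E) (f := fun s : G => s * i u)
    (g := i) (a := 1) (b := 1) i.map_one (mdifferentiable_mul_right (i u) 1)
    (mdifferentiable_hom hi 1)
  simp only [map_mul] at h1
  exact congrArg (fun L : F →L[ℂ] E => L x) (h1.symm.trans h2)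

end Homomorphisms

/-! ### Linear algebra of the Dirac bracket -/

section LinearDirac

variable {W W' : Type*} [AddCommGroup W] [Module ℂ W] [FiniteDimensional ℂ W]
  [AddCommGroup W'] [Module ℂ W'] [FiniteDimensional ℂ W']
  {T : W' →ₗ[ℂ] W} {q : W →ₗ[ℂ] W'} (hq : q ∘ₗ T = LinearMap.id)
  {β : Module.Dual ℂ W →ₗ[ℂ] Module.Dual ℂ W →ₗ[ℂ] ℂ} (hβ : ∀ ξ ζ, β ξ ζ = -β ζ ξ)
  (h : ∀ ξ, ξ ∘ₗ T = 0 → ∀ θ : Module.Dual ℂ W', β ξ (θ ∘ₗ q) = 0)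

-- Here `W` splits as the range of `T` and the kernel of `q`. The hypothesis `h` says that `β` has
-- no mixed terms between the annihilators of the two summands, so its sharp map carries the
-- annihilator of the range of `T` into the kernel of `q`.
include h in
theorem apply_sh_eq_zero {ξ : Module.Dual ℂ W} (hξ : ξ ∘ₗ T = 0) : q (sh β ξ) = 0 :=
  (Module.forall_dual_apply_eq_zero_iff ℂ _).1 fun θ => (apply_sh β ξ (θ ∘ₗ q)).trans (h ξ hξ θ)

include hq

include h in
theorem map_sh_inf_range :
    Submodule.map (sh β) (LinearMap.range T).dualAnnihilator ⊓ LinearMap.range T = ⊥ := by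
  refine eq_bot_iff.2 ?_
  rintro _ ⟨⟨ξ, hξ, rfl⟩, ⟨w, hw⟩⟩
  have h1 : ξ ∘ₗ T = 0 := LinearMap.ext fun x =>
    (Submodule.mem_dualAnnihilator ξ).1 hξ _ (LinearMap.mem_range_self T x)
  have h2 := apply_sh_eq_zero h h1
  rw [← hw] at h2 ⊢
  have h3 : w = 0 := (LinearMap.congr_fun hq w).symm.trans h2
  simp [h3]

include hβ h

/-- The vector `sh β (ξ ∘ₗ q)` is fixed by `T ∘ₗ q`: for any `θ` the covector `θ ∘ₗ T ∘ₗ q - θ`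
vanishes on the range of `T`, so by skew symmetry and `h` it vanishes on this vector. -/
theorem sh_comp (ξ : Module.Dual ℂ W') : T (sh (twist q β) ξ) = sh β (ξ ∘ₗ q) := by
  have h1 : sh (twist q β) ξ = q (sh β (ξ ∘ₗ q)) := by
    refine sub_eq_zero.1 ((Module.forall_dual_apply_eq_zero_iff ℂ _).1 fun θ => ?_)
    rw [map_sub, apply_sh, twist_apply, ← apply_sh β]
    exact sub_self _
  rw [h1]
  refine sub_eq_zero.1 ((Module.forall_dual_apply_eq_zero_iff ℂ _).1 fun θ => ?_)
  have h2 := h (θ ∘ₗ T ∘ₗ q - θ) (by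
    rw [LinearMap.sub_comp, LinearMap.comp_assoc, LinearMap.comp_assoc, hq]
    simp) ξ
  rw [hβ, ← apply_sh β, neg_eq_zero] at h2
  simpa using h2

/-- The covectors `α` and `(α ∘ₗ T) ∘ₗ q` agree on the range of `T`, so their sharps differ by an
element of the kernel of `q`. Both sharps lie in the range of `T`, which meets that kernel in zero.
-/
theorem dirac_sh {α : Module.Dual ℂ W} (hα : sh β α ∈ LinearMap.range T) :
    T (sh (twist q β) (α ∘ₗ T)) = sh β α := by
  obtain ⟨w, hw⟩ := hα
  have h1 : (α - (α ∘ₗ T) ∘ₗ q) ∘ₗ T = 0 := by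
    rw [LinearMap.sub_comp, LinearMap.comp_assoc, hq]
    simp
  have h2 := apply_sh_eq_zero h h1
  rw [map_sub, ← sh_comp hq hβ h, ← hw, ← map_sub] at h2
  have h3 : w - sh (twist q β) (α ∘ₗ T) = 0 := (LinearMap.congr_fun hq _).symm.trans h2
  rw [← hw, sub_eq_zero.1 h3]

/-- Every covector `ξ` of `W'` is the restriction of `ξ ∘ₗ q`, whose sharp is tangent by `sh_comp`;
the defining condition thus prescribes `γ` everywhere. -/
theorem dirac_unique {γ : Module.Dual ℂ W' →ₗ[ℂ] Module.Dual ℂ W' →ₗ[ℂ] ℂ}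
    (hγ : ∀ α, sh β α ∈ LinearMap.range T → T (sh γ (α ∘ₗ T)) = sh β α) : γ = twist q β := by
  have hT : Function.Injective T := Function.LeftInverse.injective (LinearMap.congr_fun hq)
  refine LinearMap.ext fun ξ => LinearMap.ext fun ζ => ?_
  have h1 := hγ (ξ ∘ₗ q) ⟨_, sh_comp hq hβ h ξ⟩
  rw [LinearMap.comp_assoc, hq, LinearMap.comp_id, ← sh_comp hq hβ h] at h1
  rw [← apply_sh γ, hT h1, apply_sh]

end LinearDirac

/-! ### Reduction of a cocycle to a connected subgroup -/

section Reduction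

variable {E : Type*} [NormedAddCommGroup E] [NormedSpace ℂ E] [FiniteDimensional ℂ E]
  [CompleteSpace E]
  {G : Type*} [TopologicalSpace G] [ChartedSpace E G] [Group G] [LieGroup 𝓘(ℂ, E) ω G]
  {F : Type*} [NormedAddCommGroup F] [NormedSpace ℂ F] [FiniteDimensional ℂ F]
  [CompleteSpace F]
  {K : Type*} [TopologicalSpace K] [ChartedSpace F K] [Group K] [LieGroup 𝓘(ℂ, F) ω K]

/-- A projection onto the Lie algebra of a subgroup that is compatible with a cocycle. -/
structure IsReduction (i : K →* G) (η : G → LieTwoTensor E G) (q : Lie E G →ₗ[ℂ] Lie F K) :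
    Prop where
  holomorphic : ContMDiff 𝓘(ℂ, F) 𝓘(ℂ, E) ω i
  comp_eq : q ∘ₗ lieMap F E i = LinearMap.id
  map_lie : ∀ x y, q ⁅lieMap F E i x, y⁆ = ⁅x, q y⁆
  lin_eq_zero : ∀ ξ, ξ ∘ₗ lieMap F E i = 0 → ∀ (θ : Module.Dual ℂ (Lie F K)) (x : Lie F K),
    lin η ξ (θ ∘ₗ q) (lieMap F E i x) = 0

namespace IsReduction

variable {i : K →* G} {η : G → LieTwoTensor E G} {q : Lie E G →ₗ[ℂ] Lie F K}
  [ConnectedSpace K] (h : IsReduction i η q)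
include h

/-- The integrated form of `map_lie`: the curve of maps `Ad_u⁻¹ q Ad_{i u}` has zero derivative
along right-invariant fields, hence is constant on the connected group `K`. -/
theorem comp_Ad (u : K) : q ∘ₗ Ad E (i u) = Ad F u ∘ₗ q := by
  have key : ∀ y, Ad F u⁻¹ (q (Ad E (i u) y)) = q y := by
    intro y
    refine sub_eq_zero.1 ((Module.forall_dual_apply_eq_zero_iff ℂ _).1 fun l => ?_)
    rw [map_sub, sub_eq_zero]
    have hA : ∀ v : K, WHolAt F (fun v : K => Ad E (i v)) v := fun v =>
      (wHolAt_Ad (i v)).comp_map h.holomorphic.contMDiffAt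
    have h0 := eq_of_hasDerivAt_right (E := F) (f := fun v : K => l (Ad F v⁻¹ (q (Ad E (i v) y))))
      (fun v => ((wHolAt_Ad_inv v).eval (((hA v).apply y).map q)) l) (fun v x => ?_) u
    · simpa [Ad_one] using h0
    · have d1 := HasWDeriv.comp_hom h.holomorphic (w := fun g => Ad E g) (x := x) (wHolAt_Ad 1)
        (hasWDeriv_Ad (lieMap F E i x))
      have d2 := ((hasWDeriv_Ad_inv x).eval ((d1.apply (Ad E (i v) y)).map q)).map (Ad F v⁻¹)
      have d3 := d2 l
      simp only [curve_zero, map_one, inv_one, Ad_one, LinearMap.id_apply, LieAlgebra.ad_apply,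
        h.map_lie, LinearMap.neg_apply, neg_add_cancel, map_zero] at d3
      simpa only [map_mul, mul_inv_rev, Ad_mul, LinearMap.comp_apply] using d3
  refine LinearMap.ext fun y => ?_
  have := congrArg (Ad F u) (key y)
  rwa [Ad_Ad_inv] at this

variable (hη : IsCocycle η)
include hη

/-- By the cocycle identity, the derivative along a left-invariant field is the linearization of `η`
at covectors moved by `Ad_{i u}`. Both classes of covectors are stable under this action, by
`lieMap_comp_Ad` and `comp_Ad`, so `lin_eq_zero` applies at every point. -/
theorem apply_eq_zero {ξ : Module.Dual ℂ (Lie E G)} (hξ : ξ ∘ₗ lieMap F E i = 0)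
    (θ : Module.Dual ℂ (Lie F K)) (u : K) : η (i u) ξ (θ ∘ₗ q) = 0 := by
  have h0 : η (i 1) ξ (θ ∘ₗ q) = 0 := by rw [i.map_one, hη.map_one]; rfl
  rw [← h0]
  have hH : ∀ u, WHolAt F (fun u => η (i u)) u := fun u =>
    (hη.holomorphic (i u)).comp_map h.holomorphic.contMDiffAt
  refine eq_of_hasDerivAt_left (E := F) (f := fun u => η (i u) ξ (θ ∘ₗ q))
    (fun u => wHolAt_iff.1 (((hH u).apply ξ).apply _)) (fun u x => ?_) u
  obtain ⟨δ, h1, h2⟩ := hη.hasWDeriv_one (lieMap F E i x)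
  have h1' := HasWDeriv.comp_hom h.holomorphic (w := η) (x := x) (hη.holomorphic 1) h1
  have h3 := hasWDeriv_iff.1 ((h1'.apply (ξ ∘ₗ Ad E (i u))).apply ((θ ∘ₗ q) ∘ₗ Ad E (i u)))
  rw [h2, LinearMap.comp_assoc _ _ θ, h.comp_Ad, ← LinearMap.comp_assoc, h.lin_eq_zero _ (by
    rw [LinearMap.comp_assoc, ← lieMap_comp_Ad h.holomorphic, ← LinearMap.comp_assoc, hξ,
      LinearMap.zero_comp])] at h3
  simp only [map_mul, hη.map_mul]
  rw [LinearMap.comp_assoc, ← h.comp_Ad, ← LinearMap.comp_assoc] at h3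
  exact h3.const_add _

/-- The reduced cocycle. -/
theorem isCocycle : IsCocycle (fun u => twist q (η (i u))) where
  alternating u ξ := hη.alternating _ _
  holomorphic u := (wHolAt_const q u).twist
    ((hη.holomorphic (i u)).comp_map h.holomorphic.contMDiffAt)
  map_mul a b := by
    refine LinearMap.ext fun ξ => LinearMap.ext fun ζ => ?_
    simp only [map_mul, hη.map_mul, twist_apply, LinearMap.add_apply, LinearMap.comp_assoc,
      h.comp_Ad]

theorem lin_reduced (ξ ζ : Module.Dual ℂ (Lie F K)) :
    lin (fun u => twist q (η (i u))) ξ ζ = lin η (ξ ∘ₗ q) (ζ ∘ₗ q) ∘ₗ lieMap F E i := by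
  have h1 : HolAt E (fun g => η g (ξ ∘ₗ q) (ζ ∘ₗ q)) (i 1) :=
    wHolAt_iff.1 (((hη.holomorphic _).apply _).apply _)
  have h2 := rcov_comp_hom h.holomorphic h1
  rw [i.map_one] at h2
  exact h2

theorem sh_reduced (u : K) (ξ : Module.Dual ℂ (Lie F K)) :
    lieMap F E i (sh (twist q (η (i u))) ξ) = sh (η (i u)) (ξ ∘ₗ q) :=
  sh_comp h.comp_eq (hη.neg_swap (i u)) (fun _ hξ θ => h.apply_eq_zero hη hξ θ u) ξ

/-- Linearization, sharp map and Lie bracket all correspond under `i` and `q`, so this is the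
ambient Maurer-Cartan form on covectors composed with `q`. -/
theorem mcForm_reduced (hmc : ∀ u ξ ζ χ, mcForm η u ξ ζ χ = 0) (u : K)
    (ξ ζ χ : Module.Dual ℂ (Lie F K)) : mcForm (fun u => twist q (η (i u))) u ξ ζ χ = 0 := by
  have e : ∀ (θ : Module.Dual ℂ (Lie F K)) x y,
      θ ⁅x, y⁆ = (θ ∘ₗ q) ⁅lieMap F E i x, lieMap F E i y⁆ := by
    intro θ x y
    rw [← lieMap_lie h.holomorphic]
    exact congrArg θ (LinearMap.congr_fun h.comp_eq _).symm
  have := hmc (i u) (ξ ∘ₗ q) (ζ ∘ₗ q) (χ ∘ₗ q)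
  rw [mcForm] at this ⊢
  simp only [h.lin_reduced hη, LinearMap.comp_apply _ (lieMap F E i), e, h.sh_reduced hη]
  exact this

theorem isPoissonLie (hmc : ∀ u ξ ζ χ, mcForm η u ξ ζ χ = 0) :
    IsPoissonLie (ofTriv fun u => twist q (η (i u))) :=
  (h.isCocycle hη).isPoissonLie (h.mcForm_reduced hη hmc)

omit [ConnectedSpace K] h hη in
/-- The projection at other points of the group. -/
def proj (i : K →* G) (q : Lie E G →ₗ[ℂ] Lie F K) (u : K) :
    TangentSpace 𝓘(ℂ, E) (i u) →ₗ[ℂ] TangentSpace 𝓘(ℂ, F) u :=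
  rightTranslation F u ∘ₗ q ∘ₗ (rightEquiv (i u)).symm.toLinearMap

omit [ConnectedSpace K] h hη in
theorem proj_comp_rightTranslation (u : K) :
    proj i q u ∘ₗ rightTranslation E (i u) = rightTranslation F u ∘ₗ q :=
  LinearMap.ext fun x => congrArg (fun z => rightTranslation F u (q z))
    ((rightEquiv (i u)).symm_apply_apply x)

omit [ConnectedSpace K] hη in
theorem tangentMapAt_comp_rightTranslation (u : K) :
    tangentMapAt E F i u ∘ₗ rightTranslation F u = rightTranslation E (i u) ∘ₗ lieMap F E i :=
  LinearMap.ext (tangentMapAt_rightTranslation h.holomorphic u)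

omit [ConnectedSpace K] hη in
theorem proj_comp (u : K) : proj i q u ∘ₗ tangentMapAt E F i u = LinearMap.id := by
  refine LinearMap.ext fun x => ?_
  obtain ⟨y, rfl⟩ := (rightEquiv u).surjective x
  have h1 := LinearMap.congr_fun (h.tangentMapAt_comp_rightTranslation u) y
  have h2 := LinearMap.congr_fun (proj_comp_rightTranslation (i := i) (q := q) u)
    (lieMap F E i y)
  refine (congrArg (proj i q u) h1).trans (h2.trans ?_)
  exact congrArg (rightTranslation F u) (LinearMap.congr_fun h.comp_eq y)

omit [ConnectedSpace K] h hη in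
theorem ofTriv_reduced (u : K) :
    ofTriv (fun u => twist q (η (i u))) u = twist (proj i q u) (ofTriv η (i u)) := by
  refine LinearMap.ext fun α => LinearMap.ext fun β => ?_
  simp only [twist_apply, ofTriv_apply, LinearMap.comp_assoc, proj_comp_rightTranslation]

theorem ofTriv_eq_zero (u : K) (ξ : Cotangent E (i u)) (hξ : ξ ∘ₗ tangentMapAt E F i u = 0)
    (θ : Cotangent F u) : ofTriv η (i u) ξ (θ ∘ₗ proj i q u) = 0 := by
  rw [ofTriv_apply, LinearMap.comp_assoc, proj_comp_rightTranslation, ← LinearMap.comp_assoc]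
  refine h.apply_eq_zero hη ?_ _ u
  rw [LinearMap.comp_assoc, ← h.tangentMapAt_comp_rightTranslation, ← LinearMap.comp_assoc, hξ,
    LinearMap.zero_comp]

theorem isDiracBracket :
    IsDiracBracket i (ofTriv η) (ofTriv fun u => twist q (η (i u))) := by
  intro u α hα
  have := dirac_sh (h.proj_comp u) (β := ofTriv η (i u)) (fun ξ ζ => hη.neg_swap _ _ _)
    (h.ofTriv_eq_zero hη u) hα
  rw [← ofTriv_reduced] at this
  exact this

theorem eq_of_isDiracBracket {P' : TwoTensor F K} (hP' : IsDiracBracket i (ofTriv η) P') :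
    P' = ofTriv fun u => twist q (η (i u)) := by
  funext u
  rw [ofTriv_reduced]
  exact dirac_unique (h.proj_comp u) (β := ofTriv η (i u)) (fun ξ ζ => hη.neg_swap _ _ _)
    (h.ofTriv_eq_zero hη u) (hP' u)

theorem isPoissonDirac (hi : IsImmersedSubmanifold (E := E) (F := F) i)
    (hmc : ∀ u ξ ζ χ, mcForm η u ξ ζ χ = 0) :
    IsPoissonDirac (E := E) (F := F) i (ofTriv η) where
  submanifold := hi
  pointwise u := map_sh_inf_range (h.proj_comp u) (β := ofTriv η (i u)) (h.ofTriv_eq_zero hη u)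
  induced := ⟨_, h.isDiracBracket hη, (h.isPoissonLie hη hmc).poisson⟩

/-- The value of a Dirac bracket on restrictions of covectors that vanish on the complement. -/
theorem diracBracket_apply {P' : TwoTensor F K} (hP' : IsDiracBracket i (ofTriv η) P') (u : K)
    {α β : Cotangent E (i u)} (hα : ∃ ξ : Module.Dual ℂ (Lie F K),
      α ∘ₗ rightTranslation E (i u) = ξ ∘ₗ q) (hβ : ∃ ζ : Module.Dual ℂ (Lie F K),
      β ∘ₗ rightTranslation E (i u) = ζ ∘ₗ q) :
    P' u (α ∘ₗ tangentMapAt E F i u) (β ∘ₗ tangentMapAt E F i u) = ofTriv η (i u) α β := by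
  obtain ⟨ξ, hξ⟩ := hα
  obtain ⟨ζ, hζ⟩ := hβ
  have e : ∀ {α : Cotangent E (i u)} {ξ : Module.Dual ℂ (Lie F K)},
      α ∘ₗ rightTranslation E (i u) = ξ ∘ₗ q →
      ((α ∘ₗ tangentMapAt E F i u) ∘ₗ rightTranslation F u) ∘ₗ q = ξ ∘ₗ q := by
    intro α ξ hξ
    rw [LinearMap.comp_assoc _ _ α, h.tangentMapAt_comp_rightTranslation, ← LinearMap.comp_assoc, hξ,
      LinearMap.comp_assoc _ _ ξ, h.comp_eq, LinearMap.comp_id]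
  rw [h.eq_of_isDiracBracket hη hP', ofTriv_apply, twist_apply, e hξ, e hζ, ofTriv_apply, hξ, hζ]

end IsReduction

end Reduction

/-! ### The Poisson-Lie structure of an `r`-matrix -/

section RMatrix

variable {E : Type*} [NormedAddCommGroup E] [NormedSpace ℂ E] [FiniteDimensional ℂ E]
  [CompleteSpace E]
  {G : Type*} [TopologicalSpace G] [ChartedSpace E G] [Group G] [LieGroup 𝓘(ℂ, E) ω G]

theorem Ad_lie (u : G) (x y : Lie E G) : Ad E u ⁅x, y⁆ = ⁅Ad E u x, Ad E u y⁆ :=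
  lieMap_lie (i := (MulAut.conj u).toMonoidHom)
    ((contMDiff_mul_right (a := u⁻¹)).comp (contMDiff_mul_left (a := u))) x y

/-- Values of a cocycle are determined by the cocycle identity and the derivative at the unit. -/
theorem IsCocycle.apply_eq_of_hasDerivAt [ConnectedSpace G] {η : G → LieTwoTensor E G}
    (hη : IsCocycle η) {W : Type*} {e : W → Module.Dual ℂ (Lie E G)} {C : G → W → W}
    (hC : ∀ u X, e X ∘ₗ Ad E u = e (C u X)) {β : G → W → W → ℂ}
    (hβ : ∀ u X Y, HolAt E (fun u => β u X Y) u) (h1 : ∀ X Y, β 1 X Y = 0)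
    (hmul : ∀ a b X Y, β (a * b) X Y = β a X Y + β b (C a X) (C a Y))
    (hd : ∀ X Y x, HasDerivAt (fun t => β (curve x t) X Y) (lin η (e X) (e Y) x) 0)
    (u : G) (X Y : W) : η u (e X) (e Y) = β u X Y := by
  have h0 : η 1 (e X) (e Y) - β 1 X Y = 0 := by rw [hη.map_one, h1, sub_eq_zero]; rfl
  refine sub_eq_zero.1 (Eq.trans ?_ h0)
  refine eq_of_hasDerivAt_left (E := E) (f := fun u => η u (e X) (e Y) - β u X Y)
    (fun u => ContMDiffAt.sub (wHolAt_iff.1 (((hη.holomorphic u).apply _).apply _)) (hβ u X Y))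
    (fun u x => ?_) u
  obtain ⟨δ, h2, h3⟩ := hη.hasWDeriv_one x
  -- Left translation by `u` replaces `X` and `Y` by `C u X` and `C u Y` in both functions, so
  -- equality of derivatives at the unit suffices everywhere.
  have h4 := hasWDeriv_iff.1 ((h2.apply (e (C u X))).apply (e (C u Y)))
  rw [h3] at h4
  have h5 := (h4.const_add (η u (e X) (e Y))).sub ((hd (C u X) (C u Y) x).const_add (β u X Y))
  rw [sub_self] at h5
  simp only [hη.map_mul, hmul, LinearMap.add_apply, twist_apply, hC]
  exact h5

variable {B : LinearMap.BilinForm ℂ (Lie E G)}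
  (hBi : ∀ X Y Z : Lie E G, B ⁅X, Y⁆ Z = B X ⁅Y, Z⁆)

section Invariant
include hBi

theorem invariant_ad (x X Y : Lie E G) : B ⁅x, X⁆ Y + B X ⁅x, Y⁆ = 0 := by
  rw [← hBi, ← lie_skew X x, map_neg, LinearMap.neg_apply]
  ring

theorem invariant_Ad [ConnectedSpace G] (u : G) (X Y : Lie E G) :
    B (Ad E u X) (Ad E u Y) = B X Y := by
  have h := eq_of_hasDerivAt_right (E := E) (f := fun u => B (Ad E u X) (Ad E u Y))
    (fun u => wHolAt_iff.1 (WHolAt.bilin B ((wHolAt_Ad u).apply X) ((wHolAt_Ad u).apply Y)))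
    (fun u x => ?_) u
  · simpa [Ad_one] using h
  · have d := hasWDeriv_iff.1 (HasWDeriv.bilin B ((hasWDeriv_Ad x).apply (Ad E u X))
      ((hasWDeriv_Ad x).apply (Ad E u Y)))
    simp only [curve_zero, Ad_one, LinearMap.id_apply, LieAlgebra.ad_apply,
      invariant_ad hBi] at d
    simpa only [Ad_mul, LinearMap.comp_apply] using d

theorem invariant_Ad_left [ConnectedSpace G] (u : G) (X Y : Lie E G) :
    B (Ad E u X) Y = B X (Ad E u⁻¹ Y) := by
  rw [← invariant_Ad hBi u X, Ad_Ad_inv]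

theorem invariant_Ad_inv_left [ConnectedSpace G] (u : G) (X Y : Lie E G) :
    B (Ad E u⁻¹ X) Y = B X (Ad E u Y) := by
  rw [← invariant_Ad hBi u _ Y, Ad_Ad_inv]

/-- Conjugates of `r`-matrices are `r`-matrices. -/
theorem IsRMatrix.conj [ConnectedSpace G] {r : Lie E G →ₗ[ℂ] Lie E G} {α : ℂ}
    (hr : IsRMatrix B r α) (u : G) : IsRMatrix B (Ad E u ∘ₗ r ∘ₗ Ad E u⁻¹) α where
  antisymm X Y := by
    simp only [LinearMap.comp_apply]
    rw [invariant_Ad_left hBi, hr.antisymm, invariant_Ad_inv_left hBi]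
  yangBaxter X Y := by
    have h := congrArg (Ad E u) (hr.yangBaxter (Ad E u⁻¹ X) (Ad E u⁻¹ Y))
    simp only [map_add, map_sub, map_smul, Ad_lie, Ad_Ad_inv] at h
    simp only [LinearMap.comp_apply, Ad_lie, Ad_inv_Ad]
    rw [← h]

/-- The left side is the derivative of `π^r` at the unit along `V`; thus `π^r` linearizes to the
bracket `[·,·]_r`. -/
theorem lin_rBracket_eq {r : Lie E G →ₗ[ℂ] Lie E G} (hs : B.IsSymm)
    (hr : ∀ X Y, B (r X) Y = -B X (r Y)) (V X Y : Lie E G) :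
    (1 / 2 : ℂ) * (B X (r ⁅V, Y⁆) - B X ⁅V, r Y⁆) = B V (rBracket r X Y) := by
  have e1 : B X (r ⁅V, Y⁆) = B V ⁅r X, Y⁆ := by
    rw [hs.eq V, hBi, hr, ← lie_skew Y V, map_neg, map_neg, neg_neg]
  have e2 : B X ⁅V, r Y⁆ = -B V ⁅X, r Y⁆ := by
    have := invariant_ad hBi V X (r Y)
    rw [← hBi V X]
    linear_combination this
  rw [e1, e2, rBracket]
  simp
  ring

/-- The Yang-Baxter identity paired with `X`, with `r` moved across the form. The right side depends
on `α` only, which permits comparison of two `r`-matrices. -/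
theorem cyclic_yangBaxter {r : Lie E G →ₗ[ℂ] Lie E G} {α : ℂ} (hs : B.IsSymm)
    (hr : IsRMatrix B r α) (X Y Z : Lie E G) :
    B X ⁅r Y, r Z⁆ + B Y ⁅r Z, r X⁆ + B Z ⁅r X, r Y⁆ = -α * B X ⁅Y, Z⁆ := by
  have cyc : ∀ a b c : Lie E G, B a ⁅b, c⁆ = B c ⁅a, b⁆ := fun a b c => by
    rw [← hBi]; exact hs.eq _ c
  have h := congrArg (B X) (hr.yangBaxter Y Z)
  simp only [map_add, map_sub, map_smul, smul_eq_mul] at h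
  have e : ∀ W, B X (r W) = -B (r X) W := fun W => by rw [hr.antisymm, neg_neg]
  rw [e, e] at h
  linear_combination -h + cyc Y (r Z) (r X) - cyc (r X) (r Y) Z

/-- The terms quadratic in `r'` equal those quadratic in `r`, by `cyclic_yangBaxter` for the same
`α`. After this replacement the two sides agree by cyclic invariance of `B X ⁅Y, Z⁆`. -/
theorem maurerCartan_rMatrix {r r' : Lie E G →ₗ[ℂ] Lie E G} {α : ℂ} (hs : B.IsSymm)
    (hr : IsRMatrix B r α) (hr' : IsRMatrix B r' α) {N : Lie E G →ₗ[ℂ] Lie E G}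
    (hN : N = (1 / 2 : ℂ) • (r - r')) (X Y Z : Lie E G) :
    B X ⁅N Y, N Z⁆ + B Y ⁅N Z, N X⁆ + B Z ⁅N X, N Y⁆ =
      B (N X) (rBracket r Y Z) + B (N Y) (rBracket r Z X) + B (N Z) (rBracket r X Y) := by
  have cyc : ∀ a b c : Lie E G, B a ⁅b, c⁆ = B c ⁅a, b⁆ := fun a b c => by
    rw [← hBi]; exact hs.eq _ c
  have h := cyclic_yangBaxter hBi hs hr X Y Z
  have h' := cyclic_yangBaxter hBi hs hr' X Y Z
  subst hN
  simp only [rBracket, LinearMap.smul_apply, LinearMap.sub_apply, smul_lie, lie_smul, sub_lie,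
    lie_sub, map_smul, map_sub, map_add, smul_eq_mul]
  have c1 := fun a b c => cyc (r a) (r b) c
  have c2 := fun a b c => cyc (r' a) (r b) c
  have c3 := fun a b c => cyc a (r b) (r c)
  have c4 := fun a b c => cyc a (r b) (r' c)
  linear_combination (1/4 : ℂ) * (h' - h) - (1/4 : ℂ) * (c1 X Y Z + c1 Y Z X + c1 Z X Y) +
    (1/4 : ℂ) * (c3 X Y Z + c3 Y Z X + c3 Z X Y) + (1/4 : ℂ) * (c2 X Y Z + c2 Y Z X + c2 Z X Y)
    - (1/4 : ℂ) * (c4 X Y Z + c4 Y Z X + c4 Z X Y)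

end Invariant

variable (hB : B.Nondegenerate) (hs : B.IsSymm) {r : Lie E G →ₗ[ℂ] Lie E G} {α : ℂ}
  (hr : IsRMatrix B r α)

/-- The right trivialization of the Poisson-Lie tensor of `r`. -/
def rTriv (B : LinearMap.BilinForm ℂ (Lie E G)) (hB : B.Nondegenerate)
    (r : Lie E G →ₗ[ℂ] Lie E G) (g : G) : LieTwoTensor E G :=
  (piR B r g).compl₁₂ (B.toDual hB).symm.toLinearMap (B.toDual hB).symm.toLinearMap

theorem exists_eq_flat (hB : B.Nondegenerate) (ξ : Module.Dual ℂ (Lie E G)) : ∃ X, B X = ξ :=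
  (B.toDual hB).surjective ξ

theorem rTriv_apply (g : G) (X Y : Lie E G) : rTriv B hB r g (B X) (B Y) = piR B r g X Y := by
  have h : ∀ X, (B.toDual hB).symm (B X) = X := fun X => (B.toDual hB).symm_apply_apply X
  simp only [rTriv, LinearMap.compl₁₂_apply, LinearEquiv.coe_coe, h]

theorem piR_apply (g : G) (X Y : Lie E G) :
    piR B r g X Y = (1 / 2 : ℂ) * (B X (r Y) - B X (Ad E g (r (Ad E g⁻¹ Y)))) := by
  simp [piR]

variable [ConnectedSpace G]
include hBi hs hr

/-- Through `B`, this is the coboundary of `½ r` for the adjoint action; alternation holds because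
`r` and its conjugates are antisymmetric. -/
theorem isCocycle_rTriv : IsCocycle (rTriv B hB r) where
  alternating g ξ := by
    obtain ⟨X, rfl⟩ := exists_eq_flat hB ξ
    have h0 : ∀ {r : Lie E G →ₗ[ℂ] Lie E G} {α}, IsRMatrix B r α → B X (r X) = 0 := by
      intro r α hr
      have h1 := hr.antisymm X X
      have h2 : B (r X) X = B X (r X) := hs.eq (r X) X
      rw [h2] at h1
      linear_combination (1/2 : ℂ) * h1
    have h3 := h0 (hr.conj hBi g)
    simp only [LinearMap.comp_apply] at h3
    rw [rTriv_apply, piR_apply, h0 hr, h3]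
    ring
  holomorphic g := by
    have hN : WHolAt E (fun g : G => r - Ad E g ∘ₗ r ∘ₗ Ad E g⁻¹) g :=
      (wHolAt_const _ _).sub ((wHolAt_Ad g).comp ((wHolAt_const r g).comp (wHolAt_Ad_inv g)))
    refine wHolAt_linearMap fun ξ => wHolAt_linearMap fun ζ => ?_
    obtain ⟨X, rfl⟩ := exists_eq_flat hB ξ
    obtain ⟨Y, rfl⟩ := exists_eq_flat hB ζ
    simp only [rTriv_apply]
    exact ((hN.apply Y).map (B X)).map ((1 / 2 : ℂ) • LinearMap.id)
  map_mul a b := by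
    refine LinearMap.ext fun ξ => LinearMap.ext fun ζ => ?_
    obtain ⟨X, rfl⟩ := exists_eq_flat hB ξ
    obtain ⟨Y, rfl⟩ := exists_eq_flat hB ζ
    have h : ∀ X, B X ∘ₗ Ad E a = B (Ad E a⁻¹ X) := fun X => LinearMap.ext fun Z =>
      (invariant_Ad_inv_left hBi a X Z).symm
    rw [LinearMap.add_apply, LinearMap.add_apply, twist_apply, h, h]
    simp only [rTriv_apply, piR_apply, mul_inv_rev, Ad_mul, LinearMap.comp_apply,
      invariant_Ad_inv_left hBi]
    ring

theorem lin_rTriv (X Y V : Lie E G) : lin (rTriv B hB r) (B X) (B Y) V = B V (rBracket r X Y) := by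
  obtain ⟨δ, h1, h2⟩ := (isCocycle_rTriv hBi hB hs hr).hasWDeriv_one V
  rw [← h2, ← lin_rBracket_eq hBi hs hr.antisymm]
  have h3 := (h1.apply (B X)).apply (B Y)
  refine h3.unique ?_
  have h4 := ((hasWDeriv_const (r Y)).sub ((hasWDeriv_Ad V).eval
    (((hasWDeriv_Ad_inv V).apply Y).map r))).map ((1 / 2 : ℂ) • B X)
  simp only [rTriv_apply]
  refine HasWDeriv.congr_deriv h4 ?_
  simp [Ad_one]
  rw [← lie_skew Y V, ← lie_skew (r Y) V]
  simp only [map_neg]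
  ring

/-- The sign arises because `r` acts on the second argument of `π^r`, whereas the sharp map takes
the first. -/
theorem sh_rTriv (g : G) (X : Lie E G) : sh (rTriv B hB r g) (B X) =
    -((1 / 2 : ℂ) • (r - Ad E g ∘ₗ r ∘ₗ Ad E g⁻¹)) X := by
  refine sub_eq_zero.1 ((Module.forall_dual_apply_eq_zero_iff ℂ _).1 fun θ => ?_)
  obtain ⟨Y, rfl⟩ := exists_eq_flat hB θ
  rw [map_sub, apply_sh, rTriv_apply, piR_apply]
  have h1 := hr.antisymm Y X
  have h2 := (hr.conj hBi g).antisymm Y X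
  have h3 : ∀ Z W, B Z W = B W Z := fun Z W => hs.eq Z W
  simp only [LinearMap.comp_apply] at h2
  rw [h3 _ X] at h1 h2
  simp
  linear_combination (1/2 : ℂ) * (h1 - h2)

theorem mcForm_rTriv (g : G) (ξ ζ χ : Module.Dual ℂ (Lie E G)) :
    mcForm (rTriv B hB r) g ξ ζ χ = 0 := by
  obtain ⟨X, rfl⟩ := exists_eq_flat hB ξ
  obtain ⟨Y, rfl⟩ := exists_eq_flat hB ζ
  obtain ⟨Z, rfl⟩ := exists_eq_flat hB χ
  have h := maurerCartan_rMatrix hBi hs hr (hr.conj hBi g) rfl X Y Z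
  rw [mcForm]
  simp only [lin_rTriv hBi hB hs hr, sh_rTriv hBi hB hs hr, map_neg, LinearMap.neg_apply, neg_lie,
    lie_neg, neg_neg]
  linear_combination h

theorem isPoissonLie_poissonLieTensor : IsPoissonLie (poissonLieTensor B hB r) :=
  (isCocycle_rTriv hBi hB hs hr).isPoissonLie (mcForm_rTriv hBi hB hs hr)

end RMatrix

/-! ### Orthogonal projection onto a simple subalgebra -/

section SimpleSubalgebra

variable {L : Type*} [LieRing L] [LieAlgebra ℂ L] [FiniteDimensional ℂ L]

theorem derivedSeries_one_eq_top_of_isSimple (h : LieAlgebra.IsSimple ℂ L) :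
    LieAlgebra.derivedSeries ℂ L 1 = ⊤ := by
  refine (h.eq_bot_or_eq_top _).resolve_left fun h0 => h.non_abelian ?_
  refine ⟨fun x y => (LieSubmodule.mem_bot (R := ℂ) (L := L) ⁅x, y⁆).1 ?_⟩
  rw [← h0]
  exact LieSubmodule.lie_mem_lie (LieSubmodule.mem_top x) (LieSubmodule.mem_top y)

/-- A simple Lie algebra has a non-zero trace form on each faithful representation. -/
theorem traceForm_ne_zero_of_isSimple {𝔥 : LieSubalgebra ℂ L} (h : LieAlgebra.IsSimple ℂ 𝔥) :
    LieModule.traceForm ℂ 𝔥 L ≠ 0 := by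
  intro h0
  -- Cartan's criterion: if the trace form vanished, the derived algebra, which is all of `𝔥`, would
  -- act nilpotently on `L`. By restriction `ad x` would be nilpotent on `𝔥`, and by Engel's theorem
  -- `𝔥` would be nilpotent.
  have h1 := LieModule.isNilpotent_derivedSeries_of_traceForm_eq_zero h0
  rw [LieModule.isNilpotent_iff_forall' (R := ℂ)] at h1
  have h2 : LieRing.IsNilpotent 𝔥 := by
    rw [LieAlgebra.isNilpotent_iff_forall (R := ℂ)]
    intro x
    obtain ⟨n, hn⟩ := h1 ⟨x, by rw [derivedSeries_one_eq_top_of_isSimple h]; trivial⟩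
    refine ⟨n, LinearMap.ext fun y => Subtype.ext ?_⟩
    have e : ∀ k : ℕ, (((LieAlgebra.ad ℂ 𝔥 x ^ k) y : 𝔥) : L) =
        (LieModule.toEnd ℂ 𝔥 L x ^ k) (y : L) := by
      intro k
      induction k with
      | zero => rfl
      | succ k ih => rw [pow_succ', pow_succ', Module.End.mul_apply, Module.End.mul_apply, ← ih]; rfl
    rw [e]
    exact LinearMap.congr_fun hn (y : L)
  have h3 : LieAlgebra.IsSolvable 𝔥 := inferInstance
  have h4 := LieAlgebra.IsSimple.nontrivial ℂ 𝔥
  have h5 : LieAlgebra.IsSolvable (⊤ : LieIdeal ℂ 𝔥) := inferInstance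
  have h6 := LieAlgebra.HasTrivialRadical.eq_bot_of_isSolvable (R := ℂ) (⊤ : LieIdeal ℂ 𝔥)
  obtain ⟨x, hx⟩ := exists_ne (0 : 𝔥)
  have h7 : x ∈ (⊤ : LieIdeal ℂ 𝔥) := trivial
  rw [h6] at h7
  exact hx ((LieSubmodule.mem_bot x).1 h7)

variable (B : LinearMap.BilinForm ℂ L) (hB : B.Nondegenerate) (hs : B.IsSymm)
  (hBi : ∀ X Y Z : L, B ⁅X, Y⁆ Z = B X ⁅Y, Z⁆)
include hs hBi hB

/-- Invariant forms on a simple Lie algebra are proportional. -/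
theorem exists_killingForm_eq_smul (h : LieAlgebra.IsSimple ℂ L) :
    ∃ c : ℂ, killingForm ℂ L = c • B := by
  have := LieAlgebra.IsSimple.nontrivial ℂ L
  -- Schur's lemma: `T` compares the two invariant forms and commutes with the adjoint action, so an
  -- eigenspace is a non-zero ideal, hence everything.
  let T : L →ₗ[ℂ] L := (B.toDual hB).symm.toLinearMap ∘ₗ killingForm ℂ L
  have hT : ∀ X Y, B (T X) Y = killingForm ℂ L X Y := fun X Y =>
    LinearMap.congr_fun ((B.toDual hB).apply_symm_apply (killingForm ℂ L X)) Y
  have hlie : ∀ Z X : L, T ⁅Z, X⁆ = ⁅Z, T X⁆ := by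
    intro Z X
    refine (B.toDual hB).injective (LinearMap.ext fun Y => ?_)
    change B _ _ = B _ _
    rw [← lie_skew Z (T X), map_neg, LinearMap.neg_apply, hBi, hT, hT, ← lie_skew Z X, map_neg,
      LinearMap.neg_apply]
    exact congrArg Neg.neg (LieModule.traceForm_apply_lie_apply ℂ L L X Z Y)
  obtain ⟨c, hc⟩ := Module.End.exists_eigenvalue (K := ℂ) T
  let I : LieIdeal ℂ L :=
    { Module.End.eigenspace T c with
      lie_mem := by
        intro Z X hX
        have hX' : X ∈ Module.End.eigenspace T c := hX
        change ⁅Z, X⁆ ∈ Module.End.eigenspace T c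
        rw [Module.End.mem_eigenspace_iff] at hX' ⊢
        rw [hlie, hX', lie_smul] }
  have hI : I = ⊤ := by
    refine (h.eq_bot_or_eq_top I).resolve_left fun h0 => ?_
    obtain ⟨v, hv⟩ := hc.exists_hasEigenvector
    have h1 : v ∈ I := hv.1
    rw [h0] at h1
    exact hv.2 ((LieSubmodule.mem_bot v).1 h1)
  refine ⟨c, LinearMap.ext fun X => LinearMap.ext fun Y => ?_⟩
  have h1 : X ∈ I := by rw [hI]; trivial
  have h2 : T X = c • X := Module.End.mem_eigenspace_iff.1 h1
  rw [← hT, h2]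
  simp

/-- An invariant form on a simple Lie algebra is non-degenerate on simple subalgebras. -/
theorem eq_zero_of_orthogonal (h : LieAlgebra.IsSimple ℂ L) {𝔥 : LieSubalgebra ℂ L}
    (h𝔥 : LieAlgebra.IsSimple ℂ 𝔥) {x : L} (hx : x ∈ 𝔥) (h0 : ∀ z ∈ 𝔥, B x z = 0) : x = 0 := by
  -- The radical of `B` on `𝔥`. If it is all of `𝔥`, then the Killing form of `L`, being a multiple
  -- of `B`, vanishes on `𝔥`; but there it is the trace form of `𝔥` on `L`.
  let I : LieIdeal ℂ 𝔥 :=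
    { carrier := {y | ∀ z ∈ 𝔥, B y z = 0}
      add_mem' := fun ha hb z hz =>
        (congrArg (fun W : L →ₗ[ℂ] ℂ => W z) (B.map_add _ _)).trans
        ((congrArg₂ (· + ·) (ha z hz) (hb z hz)).trans (add_zero 0))
      zero_mem' := fun z hz => by simp
      smul_mem' := fun c a ha z hz =>
        (congrArg (fun W : L →ₗ[ℂ] ℂ => W z) (B.map_smul c (a : L))).trans
        ((congrArg (c * ·) (ha z hz)).trans (mul_zero c))
      lie_mem := by
        intro w y hy z hz
        have h1 := hy ⁅(w : L), z⁆ (𝔥.lie_mem w.2 hz)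
        rw [← hBi] at h1
        change B ⁅(w : L), (y : L)⁆ z = 0
        rw [← lie_skew (w : L) (y : L), map_neg, LinearMap.neg_apply, h1, neg_zero] }
  rcases h𝔥.eq_bot_or_eq_top I with hI | hI
  · have h1 : (⟨x, hx⟩ : 𝔥) ∈ I := h0
    rw [hI, LieSubmodule.mem_bot] at h1
    exact congrArg Subtype.val h1
  · refine absurd ?_ (traceForm_ne_zero_of_isSimple h𝔥)
    obtain ⟨c, hc⟩ := exists_killingForm_eq_smul B hB hs hBi h
    refine LinearMap.ext fun y => LinearMap.ext fun z => ?_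
    have h1 : y ∈ I := by rw [hI]; trivial
    have h2 : LieModule.traceForm ℂ 𝔥 L y z = killingForm ℂ L y z := rfl
    rw [h2, hc, LinearMap.smul_apply, LinearMap.smul_apply, h1 z z.2, smul_zero]
    rfl

/-- The orthogonal projection onto a simple subalgebra. -/
theorem exists_orthogonal_projection (h : LieAlgebra.IsSimple ℂ L) {𝔥 : LieSubalgebra ℂ L}
    (h𝔥 : LieAlgebra.IsSimple ℂ 𝔥) : ∃ p : L →ₗ[ℂ] L, (∀ X, p X ∈ 𝔥) ∧ (∀ X ∈ 𝔥, p X = X) ∧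
      (∀ X, ∀ Z ∈ 𝔥, B (p X) Z = B X Z) ∧ ∀ X ∈ 𝔥, ∀ Y, p ⁅X, Y⁆ = ⁅X, p Y⁆ := by
  -- Restricted to `𝔥`, the map `S` is injective into a space of the same dimension. The projection
  -- is `S` followed by the inverse of this restriction.
  let S : L →ₗ[ℂ] Module.Dual ℂ 𝔥.toSubmodule := 𝔥.toSubmodule.subtype.dualMap ∘ₗ B
  have hinj : Function.Injective (S ∘ₗ 𝔥.toSubmodule.subtype) := by
    refine (injective_iff_map_eq_zero _).2 fun x hx => Subtype.ext ?_
    exact eq_zero_of_orthogonal B hB hs hBi h h𝔥 x.2 fun z hz => LinearMap.congr_fun hx ⟨z, hz⟩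
  let e := LinearEquiv.ofInjectiveOfFinrankEq _ hinj (Subspace.dual_finrank_eq).symm
  have hp : ∀ X, ∀ Z ∈ 𝔥, B (e.symm (S X) : L) Z = B X Z := fun X Z hZ =>
    LinearMap.congr_fun (e.apply_symm_apply (S X)) ⟨Z, hZ⟩
  have huniq : ∀ X ∈ 𝔥, ∀ Y ∈ 𝔥, (∀ Z ∈ 𝔥, B X Z = B Y Z) → X = Y := fun X hX Y hY hXY =>
    sub_eq_zero.1 (eq_zero_of_orthogonal B hB hs hBi h h𝔥 (𝔥.sub_mem hX hY) fun Z hZ => by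
      rw [map_sub, LinearMap.sub_apply, hXY Z hZ, sub_self])
  refine ⟨𝔥.toSubmodule.subtype ∘ₗ e.symm.toLinearMap ∘ₗ S, fun X => (e.symm (S X)).2,
    fun X hX => huniq _ (e.symm (S X)).2 _ hX (hp X), hp, fun X hX Y => ?_⟩
  refine huniq _ (e.symm (S _)).2 _ (𝔥.lie_mem hX (e.symm (S Y)).2) fun Z hZ => ?_
  have h1 : ∀ W : L, B ⁅X, W⁆ Z = -B W ⁅X, Z⁆ := fun W => by
    rw [← lie_skew, map_neg, LinearMap.neg_apply, hBi]
  exact (hp _ Z hZ).trans ((h1 _).trans ((congrArg Neg.neg (hp Y _ (𝔥.lie_mem hX hZ))).symm.trans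
    (h1 _).symm))

end SimpleSubalgebra

/-- A left inverse of an injective map with a given kernel. -/
theorem exists_leftInverse_comp_eq {V W : Type*} [AddCommGroup V] [Module ℂ V] [AddCommGroup W]
    [Module ℂ W] {f : V →ₗ[ℂ] W} (hf : Function.Injective f) {p : W →ₗ[ℂ] W}
    (hp : ∀ x, p x ∈ LinearMap.range f) (hpf : ∀ x ∈ LinearMap.range f, p x = x) :
    ∃ q : W →ₗ[ℂ] V, q ∘ₗ f = LinearMap.id ∧ ∀ x, f (q x) = p x := by
  obtain ⟨g, hg⟩ := f.exists_leftInverse_of_injective (LinearMap.ker_eq_bot.2 hf)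
  have hg' : ∀ x, g (f x) = x := LinearMap.congr_fun hg
  refine ⟨g ∘ₗ p, LinearMap.ext fun x => ?_, fun x => ?_⟩
  · rw [LinearMap.comp_apply, LinearMap.comp_apply, hpf _ (LinearMap.mem_range_self f x), hg']
    rfl
  · obtain ⟨y, hy⟩ := hp x
    rw [LinearMap.comp_apply, ← hy, hg']

/-! ### The orthogonal projection as a reduction of both groups -/

section Projection

variable {E : Type*} [NormedAddCommGroup E] [NormedSpace ℂ E] [FiniteDimensional ℂ E]
  [CompleteSpace E]
  {G : Type*} [TopologicalSpace G] [ChartedSpace E G] [Group G] [LieGroup 𝓘(ℂ, E) ω G]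

/-- An orthogonal projection of the Lie algebra onto a subalgebra invariant under `r`. -/
structure IsOrthogonalProjection (B : LinearMap.BilinForm ℂ (Lie E G))
    (r : Lie E G →ₗ[ℂ] Lie E G) (𝔥 : LieSubalgebra ℂ (Lie E G)) (p : Lie E G →ₗ[ℂ] Lie E G) :
    Prop where
  symm : B.IsSymm
  invariant : ∀ X Y Z : Lie E G, B ⁅X, Y⁆ Z = B X ⁅Y, Z⁆
  antisymm : ∀ X Y, B (r X) Y = -B X (r Y)
  map_mem : ∀ X ∈ 𝔥, r X ∈ 𝔥
  nondegenerate : ∀ X ∈ 𝔥, (∀ Z ∈ 𝔥, B X Z = 0) → X = 0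
  mem : ∀ X, p X ∈ 𝔥
  apply_of_mem : ∀ X ∈ 𝔥, p X = X
  left_eq : ∀ X, ∀ Z ∈ 𝔥, B (p X) Z = B X Z
  map_lie : ∀ X ∈ 𝔥, ∀ Y, p ⁅X, Y⁆ = ⁅X, p Y⁆

namespace IsOrthogonalProjection

variable {B : LinearMap.BilinForm ℂ (Lie E G)} {r : Lie E G →ₗ[ℂ] Lie E G}
  {𝔥 : LieSubalgebra ℂ (Lie E G)} {p : Lie E G →ₗ[ℂ] Lie E G}
  (h : IsOrthogonalProjection B r 𝔥 p)
include h

theorem right_eq {X : Lie E G} (hX : X ∈ 𝔥) (Z : Lie E G) : B X (p Z) = B X Z := by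
  rw [h.symm.eq X (p Z), h.left_eq Z X hX]
  exact h.symm.eq Z X

theorem comp_self (X : Lie E G) : p (p X) = p X := h.apply_of_mem _ (h.mem X)

/-- Being antisymmetric, `r` preserves the orthogonal complement of `𝔥` along with `𝔥`. -/
theorem comp_r (X : Lie E G) : p (r X) = r (p X) := by
  refine sub_eq_zero.1 (h.nondegenerate _ (𝔥.sub_mem (h.mem _) (h.map_mem _ (h.mem _)))
    fun Z hZ => ?_)
  rw [map_sub, LinearMap.sub_apply, h.left_eq _ Z hZ, h.antisymm, h.antisymm,
    h.left_eq _ _ (h.map_mem Z hZ), sub_self]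

theorem map_rBracket {X : Lie E G} (hX : X ∈ 𝔥) (Y : Lie E G) :
    p (rBracket r X Y) = rBracket r X (p Y) := by
  simp only [rBracket, map_smul, map_add, h.map_lie _ hX, h.map_lie _ (h.map_mem X hX), h.comp_r]

/-- Used to recognize the element of `𝔤` that represents a covector factoring through the
projection. -/
theorem mem_of_apply_eq {X : Lie E G} (hX : ∀ Z, B X (p Z) = B X Z) (hB : B.Nondegenerate) :
    X ∈ 𝔥 := by
  have : X = p X := (B.toDual hB).injective (LinearMap.ext fun Z => by
    change B X Z = B (p X) Z
    rw [← hX, ← h.left_eq X _ (h.mem Z), h.right_eq (h.mem X)])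
  rw [this]
  exact h.mem X

theorem apply_lie_eq_zero {V X Y : Lie E G} (hV : V ∈ 𝔥) (hY : Y ∈ 𝔥)
    (hX : ∀ Z ∈ 𝔥, B X Z = 0) : B V ⁅X, Y⁆ = 0 := by
  rw [← h.invariant, ← lie_skew, map_neg, LinearMap.neg_apply, h.invariant,
    hX _ (𝔥.lie_mem hV hY), neg_zero]

theorem apply_rBracket_eq_zero {V X Y : Lie E G} (hV : V ∈ 𝔥) (hY : Y ∈ 𝔥)
    (hX : ∀ Z ∈ 𝔥, B X Z = 0) : B V (rBracket r X Y) = 0 := by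
  have h1 : ∀ Z ∈ 𝔥, B (r X) Z = 0 := fun Z hZ => by
    rw [h.antisymm, hX _ (h.map_mem Z hZ), neg_zero]
  rw [rBracket, map_smul, map_add, h.apply_lie_eq_zero hV (h.map_mem Y hY) hX,
    h.apply_lie_eq_zero hV hY h1, add_zero, smul_zero]

end IsOrthogonalProjection

variable {B : LinearMap.BilinForm ℂ (Lie E G)} {r : Lie E G →ₗ[ℂ] Lie E G}
  {𝔥 : LieSubalgebra ℂ (Lie E G)} {p : Lie E G →ₗ[ℂ] Lie E G}
  (h : IsOrthogonalProjection B r 𝔥 p) (hB : B.Nondegenerate)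

section Subgroup

variable {α : ℂ} [ConnectedSpace G] (hr : IsRMatrix B r α)
  {F : Type*} [NormedAddCommGroup F] [NormedSpace ℂ F] [FiniteDimensional ℂ F]
  [CompleteSpace F]
  {H : Type*} [TopologicalSpace H] [ChartedSpace F H] [Group H] [LieGroup 𝓘(ℂ, F) ω H]
  {i : H →* G} (hi : IsLieSubgroup (E := E) (F := F) i 𝔥.toSubmodule)

omit [ConnectedSpace G] [CompleteSpace F] [LieGroup 𝓘(ℂ, F) ω H] [CompleteSpace E]
  [LieGroup 𝓘(ℂ, E) ω G] in
theorem IsLieSubgroup.lieMap_injective {i : H →* G} {V : Submodule ℂ (Lie E G)}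
    (hi : IsLieSubgroup (E := E) (F := F) i V) : Function.Injective (lieMap F E i) :=
  hi.submanifold.immersion 1

omit [ConnectedSpace G] in
include hi in
theorem lieMap_mem (x : Lie F H) : lieMap F E i x ∈ 𝔥 := by
  have : lieMap F E i x ∈ 𝔥.toSubmodule := by
    rw [← hi.range_eq]
    exact LinearMap.mem_range_self _ x
  exact this

include hi h hB hr

/-- The projection is lifted through the injective map `lieMap`. Covectors that vanish on `𝔥` are
represented by elements orthogonal to `𝔥`, and covectors that factor through `q` by elements of `𝔥`.
The mixed term is then a value of `B V ⁅X, Y⁆_r`, zero by `apply_rBracket_eq_zero`. -/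
theorem exists_isReduction : ∃ q : Lie E G →ₗ[ℂ] Lie F H,
    IsReduction i (rTriv B hB r) q ∧ ∀ X, lieMap F E i (q X) = p X := by
  have hinj := hi.lieMap_injective
  obtain ⟨q, hq, hqp⟩ := exists_leftInverse_comp_eq (p := p) hinj
    (fun X => by rw [hi.range_eq]; exact h.mem X)
    (fun X hX => by rw [hi.range_eq] at hX; exact h.apply_of_mem X hX)
  have hqp' : ∀ Z, q (p Z) = q Z := fun Z => hinj (by rw [hqp, hqp, h.comp_self])
  refine ⟨q, ⟨hi.submanifold.holomorphic, hq, fun x y => hinj ?_, fun ξ hξ θ x => ?_⟩, hqp⟩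
  · rw [hqp, lieMap_lie hi.submanifold.holomorphic, hqp, h.map_lie _ (lieMap_mem hi x)]
  · obtain ⟨X, rfl⟩ := exists_eq_flat hB ξ
    obtain ⟨Y, hY⟩ := exists_eq_flat hB (θ ∘ₗ q)
    have hX0 : ∀ Z ∈ 𝔥, B X Z = 0 := by
      intro Z hZ
      have : Z ∈ 𝔥.toSubmodule := hZ
      rw [← hi.range_eq] at this
      obtain ⟨z, rfl⟩ := this
      exact LinearMap.congr_fun hξ z
    rw [← hY, lin_rTriv h.invariant hB h.symm hr]
    refine h.apply_rBracket_eq_zero (lieMap_mem hi x) (h.mem_of_apply_eq (fun Z => ?_) hB) hX0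
    rw [hY, LinearMap.comp_apply, hqp', LinearMap.comp_apply]

end Subgroup

section DualSubgroup

variable {D : Type*} [NormedAddCommGroup D] [NormedSpace ℂ D] [FiniteDimensional ℂ D]
  [CompleteSpace D]
  {Gr : Type*} [TopologicalSpace Gr] [ChartedSpace D Gr] [Group Gr] [LieGroup 𝓘(ℂ, D) ω Gr]
  {φ : Lie E G ≃ₗ[ℂ] Lie D Gr} {Q : TwoTensor D Gr} (hQ : IsDualGroup B r φ Q)
include hQ

theorem IsDualGroup.isCocycle : IsCocycle (triv Q) :=
  isCocycle_of_isPoissonLie (by rw [ofTriv_triv]; exact hQ.poissonLie)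

theorem IsDualGroup.mcForm_eq_zero (u : Gr) (ξ ζ χ : Module.Dual ℂ (Lie D Gr)) :
    mcForm (triv Q) u ξ ζ χ = 0 :=
  mcForm_eq_zero_of_isPoissonLie (by rw [ofTriv_triv]; exact hQ.poissonLie) u ξ ζ χ

theorem IsDualGroup.lin_eq (X Y : Lie E G) :
    lin (triv Q) (B X ∘ₗ φ.symm.toLinearMap) (B Y ∘ₗ φ.symm.toLinearMap) =
      B ⁅X, Y⁆ ∘ₗ φ.symm.toLinearMap := by
  have h1 := hQ.linearizes
  rw [← ofTriv_triv Q] at h1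
  exact (hQ.isCocycle.linearizesTo_iff _).1 h1 X Y

variable
  {F : Type*} [NormedAddCommGroup F] [NormedSpace ℂ F] [FiniteDimensional ℂ F]
  [CompleteSpace F]
  {H : Type*} [TopologicalSpace H] [ChartedSpace F H] [Group H] [LieGroup 𝓘(ℂ, F) ω H]
  {j : H →* Gr} (hj : IsLieSubgroup (E := D) (F := F) j (𝔥.toSubmodule.map φ.toLinearMap))

omit hQ in
include hj in
theorem symm_lieMap_mem (x : Lie F H) : φ.symm (lieMap F D j x) ∈ 𝔥 := by
  have : lieMap F D j x ∈ 𝔥.toSubmodule.map φ.toLinearMap := by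
    rw [← hj.range_eq]
    exact LinearMap.mem_range_self _ x
  obtain ⟨X, hX, e⟩ := this
  rw [← e]
  exact (φ.symm_apply_apply X).symm ▸ hX

include h hB hj

/-- The roles of the brackets are exchanged: equivariance of the projection is needed for `[·,·]_r`,
where commutation with `r` enters, and the linearization is the bracket of `𝔤`, where invariance of
`B` suffices. -/
theorem exists_isReduction_dual : ∃ q : Lie D Gr →ₗ[ℂ] Lie F H,
    IsReduction j (triv Q) q ∧ ∀ x, lieMap F D j (q x) = φ (p (φ.symm x)) := by
  have hinj := hj.lieMap_injective
  obtain ⟨q, hq, hqp⟩ := exists_leftInverse_comp_eq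
    (p := φ.toLinearMap ∘ₗ p ∘ₗ φ.symm.toLinearMap) hinj
    (fun x => by rw [hj.range_eq]; exact ⟨_, h.mem _, rfl⟩)
    (fun x hx => by
      rw [hj.range_eq] at hx
      obtain ⟨X, hX, rfl⟩ := hx
      simp only [LinearMap.comp_apply, LinearEquiv.coe_coe, LinearEquiv.symm_apply_apply,
        h.apply_of_mem X hX])
  simp only [LinearMap.comp_apply, LinearEquiv.coe_coe] at hqp
  have hqp' : ∀ Z, q (φ (p Z)) = q (φ Z) := fun Z => hinj (by
    rw [hqp, hqp, φ.symm_apply_apply, φ.symm_apply_apply, h.comp_self])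
  refine ⟨q, ⟨hj.submanifold.holomorphic, hq, fun x y => hinj ?_, fun ξ hξ θ x => ?_⟩, hqp⟩
  · rw [hqp, lieMap_lie hj.submanifold.holomorphic, hqp]
    obtain ⟨X, hX⟩ := φ.surjective (lieMap F D j x)
    obtain ⟨Y, rfl⟩ := φ.surjective y
    have hX' : X ∈ 𝔥 := by
      have := symm_lieMap_mem hj x
      rwa [← hX, φ.symm_apply_apply] at this
    rw [← hX, ← hQ.map_rBracket, φ.symm_apply_apply, φ.symm_apply_apply, ← hQ.map_rBracket,
      h.map_rBracket hX']
  · obtain ⟨X, hX⟩ := exists_eq_flat hB (ξ ∘ₗ φ.toLinearMap)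
    obtain ⟨Y, hY⟩ := exists_eq_flat hB ((θ ∘ₗ q) ∘ₗ φ.toLinearMap)
    have e : ∀ {ξ : Module.Dual ℂ (Lie D Gr)} {X : Lie E G}, B X = ξ ∘ₗ φ.toLinearMap →
        ξ = B X ∘ₗ φ.symm.toLinearMap := by
      rintro ξ X hX
      rw [hX]
      exact LinearMap.ext fun x => congrArg ξ (φ.apply_symm_apply x).symm
    have hX0 : ∀ Z ∈ 𝔥, B X Z = 0 := by
      intro Z hZ
      have : φ Z ∈ 𝔥.toSubmodule.map φ.toLinearMap := ⟨Z, hZ, rfl⟩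
      rw [← hj.range_eq] at this
      obtain ⟨z, hz⟩ := this
      rw [hX, LinearMap.comp_apply, LinearEquiv.coe_coe, ← hz]
      exact LinearMap.congr_fun hξ z
    rw [e hX, e hY, hQ.lin_eq, LinearMap.comp_apply, LinearEquiv.coe_coe]
    have h1 : B ⁅X, Y⁆ (φ.symm (lieMap F D j x)) = B (φ.symm (lieMap F D j x)) ⁅X, Y⁆ :=
      h.symm.eq _ _
    rw [h1]
    refine h.apply_lie_eq_zero (symm_lieMap_mem hj x) (h.mem_of_apply_eq (fun Z => ?_) hB) hX0
    rw [hY]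
    exact congrArg θ (hqp' Z)

end DualSubgroup

end Projection

/-! ### Logarithmic derivatives along right-invariant fields -/

section RightLog

variable {E : Type*} [NormedAddCommGroup E] [NormedSpace ℂ E] [FiniteDimensional ℂ E]
  [CompleteSpace E]
  {G : Type*} [TopologicalSpace G] [ChartedSpace E G] [Group G] [LieGroup 𝓘(ℂ, E) ω G]
  {D : Type*} [NormedAddCommGroup D] [NormedSpace ℂ D] [FiniteDimensional ℂ D]
  [CompleteSpace D]
  {K : Type*} [TopologicalSpace K] [ChartedSpace D K] [Group K] [LieGroup 𝓘(ℂ, D) ω K]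

omit [FiniteDimensional ℂ E] [CompleteSpace E] [LieGroup 𝓘(ℂ, E) ω G] in
theorem rightLog_comp {M : Type*} [TopologicalSpace M] [ChartedSpace D M]
    {F : Type*} [NormedAddCommGroup F] [NormedSpace ℂ F]
    {N : Type*} [TopologicalSpace N] [ChartedSpace F N] {f : M → G} {i : N → M} {u : N}
    (hf : MDifferentiableAt 𝓘(ℂ, D) 𝓘(ℂ, E) f (i u))
    (hi : MDifferentiableAt 𝓘(ℂ, F) 𝓘(ℂ, D) i u) :
    rightLog F E (f ∘ i) u = rightLog D E f (i u) ∘ₗ tangentMapAt D F i u := by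
  have h : tangentMapAt E F (f ∘ i) u = tangentMapAt E D f (i u) ∘ₗ tangentMapAt D F i u :=
    congrArg ContinuousLinearMap.toLinearMap (mfderiv_comp u hf hi)
  rw [rightLog, h]
  rfl

theorem rightLog_hom {p : K →* G} (hp : ContMDiff 𝓘(ℂ, D) 𝓘(ℂ, E) ω p) (u : K) (x : Lie D K) :
    rightLog D E p u (rightTranslation D u x) = lieMap D E p x := by
  have h1 := LinearMap.congr_fun (rightLog_comp (f := (id : G → G)) (u := u) mdifferentiableAt_id
    (hp.mdifferentiableAt (by simp))) (rightTranslation D u x)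
  refine h1.trans ((congrArg (rightLog E E id (p u)) (tangentMapAt_rightTranslation hp u x)).trans ?_)
  exact rightLog_rightTranslation (p u) (lieMap D E p x)

/-- The differential of a vector valued map gives derivatives along right-invariant fields. -/
theorem hasWDeriv_mvfderiv {V : Type*} [NormedAddCommGroup V] [NormedSpace ℂ V]
    [FiniteDimensional ℂ V] {f : K → V} {u : K} (hf : ContMDiffAt 𝓘(ℂ, D) 𝓘(ℂ, V) ω f u)
    (x : Lie D K) : HasWDeriv (fun t => f (curve x t * u))
      (mvfderiv 𝓘(ℂ, D) f u (rightTranslation D u x)) := by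
  intro l
  have h1 : HolAt D (fun v => l (f v)) u := wHolAt_of_contMDiffAt hf l
  have h2 := hasDerivAt_mul_right h1 x
  refine h2.congr_deriv ?_
  rw [← diff_comp_rightTranslation h1]
  have h3 : mfderiv 𝓘(ℂ, D) 𝓘(ℂ, ℂ) (fun v => l (f v)) u =
      (mfderiv 𝓘(ℂ, V) 𝓘(ℂ, ℂ) (LinearMap.toContinuousLinearMap l) (f u)).comp
        (mfderiv 𝓘(ℂ, D) 𝓘(ℂ, V) f u) :=
    mfderiv_comp (g := LinearMap.toContinuousLinearMap l) u
      (LinearMap.toContinuousLinearMap l).mdifferentiableAt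
      (hf.mdifferentiableAt (by simp))
  rw [ContinuousLinearMap.mfderiv_eq] at h3
  exact congrArg (fun L : D →L[ℂ] ℂ => L (rightTranslation D u x)) h3

theorem rightTranslation_one (x : Lie D K) : rightTranslation D (1 : K) x = x := by
  have h : (fun s : K => s * 1) = id := by funext s; simp
  have h1 : (mfderiv 𝓘(ℂ, D) 𝓘(ℂ, D) (fun s : K => s * 1) 1 : D →L[ℂ] D) =
      ContinuousLinearMap.id ℂ D := by
    rw [h]; exact mfderiv_id
  exact congrArg (fun L : D →L[ℂ] D => L x) h1

theorem hasWDeriv_Ad_hom {p : K →* G} (hp : ContMDiff 𝓘(ℂ, D) 𝓘(ℂ, E) ω p) (x : Lie D K) :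
    HasWDeriv (fun t => Ad E (p (curve x t))) (LieAlgebra.ad ℂ (Lie E G) (lieMap D E p x)) :=
  HasWDeriv.comp_hom hp (w := fun g => Ad E g) (wHolAt_Ad 1) (hasWDeriv_Ad _)

theorem hasWDeriv_Ad_inv_hom {p : K →* G} (hp : ContMDiff 𝓘(ℂ, D) 𝓘(ℂ, E) ω p) (x : Lie D K) :
    HasWDeriv (fun t => Ad E (p (curve x t))⁻¹)
      (-LieAlgebra.ad ℂ (Lie E G) (lieMap D E p x)) :=
  HasWDeriv.comp_hom hp (w := fun g => Ad E g⁻¹) (wHolAt_Ad_inv 1) (hasWDeriv_Ad_inv _)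

end RightLog

/-! ### Explicit formulas on the dual group, factorizable and triangular -/

section DualFormulas

variable {E : Type*} [NormedAddCommGroup E] [NormedSpace ℂ E] [FiniteDimensional ℂ E]
  [CompleteSpace E]
  {G : Type*} [TopologicalSpace G] [ChartedSpace E G] [Group G] [LieGroup 𝓘(ℂ, E) ω G]
  [ConnectedSpace G]
  {D : Type*} [NormedAddCommGroup D] [NormedSpace ℂ D] [FiniteDimensional ℂ D]
  [CompleteSpace D]
  {Gr : Type*} [TopologicalSpace Gr] [ChartedSpace D Gr] [Group Gr] [LieGroup 𝓘(ℂ, D) ω Gr]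
  [ConnectedSpace Gr]
  {B : LinearMap.BilinForm ℂ (Lie E G)} (hB : B.Nondegenerate) (hs : B.IsSymm)
  (hBi : ∀ X Y Z : Lie E G, B ⁅X, Y⁆ Z = B X ⁅Y, Z⁆)
  {r : Lie E G →ₗ[ℂ] Lie E G} (hr : ∀ X Y, B (r X) Y = -B X (r Y))
  {φ : Lie E G ≃ₗ[ℂ] Lie D Gr} {Q : TwoTensor D Gr} (hQ : IsDualGroup B r φ Q)

/-- The covector at the unit of the dual group that an element of the Lie algebra defines. -/
def dualFlat (B : LinearMap.BilinForm ℂ (Lie E G)) (φ : Lie E G ≃ₗ[ℂ] Lie D Gr) (X : Lie E G) :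
    Module.Dual ℂ (Lie D Gr) := B X ∘ₗ φ.symm.toLinearMap

theorem dualFlat_apply (X Y : Lie E G) : dualFlat B φ X (φ Y) = B X Y :=
  congrArg (B X) (φ.symm_apply_apply Y)

include hB in
theorem dualFlat_injective : Function.Injective (dualFlat B φ) := fun X Y hXY =>
  (B.toDual hB).injective (LinearMap.ext fun Z => by
    change B X Z = B Y Z
    rw [← dualFlat_apply (φ := φ), hXY, dualFlat_apply])

section Coadjoint
variable {C : Gr → Lie E G → Lie E G}
  (hC : ∀ u X, dualFlat B φ X ∘ₗ Ad D u = dualFlat B φ (C u X))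
include hB hC

theorem coadjoint_mul (a b : Gr) (X : Lie E G) : C (a * b) X = C b (C a X) :=
  dualFlat_injective hB (φ := φ) (by rw [← hC, ← hC, ← hC, Ad_mul, LinearMap.comp_assoc])

theorem coadjoint_inv (a : Gr) (X : Lie E G) : C a⁻¹ (C a X) = X := by
  rw [← coadjoint_mul hB hC, mul_inv_cancel]
  exact dualFlat_injective hB (φ := φ) (by rw [← hC, Ad_one, LinearMap.comp_id])

end Coadjoint

section Factorizable

variable {c : ℂ} (hc : c ≠ 0) {p m : Gr →* G} (hF : IsFactorizableRealization r c φ p m)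

theorem rShift_sub (X : Lie E G) : rShift r c X - rShift r (-c) X = c • X := by
  simp only [rShift, LinearMap.smul_apply, LinearMap.add_apply, LinearMap.id_apply]
  module

/-- The transpose of the adjoint action, for a dual group realized in `G × G`. -/
def coadFactorizable (r : Lie E G →ₗ[ℂ] Lie E G) (c : ℂ) (p m : Gr →* G) (u : Gr)
    (X : Lie E G) : Lie E G :=
  c⁻¹ • (rShift r c (Ad E (m u)⁻¹ X) - rShift r (-c) (Ad E (p u)⁻¹ X))

-- An element of `𝔤` is recovered from its images in the double by `r_+ - r_- = c`, and
-- homomorphisms intertwine the adjoint actions.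
include hc hF in
theorem symm_Ad_factorizable (u : Gr) (X : Lie E G) : φ.symm (Ad D u (φ X)) =
    c⁻¹ • (Ad E (p u) (rShift r c X) - Ad E (m u) (rShift r (-c) X)) := by
  have h1 := hF.deriv_left (φ.symm (Ad D u (φ X)))
  have h2 := hF.deriv_right (φ.symm (Ad D u (φ X)))
  rw [φ.apply_symm_apply, lieMap_Ad hF.holomorphic_left, hF.deriv_left] at h1
  rw [φ.apply_symm_apply, lieMap_Ad hF.holomorphic_right, hF.deriv_right] at h2
  rw [h1, h2, rShift_sub, smul_smul, inv_mul_cancel₀ hc, one_smul]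

include hr in
theorem rShift_antisymm (X Y : Lie E G) : B X (rShift r c Y) = -B (rShift r (-c) X) Y := by
  simp only [rShift, LinearMap.smul_apply, LinearMap.add_apply, LinearMap.id_apply, map_smul,
    map_add, hr, smul_eq_mul]
  ring

include hBi hr hc hF in
theorem dualFlat_Ad_factorizable (u : Gr) (X : Lie E G) :
    dualFlat B φ X ∘ₗ Ad D u = dualFlat B φ (coadFactorizable r c p m u X) := by
  refine LinearMap.ext fun y => ?_
  obtain ⟨Y, rfl⟩ := φ.surjective y
  rw [dualFlat_apply]
  change B X (φ.symm (Ad D u (φ Y))) = _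
  have e : ∀ X, B X (rShift r (-c) Y) = -B (rShift r c X) Y := fun X => by
    have := rShift_antisymm (c := -c) hr X Y
    rwa [neg_neg] at this
  rw [symm_Ad_factorizable hc hF, map_smul, map_sub, ← invariant_Ad_inv_left hBi,
    ← invariant_Ad_inv_left hBi, rShift_antisymm hr, e, coadFactorizable]
  simp only [map_smul, map_sub, LinearMap.smul_apply, LinearMap.sub_apply, smul_eq_mul]
  ring

/-- Isolates the coadjoint action on `Y`, which is multiplicative in `u`; the cocycle identity then
concerns only `Ad_p - Ad_m`. -/
theorem piFactorizable_eq (hc : c ≠ 0) (u : Gr) (X Y : Lie E G) :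
    (c ^ 2)⁻¹ * piFactorizable B r c (p u) (m u) X Y =
      -c⁻¹ * B X ((Ad E (p u) - Ad E (m u)) (coadFactorizable r c p m u Y)) := by
  rw [piFactorizable, coadFactorizable, map_smul, map_smul, smul_eq_mul,
    ← neg_sub (rShift r (-c) (Ad E (p u)⁻¹ Y)), map_neg, map_neg]
  field_simp

include hB hBi hr hc hF in
theorem piFactorizable_mul (a b : Gr) (X Y : Lie E G) :
    (c ^ 2)⁻¹ * piFactorizable B r c (p (a * b)) (m (a * b)) X Y =
      (c ^ 2)⁻¹ * piFactorizable B r c (p a) (m a) X Y +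
      (c ^ 2)⁻¹ * piFactorizable B r c (p b) (m b) (coadFactorizable r c p m a X)
        (coadFactorizable r c p m a Y) := by
  have hC := dualFlat_Ad_factorizable hBi hr hc hF
  rw [piFactorizable_eq hc, piFactorizable_eq hc, piFactorizable_eq hc, coadjoint_mul hB hC]
  set V := coadFactorizable r c p m a Y
  set U := coadFactorizable r c p m b V with hU
  -- This is the coadjoint action of `b⁻¹`, which takes `U` back to `V`. With `c = r_+ - r_-` it
  -- expresses `Ad_{p b} U` and `Ad_{m b} U` through `V` and their difference, in the shape of
  -- `symm_Ad_factorizable` for `a`.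
  have e1 : c • V = rShift r c (Ad E (m b) U) - rShift r (-c) (Ad E (p b) U) := by
    rw [← coadjoint_inv hB hC b V, ← hU, coadFactorizable, smul_smul, mul_inv_cancel₀ hc, one_smul,
      map_inv, map_inv, inv_inv, inv_inv]
  have e2 : ∀ W, B (coadFactorizable r c p m a X) W = B X (φ.symm (Ad D a (φ W))) := fun W => by
    rw [← dualFlat_apply (φ := φ), ← hC]; rfl
  rw [e2, symm_Ad_factorizable hc hF, ← mul_add, ← map_add]
  have e3 : c • Ad E (p b) U = c • V + rShift r c ((Ad E (p b) - Ad E (m b)) U) := by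
    rw [e1, ← rShift_sub (r := r), LinearMap.sub_apply, map_sub]
    abel
  have e4 : c • Ad E (m b) U = c • V + rShift r (-c) ((Ad E (p b) - Ad E (m b)) U) := by
    rw [e1, ← rShift_sub (r := r), LinearMap.sub_apply, map_sub]
    abel
  congr 2
  have e3' : Ad E (p b) U = V + c⁻¹ • rShift r c ((Ad E (p b) - Ad E (m b)) U) := by
    rw [← inv_smul_smul₀ hc (Ad E (p b) U), e3, smul_add, inv_smul_smul₀ hc]
  have e4' : Ad E (m b) U = V + c⁻¹ • rShift r (-c) ((Ad E (p b) - Ad E (m b)) U) := by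
    rw [← inv_smul_smul₀ hc (Ad E (m b) U), e4, smul_add, inv_smul_smul₀ hc]
  set W := (Ad E (p b) - Ad E (m b)) U
  have e5 := congrArg (Ad E (p a)) e3'
  have e6 := congrArg (Ad E (m a)) e4'
  rw [map_add, map_smul] at e5 e6
  rw [map_mul, map_mul, Ad_mul, Ad_mul, LinearMap.sub_apply, LinearMap.comp_apply,
    LinearMap.comp_apply, e5, e6, LinearMap.sub_apply]
  module

include hB hBi hr hc hF hQ in
/-- The dual Poisson-Lie structure in the factorizable case. -/
theorem triv_apply_factorizable (u : Gr) (X Y : Lie E G) :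
    triv Q u (dualFlat B φ X) (dualFlat B φ Y) =
      (c ^ 2)⁻¹ * piFactorizable B r c (p u) (m u) X Y := by
  -- The factor `(c ^ 2)⁻¹` compensates for the forms `thetaFactorizable`, which are `c` times the
  -- covectors `dualFlat`.
  refine hQ.isCocycle.apply_eq_of_hasDerivAt (e := dualFlat B φ)
    (C := coadFactorizable r c p m)
    (β := fun u X Y => (c ^ 2)⁻¹ * piFactorizable B r c (p u) (m u) X Y)
    (dualFlat_Ad_factorizable hBi hr hc hF) (fun u X Y => ?_) (fun X Y => ?_)
    (piFactorizable_mul hB hBi hr hc hF) (fun X Y x => ?_) u X Y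
  · have hA := fun {p : Gr →* G} (hp : ContMDiff 𝓘(ℂ, D) 𝓘(ℂ, E) ω p) =>
      (wHolAt_Ad (p u)).comp_map (i := p) (p := u) hp.contMDiffAt
    have hA' := fun {p : Gr →* G} (hp : ContMDiff 𝓘(ℂ, D) 𝓘(ℂ, E) ω p) =>
      (wHolAt_Ad_inv (p u)).comp_map (i := p) (p := u) hp.contMDiffAt
    have h1 := (((hA hF.holomorphic_left).sub (hA hF.holomorphic_right)).eval
      ((((hA' hF.holomorphic_left).apply Y).map (rShift r (-c))).sub
        (((hA' hF.holomorphic_right).apply Y).map (rShift r c)))).map ((c ^ 2)⁻¹ • B X)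
    exact wHolAt_iff.1 h1
  · simp [piFactorizable]
  · obtain ⟨V, rfl⟩ := φ.surjective x
    have h1 := (((hasWDeriv_Ad_hom hF.holomorphic_left (φ V)).sub
      (hasWDeriv_Ad_hom hF.holomorphic_right (φ V))).eval
      ((((hasWDeriv_Ad_inv_hom hF.holomorphic_left (φ V)).apply Y).map (rShift r (-c))).sub
        (((hasWDeriv_Ad_inv_hom hF.holomorphic_right (φ V)).apply Y).map (rShift r c)))).map
          ((c ^ 2)⁻¹ • B X)
    refine (hasWDeriv_iff.1 h1).congr_deriv ?_
    have h2 : lin (triv Q) (dualFlat B φ X) (dualFlat B φ Y) = dualFlat B φ ⁅X, Y⁆ :=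
      hQ.lin_eq X Y
    rw [h2, dualFlat_apply, hBi, ← lie_skew Y V]
    simp only [curve_zero, map_one, inv_one, Ad_one, LinearMap.id_apply, sub_self,
      LinearMap.zero_apply, add_zero, LinearMap.sub_apply, LieAlgebra.ad_apply, hF.deriv_left,
      hF.deriv_right, ← sub_lie, rShift_sub, ← neg_sub (rShift r c Y), smul_lie, map_neg,
      map_smul, LinearMap.smul_apply, smul_eq_mul]
    field_simp

include hs hF in
theorem thetaFactorizable_rightTranslation (u : Gr) (X : Lie E G) :
    thetaFactorizable D B p m u X ∘ₗ rightTranslation D u = c • dualFlat B φ X := by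
  refine LinearMap.ext fun y => ?_
  obtain ⟨Y, rfl⟩ := φ.surjective y
  change B (rightLog D E p u (rightTranslation D u (φ Y)) -
    rightLog D E m u (rightTranslation D u (φ Y))) X = _
  rw [rightLog_hom hF.holomorphic_left, rightLog_hom hF.holomorphic_right, hF.deriv_left,
    hF.deriv_right, rShift_sub, LinearMap.smul_apply, dualFlat_apply, map_smul,
    LinearMap.smul_apply]
  exact congrArg (c * ·) (hs.eq Y X)

end Factorizable
section Triangular

include hB hBi hr in
/-- The cocycle identity behind the triangular case. -/
theorem triangular_cocycle {s : Lie E G →ₗ[ℂ] Lie E G} (hsk : ∀ X Y, B (s X) Y = -B X (s Y))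
    {W : Lie E G} (hW : ∀ U, r ⁅W, s U⁆ = s U - r U) (x y a b : Lie E G) :
    B x (⁅W, y⁆ + b) - B (⁅W, x⁆ + a) (s (⁅W, y⁆ + b)) =
      (B x b - B a (r b)) + (B (x + r a) ⁅W, y + r b⁆ - B ⁅W, x + r a⁆ (s ⁅W, y + r b⁆)) := by
  -- The transpose of `hW`: the operators `r`, `s` and `ad W` are all antisymmetric for `B`.
  have hW' : ∀ U, s ⁅W, r U⁆ = s U - r U := fun U =>
    (B.toDual hB).injective (LinearMap.ext fun V => by
      change B _ V = B _ V
      have h1 := invariant_ad hBi W (r U) (s V)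
      have h2 := hr U ⁅W, s V⁆
      rw [hW, map_sub] at h2
      rw [hsk, map_sub, LinearMap.sub_apply, hsk, hr]
      linear_combination -h1 + h2)
  have e1 := invariant_ad hBi W x (r b)
  have e2 := invariant_ad hBi W (r a) (r b)
  have e3 := fun v => hsk ⁅W, r a⁆ v
  have e4 := fun v => hsk a v
  have e5 := hr a b
  simp only [hW', map_sub, LinearMap.sub_apply] at e3
  simp only [lie_add, map_add, LinearMap.add_apply, hW', map_sub]
  linear_combination -e1 - e2 + e3 ⁅W, y⁆ + e3 b - e4 ⁅W, y⁆ - e4 b + e5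

/-- The transpose of the adjoint action, for a dual group realized in `G ⋉ 𝔤`. -/
def coadTriangular (r : Lie E G →ₗ[ℂ] Lie E G) (g : G) (Z X : Lie E G) : Lie E G :=
  Ad E g⁻¹ X + r (Ad E g⁻¹ ⁅Z, X⁆)

-- Conjugation of all arguments by `g` removes `Ad_g` from the formula and leaves
-- `triangular_cocycle`, with `s = Ad_k r Ad_k⁻¹`.
include hB hBi hr in
theorem piTriangular_mul {g k : G} {Z W : Lie E G}
    (hW : ∀ U, r ⁅W, Ad E k (r (Ad E k⁻¹ U))⁆ = Ad E k (r (Ad E k⁻¹ U)) - r U)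
    (X Y : Lie E G) : piTriangular B r (g * k) (Ad E g W + Z) X Y =
      piTriangular B r g Z X Y +
      piTriangular B r k W (coadTriangular r g Z X) (coadTriangular r g Z Y) := by
  obtain ⟨s, hk⟩ : ∃ s : Lie E G →ₗ[ℂ] Lie E G, ∀ U, Ad E k (r (Ad E k⁻¹ U)) = s U :=
    ⟨Ad E k ∘ₗ r ∘ₗ Ad E k⁻¹, fun U => rfl⟩
  obtain ⟨x, rfl⟩ : ∃ x, X = Ad E g x := ⟨_, (Ad_Ad_inv g X).symm⟩
  obtain ⟨y, rfl⟩ : ∃ y, Y = Ad E g y := ⟨_, (Ad_Ad_inv g Y).symm⟩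
  obtain ⟨z, rfl⟩ : ∃ z, Z = Ad E g z := ⟨_, (Ad_Ad_inv g Z).symm⟩
  have h := triangular_cocycle hB hBi hr (s := s) (W := W) (fun X Y => by
    rw [← hk, ← hk, invariant_Ad_left hBi, hr, invariant_Ad_inv_left hBi])
    (by simpa only [hk] using hW) x y ⁅z, x⁆ ⁅z, y⁆
  simp only [piTriangular, coadTriangular, Ad_mul, mul_inv_rev, LinearMap.comp_apply, ← map_add,
    ← Ad_lie, Ad_inv_Ad, invariant_Ad hBi, add_lie, hk]
  rw [h]
  ring

variable {p : Gr →* G} {x : Gr → E} (hT : IsTriangularRealization r φ p x)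
include hT

theorem triangular_one : ofModel E G (x 1) = 0 := by
  have h := hT.map_mul 1 1
  rw [one_mul, map_one, Ad_one, LinearMap.id_apply] at h
  exact left_eq_add.1 h

theorem wHolAt_triangular (u : Gr) : WHolAt D (fun u => ofModel E G (x u)) u :=
  (wHolAt_of_contMDiffAt hT.holomorphic_right.contMDiffAt).map (ofModel E G)

theorem hasWDeriv_triangular_one (V : Lie E G) :
    HasWDeriv (fun t => ofModel E G (x (curve (φ V) t))) ((1 / 2 : ℂ) • V) := by
  have h := (hasWDeriv_mvfderiv (u := 1) hT.holomorphic_right.contMDiffAt (φ V)).map (ofModel E G)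
  rw [rightTranslation_one, hT.deriv_right] at h
  simpa only [mul_one] using h

theorem hasWDeriv_triangular (u : Gr) (V : Lie E G) :
    HasWDeriv (fun t => ofModel E G (x (curve (φ V) t * u)))
      ((1 / 2 : ℂ) • (⁅r V, ofModel E G (x u)⁆ + V)) := by
  have h := ((hasWDeriv_Ad_hom hT.holomorphic_left (φ V)).apply (ofModel E G (x u))).add
    (hasWDeriv_triangular_one hT V)
  simp only [← hT.map_mul] at h
  refine h.congr_deriv ?_
  rw [LieAlgebra.ad_apply, hT.deriv_left, smul_lie, smul_add]

theorem r_symm_Ad_triangular (u : Gr) (V : Lie E G) :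
    r (φ.symm (Ad D u (φ V))) = Ad E (p u) (r V) := by
  have h := hT.deriv_left (φ.symm (Ad D u (φ V)))
  rw [φ.apply_symm_apply, lieMap_Ad hT.holomorphic_left, hT.deriv_left, map_smul] at h
  exact (smul_right_injective _ (by norm_num : (1 / 2 : ℂ) ≠ 0) h).symm

/-- The left derivative of `x` along `φ V` is its right derivative along `Ad_u (φ V)`. The product
rule of `G ⋉ 𝔤` computes both, and equating them determines `Ad_u`. -/
theorem symm_Ad_triangular (u : Gr) (V : Lie E G) : φ.symm (Ad D u (φ V)) =
    Ad E (p u) V + ⁅ofModel E G (x u), Ad E (p u) (r V)⁆ := by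
  have h : (1 / 2 : ℂ) • Ad E (p u) V = (1 / 2 : ℂ) •
      (⁅Ad E (p u) (r V), ofModel E G (x u)⁆ + φ.symm (Ad D u (φ V))) := by
    refine sub_eq_zero.1 ((Module.forall_dual_apply_eq_zero_iff ℂ _).1 fun l => ?_)
    rw [map_sub, sub_eq_zero]
    have hol : HolAt D (fun v => l (ofModel E G (x v))) u := wHolAt_triangular hT u l
    have h1 := hasDerivAt_mul_left hol (φ V)
    have h2 := hasDerivAt_mul_right hol (Ad D u (φ V))
    have h3 := hasWDeriv_triangular hT u (φ.symm (Ad D u (φ V))) l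
    rw [φ.apply_symm_apply, r_symm_Ad_triangular hT] at h3
    have h4 := (((hasWDeriv_triangular_one hT V).map (Ad E (p u))).add
      (hasWDeriv_const (ofModel E G (x u)))) l
    simp only [← hT.map_mul] at h4
    rw [add_zero, map_smul] at h4
    exact (h4.unique h1).trans (h2.unique h3)
  have h' := smul_right_injective _ (by norm_num : (1 / 2 : ℂ) ≠ 0) h
  rw [h', ← lie_skew]
  abel

/-- Two evaluations of `r` on the adjoint action are compared, from `p` alone and from `x`. The
result is the relation between `p` and `x` that the cocycle identity requires. -/
theorem triangular_r_lie (u : Gr) (U : Lie E G) :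
    r ⁅ofModel E G (x u), Ad E (p u) (r (Ad E (p u)⁻¹ U))⁆ =
      Ad E (p u) (r (Ad E (p u)⁻¹ U)) - r U := by
  have h := r_symm_Ad_triangular hT u (Ad E (p u)⁻¹ U)
  rw [symm_Ad_triangular hT, map_add, Ad_Ad_inv] at h
  rw [eq_sub_iff_add_eq, add_comm]
  exact h

include hBi hr in
theorem dualFlat_Ad_triangular (u : Gr) (X : Lie E G) : dualFlat B φ X ∘ₗ Ad D u =
    dualFlat B φ (coadTriangular r (p u) (ofModel E G (x u)) X) := by
  refine LinearMap.ext fun y => ?_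
  obtain ⟨V, rfl⟩ := φ.surjective y
  rw [dualFlat_apply]
  change B X (φ.symm (Ad D u (φ V))) = _
  have h1 := invariant_ad hBi (ofModel E G (x u)) X (Ad E (p u) (r V))
  rw [symm_Ad_triangular hT, coadTriangular, map_add, map_add, LinearMap.add_apply, hr,
    invariant_Ad_inv_left hBi, invariant_Ad_inv_left hBi]
  linear_combination h1

include hB hBi hr hQ in
/-- The dual Poisson-Lie structure in the triangular case. -/
theorem triv_apply_triangular (u : Gr) (X Y : Lie E G) :
    triv Q u (dualFlat B φ X) (dualFlat B φ Y) =
      4 * piTriangular B r (p u) (ofModel E G (x u)) X Y := by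
  -- The factor `4` compensates for the forms `thetaTriangular`, which are half of the covectors
  -- `dualFlat`.
  refine hQ.isCocycle.apply_eq_of_hasDerivAt (e := dualFlat B φ)
    (C := fun u => coadTriangular r (p u) (ofModel E G (x u)))
    (β := fun u X Y => 4 * piTriangular B r (p u) (ofModel E G (x u)) X Y)
    (dualFlat_Ad_triangular hBi hr hT) (fun u X Y => ?_) (fun X Y => ?_)
    (fun a b X Y => ?_) (fun X Y v => ?_) u X Y
  · have hA := (wHolAt_Ad (p u)).comp_map (i := p) (p := u) hT.holomorphic_left.contMDiffAt
    have hA' := (wHolAt_Ad_inv (p u)).comp_map (i := p) (p := u) hT.holomorphic_left.contMDiffAt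
    have hl := fun X => (wHolAt_triangular hT u).map (-LieAlgebra.ad ℂ (Lie E G) X)
    simp only [LinearMap.neg_apply, LieAlgebra.ad_apply, lie_skew] at hl
    have h1 := (((hl Y).map (B X)).sub (WHolAt.bilin B (hl X)
      (hA.eval ((hA'.eval (hl Y)).map r)))).map ((4 * -(1 / 2) : ℂ) • LinearMap.id)
    simp only [piTriangular, ← mul_assoc]
    exact wHolAt_iff.1 h1
  · simp [piTriangular, triangular_one hT]
  · simp only [map_mul, hT.map_mul]
    rw [piTriangular_mul hB hBi hr (triangular_r_lie hT b), mul_add]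
  · obtain ⟨V, rfl⟩ := φ.surjective v
    have hl := fun X => (hasWDeriv_triangular_one hT V).map (-LieAlgebra.ad ℂ (Lie E G) X)
    simp only [LinearMap.neg_apply, LieAlgebra.ad_apply, lie_skew] at hl
    have hA := hasWDeriv_Ad_hom hT.holomorphic_left (φ V)
    have hA' := hasWDeriv_Ad_inv_hom hT.holomorphic_left (φ V)
    have h1 := (((hl Y).map (B X)).sub (HasWDeriv.bilin B (hl X)
      (hA.eval ((hA'.eval (hl Y)).map r)))).map ((4 * -(1 / 2) : ℂ) • LinearMap.id)
    simp only [piTriangular, ← mul_assoc]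
    refine (hasWDeriv_iff.1 h1).congr_deriv ?_
    have h2 : lin (triv Q) (dualFlat B φ X) (dualFlat B φ Y) = dualFlat B φ ⁅X, Y⁆ :=
      hQ.lin_eq X Y
    rw [h2, dualFlat_apply]
    simp [triangular_one hT]
    rw [hBi X Y V, ← lie_skew Y V]
    simp only [map_neg]
    ring

-- The correction `[x, dp p⁻¹]` cancels the non-constant part of the right derivative of `x`, so
-- that a right-invariant form remains.
include hs in
theorem thetaTriangular_rightTranslation (u : Gr) (X : Lie E G) :
    thetaTriangular D B p x u X ∘ₗ rightTranslation D u = (1 / 2 : ℂ) • dualFlat B φ X := by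
  refine LinearMap.ext fun y => ?_
  obtain ⟨V, rfl⟩ := φ.surjective y
  have h1 : ofModel E G (mvfderiv 𝓘(ℂ, D) x u (rightTranslation D u (φ V))) =
      (1 / 2 : ℂ) • (⁅r V, ofModel E G (x u)⁆ + V) :=
    ((hasWDeriv_mvfderiv hT.holomorphic_right.contMDiffAt (φ V)).map (ofModel E G)).unique
      (hasWDeriv_triangular hT u V)
  change B (ofModel E G (mvfderiv 𝓘(ℂ, D) x u (rightTranslation D u (φ V))) +
    ⁅ofModel E G (x u), rightLog D E p u (rightTranslation D u (φ V))⁆) X = _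
  rw [rightLog_hom hT.holomorphic_left, hT.deriv_left, h1, lie_smul, ← smul_add,
    ← lie_skew (r V), LinearMap.smul_apply, dualFlat_apply, add_right_comm, neg_add_cancel,
    zero_add, map_smul, LinearMap.smul_apply]
  exact congrArg ((1 / 2 : ℂ) * ·) (hs.eq V X)

end Triangular
end DualFormulas

/-! ### Evaluation of the Dirac brackets and their duality -/

section DiracBrackets

variable {E : Type*} [NormedAddCommGroup E] [NormedSpace ℂ E] [FiniteDimensional ℂ E]
  [CompleteSpace E]
  {G : Type*} [TopologicalSpace G] [ChartedSpace E G] [Group G] [LieGroup 𝓘(ℂ, E) ω G]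
  [ConnectedSpace G]
  {B : LinearMap.BilinForm ℂ (Lie E G)} {r : Lie E G →ₗ[ℂ] Lie E G} {α : ℂ}
  {𝔥 : LieSubalgebra ℂ (Lie E G)} {pr : Lie E G →ₗ[ℂ] Lie E G}
  (h : IsOrthogonalProjection B r 𝔥 pr) (hB : B.Nondegenerate) (hr : IsRMatrix B r α)
  {F : Type*} [NormedAddCommGroup F] [NormedSpace ℂ F] [FiniteDimensional ℂ F]
  [CompleteSpace F]
  {H : Type*} [TopologicalSpace H] [ChartedSpace F H] [Group H] [LieGroup 𝓘(ℂ, F) ω H]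
  [ConnectedSpace H] {i : H →* G} {q : Lie E G →ₗ[ℂ] Lie F H}
  (hq : IsReduction i (rTriv B hB r) q) (hqp : ∀ X, lieMap F E i (q X) = pr X)
  {P' : TwoTensor F H} (hP' : IsDiracBracket i (poissonLieTensor B hB r) P')
  {D : Type*} [NormedAddCommGroup D] [NormedSpace ℂ D] [FiniteDimensional ℂ D]
  [CompleteSpace D]
  {Gr : Type*} [TopologicalSpace Gr] [ChartedSpace D Gr] [Group Gr] [LieGroup 𝓘(ℂ, D) ω Gr]
  [ConnectedSpace Gr]
  {φ : Lie E G ≃ₗ[ℂ] Lie D Gr} {Q : TwoTensor D Gr} (hQ : IsDualGroup B r φ Q)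
  {F' : Type*} [NormedAddCommGroup F'] [NormedSpace ℂ F'] [FiniteDimensional ℂ F']
  [CompleteSpace F']
  {K : Type*} [TopologicalSpace K] [ChartedSpace F' K] [Group K] [LieGroup 𝓘(ℂ, F') ω K]
  [ConnectedSpace K] {j : K →* Gr} {q' : Lie D Gr →ₗ[ℂ] Lie F' K}
  (hq' : IsReduction j (triv Q) q') (hqp' : ∀ x, lieMap F' D j (q' x) = φ (pr (φ.symm x)))
  {Q' : TwoTensor F' K} (hQ' : IsDiracBracket j Q Q')

include h hqp in
theorem exists_comp_projection {X : Lie E G} (hX : X ∈ 𝔥) :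
    ∃ ξ : Module.Dual ℂ (Lie F H), B X = ξ ∘ₗ q :=
  ⟨B X ∘ₗ lieMap F E i, LinearMap.ext fun Z => by
    rw [LinearMap.comp_apply, LinearMap.comp_apply, hqp, h.right_eq hX]⟩

include h hqp' in
theorem exists_comp_projection_dual {X : Lie E G} (hX : X ∈ 𝔥) (c : ℂ) :
    ∃ ξ : Module.Dual ℂ (Lie F' K), c • dualFlat B φ X = ξ ∘ₗ q' :=
  ⟨c • dualFlat B φ X ∘ₗ lieMap F' D j, LinearMap.ext fun z => by
    obtain ⟨Z, rfl⟩ := φ.surjective z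
    rw [LinearMap.comp_apply, LinearMap.smul_apply, LinearMap.smul_apply, LinearMap.comp_apply,
      hqp', φ.symm_apply_apply, dualFlat_apply, dualFlat_apply, h.right_eq hX]⟩

include h hqp hr hq hP' in
/-- The Dirac bracket on the subgroup is given by the restriction of `r`. -/
theorem diracBracket_thetaR (u : H) {X Y : Lie E G} (hX : X ∈ 𝔥) (hY : Y ∈ 𝔥) :
    P' u (thetaR F B i u X) (thetaR F B i u Y) = piR B r (i u) X Y := by
  have e1 : ∀ X, thetaR F B i u X = thetaR E B id (i u) X ∘ₗ tangentMapAt E F i u := fun X =>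
    congrArg (fun L => B.flip X ∘ₗ L) (rightLog_comp (f := (id : G → G)) (u := u)
      mdifferentiableAt_id (hq.holomorphic.mdifferentiableAt (by simp)))
  have e2 : ∀ X, thetaR E B id (i u) X ∘ₗ rightTranslation E (i u) = B X := fun X =>
    LinearMap.ext fun Z => by
      change B (rightLog E E id (i u) (rightTranslation E (i u) Z)) X = _
      rw [rightLog_rightTranslation]
      exact h.symm.eq Z X
  rw [e1, e1, hq.diracBracket_apply (isCocycle_rTriv h.invariant hB h.symm hr) hP' u
    (by rw [e2]; exact exists_comp_projection h hqp hX)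
    (by rw [e2]; exact exists_comp_projection h hqp hY), ofTriv_apply, e2, e2, rTriv_apply]

-- For elements of `𝔥` the trivialized forms factor through the projection, so the Dirac bracket of
-- their restrictions is the ambient bracket. The scale `c` is left free for use with both
-- realizations.
include h hqp' hQ hq' hQ' in
theorem diracBracket_dual (u : K) {X Y : Lie E G} (hX : X ∈ 𝔥) (hY : Y ∈ 𝔥) {c : ℂ}
    {θ : Lie E G → Cotangent D (j u)}
    (hθ : ∀ X, θ X ∘ₗ rightTranslation D (j u) = c • dualFlat B φ X) :
    Q' u (θ X ∘ₗ tangentMapAt D F' j u) (θ Y ∘ₗ tangentMapAt D F' j u) =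
      c ^ 2 * triv Q (j u) (dualFlat B φ X) (dualFlat B φ Y) := by
  rw [hq'.diracBracket_apply hQ.isCocycle (by rw [ofTriv_triv]; exact hQ') u
    (by rw [hθ]; exact exists_comp_projection_dual h hqp' hX c)
    (by rw [hθ]; exact exists_comp_projection_dual h hqp' hY c), ofTriv_apply, hθ, hθ]
  simp only [map_smul, LinearMap.smul_apply, smul_eq_mul]
  ring

include h hB hr hqp' hQ hq' hQ' in
theorem diracBracket_factorizable {c : ℂ} (hc : c ≠ 0) {p m : Gr →* G}
    (hF : IsFactorizableRealization r c φ p m) (u : K) {X Y : Lie E G} (hX : X ∈ 𝔥)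
    (hY : Y ∈ 𝔥) : Q' u (thetaFactorizable F' B (p ∘ j) (m ∘ j) u X)
      (thetaFactorizable F' B (p ∘ j) (m ∘ j) u Y) =
        piFactorizable B r c (p (j u)) (m (j u)) X Y := by
  have e : ∀ X, thetaFactorizable F' B (p ∘ j) (m ∘ j) u X =
      thetaFactorizable D B p m (j u) X ∘ₗ tangentMapAt D F' j u := fun X => by
    have h1 := fun {p : Gr →* G} (hp : ContMDiff 𝓘(ℂ, D) 𝓘(ℂ, E) ω p) =>
      rightLog_comp (f := p) (u := u) (hp.mdifferentiableAt (by simp))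
        (hq'.holomorphic.mdifferentiableAt (by simp))
    rw [thetaFactorizable, h1 hF.holomorphic_left, h1 hF.holomorphic_right]
    rfl
  rw [e, e, diracBracket_dual h hQ hq' hqp' hQ' u hX hY
    (thetaFactorizable_rightTranslation h.symm hF (j u)),
    triv_apply_factorizable hB h.invariant hr.antisymm hQ hc hF, mul_inv_cancel_left₀ (by simpa)]

include h hB hr hqp' hQ hq' hQ' in
theorem diracBracket_triangular {p : Gr →* G} {x : Gr → E}
    (hT : IsTriangularRealization r φ p x) (u : K) {X Y : Lie E G} (hX : X ∈ 𝔥)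
    (hY : Y ∈ 𝔥) : Q' u (thetaTriangular F' B (p ∘ j) (x ∘ j) u X)
      (thetaTriangular F' B (p ∘ j) (x ∘ j) u Y) =
        piTriangular B r (p (j u)) (ofModel E G (x (j u))) X Y := by
  have e : ∀ X, thetaTriangular F' B (p ∘ j) (x ∘ j) u X =
      thetaTriangular D B p x (j u) X ∘ₗ tangentMapAt D F' j u := fun X => by
    have hj := hq'.holomorphic.mdifferentiableAt (x := u) (by simp)
    have h1 := rightLog_comp (f := p) (u := u)
      (hT.holomorphic_left.mdifferentiableAt (by simp)) hj
    have h2 : (mvfderiv 𝓘(ℂ, F') (x ∘ j) u).toLinearMap =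
        (mvfderiv 𝓘(ℂ, D) x (j u)).toLinearMap ∘ₗ tangentMapAt D F' j u :=
      congrArg ContinuousLinearMap.toLinearMap
        (mfderiv_comp u (hT.holomorphic_right.mdifferentiableAt (by simp)) hj)
    rw [thetaTriangular, h1, h2]
    rfl
  rw [e, e, diracBracket_dual h hQ hq' hqp' hQ' u hX hY
    (thetaTriangular_rightTranslation h.symm hT (j u)),
    triv_apply_triangular hB h.invariant hr.antisymm hQ hT]
  ring

include h hB hr hq hqp hP' hQ hq' hqp' hQ' in
/-- The Dirac brackets on the two subgroups are dual Poisson-Lie structures. -/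
theorem isDualPair_diracBracket (hi : IsLieSubgroup (E := E) (F := F) i 𝔥.toSubmodule)
    (hj : IsLieSubgroup (E := D) (F := F') j (𝔥.toSubmodule.map φ.toLinearMap)) :
    IsDualPair P' Q' (B.compl₁₂ (lieMap F E i) (φ.symm.toLinearMap ∘ₗ lieMap F' D j)) := by
  have hη := isCocycle_rTriv h.invariant hB h.symm hr
  have hmc := mcForm_rTriv h.invariant hB h.symm hr
  rw [← ofTriv_triv Q] at hQ'
  have hP'' := hq.eq_of_isDiracBracket hη hP'
  have hQ'' := hq'.eq_of_isDiracBracket hQ.isCocycle hQ'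
  set β := B.compl₁₂ (lieMap F E i) (φ.symm.toLinearMap ∘ₗ lieMap F' D j) with hβ
  have hβa : ∀ x y, β x y = B (lieMap F E i x) (φ.symm (lieMap F' D j y)) := fun x y => rfl
  have hi' : ∀ X ∈ 𝔥, ∃ x, lieMap F E i x = X := fun X hX => ⟨q X, by
    rw [hqp, h.apply_of_mem X hX]⟩
  have hj' : ∀ X ∈ 𝔥, ∃ x, φ.symm (lieMap F' D j x) = X := fun X hX => ⟨q' (φ X), by
    rw [hqp', φ.symm_apply_apply, φ.symm_apply_apply, h.apply_of_mem X hX]⟩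
  refine ⟨?_, ?_, ⟨fun x hx => ?_, fun y hy => ?_⟩, ?_, ?_⟩
  · rw [hP'']
    exact hq.isPoissonLie hη hmc
  · rw [hQ'']
    exact hq'.isPoissonLie hQ.isCocycle hQ.mcForm_eq_zero
  -- Both Lie algebras are copies of `𝔥`, so perfection of the pairing is non-degeneracy of `B` on
  -- `𝔥`.
  · refine hi.lieMap_injective ((h.nondegenerate _ (lieMap_mem hi x) fun Z hZ => ?_).trans
      (map_zero _).symm)
    obtain ⟨y, rfl⟩ := hj' Z hZ
    exact hx y
  · refine hj.lieMap_injective (φ.symm.injective ((h.nondegenerate _ (symm_lieMap_mem hj y)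
      fun Z hZ => ?_).trans ?_))
    · obtain ⟨x, rfl⟩ := hi' Z hZ
      exact (h.symm.eq _ _).trans (hy x)
    · rw [map_zero, map_zero]
  · rw [hP'', (hq.isCocycle hη).linearizesTo_iff]
    intro y z
    -- Extended by zero on the complement, the covector paired with `y` is represented by an element
    -- of `𝔥`, so the reduced linearization is that of `π^r` restricted to `𝔥`.
    have e : ∀ y, β.flip y ∘ₗ q = B (φ.symm (lieMap F' D j y)) := fun y =>
      LinearMap.ext fun Z => by
        rw [LinearMap.comp_apply, LinearMap.flip_apply, hβa, hqp,
          h.left_eq _ _ (symm_lieMap_mem hj y)]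
        exact h.symm.eq _ _
    rw [hq.lin_reduced hη, e, e]
    refine LinearMap.ext fun x => ?_
    rw [LinearMap.comp_apply, lin_rTriv h.invariant hB h.symm hr, LinearMap.flip_apply, hβa,
      lieMap_lie hj.submanifold.holomorphic]
    congr 1
    rw [LinearEquiv.eq_symm_apply, hQ.map_rBracket, φ.apply_symm_apply, φ.apply_symm_apply]
  · rw [hQ'', (hq'.isCocycle hQ.isCocycle).linearizesTo_iff]
    intro x z
    have e : ∀ x, β.flip.flip x ∘ₗ q' = dualFlat B φ (lieMap F E i x) := fun x =>
      LinearMap.ext fun w => by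
        obtain ⟨W, rfl⟩ := φ.surjective w
        rw [LinearMap.comp_apply, LinearMap.flip_apply, LinearMap.flip_apply, hβa, hqp',
          φ.symm_apply_apply, φ.symm_apply_apply, dualFlat_apply,
          h.right_eq (lieMap_mem hi x)]
    have h1 : ∀ X Y, lin (triv Q) (dualFlat B φ X) (dualFlat B φ Y) = dualFlat B φ ⁅X, Y⁆ :=
      hQ.lin_eq
    rw [hq'.lin_reduced hQ.isCocycle, e, e, h1, ← lieMap_lie hi.submanifold.holomorphic]
    rfl

end DiracBrackets
end PoissonLie

end

/-! ### The main theorem -/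

theorem mainTheorem10
    -- the connected simple complex Lie group `G`, with invariant form `B = tr` and `r`-matrix `r`
    {E : Type*} [NormedAddCommGroup E] [NormedSpace ℂ E] [FiniteDimensional ℂ E]
    [CompleteSpace E] {G : Type*} [TopologicalSpace G] [ChartedSpace E G] [Group G]
    [LieGroup 𝓘(ℂ, E) ω G] [ConnectedSpace G]
    (hG : LieAlgebra.IsSimple ℂ (PoissonLie.Lie E G))
    (B : LinearMap.BilinForm ℂ (PoissonLie.Lie E G)) (hB : B.Nondegenerate) (hBs : B.IsSymm)
    (hBi : ∀ X Y Z : PoissonLie.Lie E G, B ⁅X, Y⁆ Z = B X ⁅Y, Z⁆)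
    (r : PoissonLie.Lie E G →ₗ[ℂ] PoissonLie.Lie E G) (α : ℂ)
    (hr : PoissonLie.IsRMatrix B r α)
    -- the dual Poisson-Lie group `Gr`
    {D : Type*} [NormedAddCommGroup D] [NormedSpace ℂ D] [FiniteDimensional ℂ D]
    [CompleteSpace D] {Gr : Type*} [TopologicalSpace Gr] [ChartedSpace D Gr] [Group Gr]
    [LieGroup 𝓘(ℂ, D) ω Gr] [ConnectedSpace Gr]
    (φ : PoissonLie.Lie E G ≃ₗ[ℂ] PoissonLie.Lie D Gr) (Q : PoissonLie.TwoTensor D Gr)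
    (hQ : PoissonLie.IsDualGroup B r φ Q)
    -- the simple `r`-invariant subalgebra `𝔥`
    (𝔥 : LieSubalgebra ℂ (PoissonLie.Lie E G)) (h𝔥 : LieAlgebra.IsSimple ℂ 𝔥)
    (h𝔥r : ∀ X ∈ 𝔥, r X ∈ 𝔥)
    -- the subgroup `H` of `G` with Lie algebra `𝔥`
    {E' : Type*} [NormedAddCommGroup E'] [NormedSpace ℂ E'] [FiniteDimensional ℂ E']
    [CompleteSpace E'] {H : Type*} [TopologicalSpace H] [ChartedSpace E' H] [Group H]
    [LieGroup 𝓘(ℂ, E') ω H]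
    (i : H →* G) (hi : PoissonLie.IsLieSubgroup (E := E) (F := E') i 𝔥.toSubmodule)
    -- the subgroup `Hr` of `Gr` with Lie algebra `(𝔥, [·,·]_r)`
    {D' : Type*} [NormedAddCommGroup D'] [NormedSpace ℂ D'] [FiniteDimensional ℂ D']
    [CompleteSpace D'] {Hr : Type*} [TopologicalSpace Hr] [ChartedSpace D' Hr] [Group Hr]
    [LieGroup 𝓘(ℂ, D') ω Hr]
    (j : Hr →* Gr)
    (hj : PoissonLie.IsLieSubgroup (E := D) (F := D') j
      (𝔥.toSubmodule.map φ.toLinearMap)) :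
    PoissonLie.IsPoissonLie (PoissonLie.poissonLieTensor B hB r) ∧
    PoissonLie.IsPoissonDirac (E := E) (F := E') i (PoissonLie.poissonLieTensor B hB r) ∧
    PoissonLie.IsPoissonDirac (E := D) (F := D') j Q ∧
    -- the Dirac brackets
    ∀ (P' : PoissonLie.TwoTensor E' H) (Q' : PoissonLie.TwoTensor D' Hr),
      PoissonLie.IsDiracBracket i (PoissonLie.poissonLieTensor B hB r) P' →
      PoissonLie.IsDiracBracket j Q Q' →
      -- on `H`: the Poisson-Lie structure of the restriction of `r` to `𝔥`
      (∀ h : H, ∀ X ∈ 𝔥, ∀ Y ∈ 𝔥,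
        P' h (PoissonLie.thetaR E' B i h X) (PoissonLie.thetaR E' B i h Y) =
          PoissonLie.piR B r (i h) X Y) ∧
      -- on `Hr`, in the factorizable case, with `Gr` realized in `G × G`
      (∀ c : ℂ, c ≠ 0 → c ^ 2 = α → ∀ p m : Gr →* G,
        PoissonLie.IsFactorizableRealization r c φ p m →
        ∀ u : Hr, ∀ X ∈ 𝔥, ∀ Y ∈ 𝔥,
          Q' u (PoissonLie.thetaFactorizable D' B (p ∘ j) (m ∘ j) u X)
            (PoissonLie.thetaFactorizable D' B (p ∘ j) (m ∘ j) u Y) =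
              PoissonLie.piFactorizable B r c (p (j u)) (m (j u)) X Y) ∧
      -- on `Hr`, in the triangular case, with `Gr` realized in `G ⋉ 𝔤`
      (α = 0 → ∀ (p : Gr →* G) (x : Gr → E),
        PoissonLie.IsTriangularRealization r φ p x →
        ∀ u : Hr, ∀ X ∈ 𝔥, ∀ Y ∈ 𝔥,
          Q' u (PoissonLie.thetaTriangular D' B (p ∘ j) (x ∘ j) u X)
            (PoissonLie.thetaTriangular D' B (p ∘ j) (x ∘ j) u Y) =
              PoissonLie.piTriangular B r (p (j u)) (PoissonLie.ofModel E G (x (j u))) X Y) ∧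
      -- `H` and `Hr` are dual Poisson-Lie groups
      PoissonLie.IsDualPair P' Q'
        (B.compl₁₂ (PoissonLie.lieMap E' E i)
          (φ.symm.toLinearMap ∘ₗ PoissonLie.lieMap D' D j)) := by
  obtain ⟨pr, h1, h2, h3, h4⟩ :=
    PoissonLie.exists_orthogonal_projection B hB hBs hBi hG h𝔥
  have h : PoissonLie.IsOrthogonalProjection B r 𝔥 pr :=
    ⟨hBs, hBi, hr.antisymm, h𝔥r,
      fun X hX => PoissonLie.eq_zero_of_orthogonal B hB hBs hBi hG h𝔥 hX, h1, h2, h3, h4⟩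
  have := hi.connected
  have := hj.connected
  obtain ⟨q, hq, hqp⟩ := PoissonLie.exists_isReduction h hB hr hi
  obtain ⟨q', hq', hqp'⟩ := PoissonLie.exists_isReduction_dual h hB hQ hj
  have hη := PoissonLie.isCocycle_rTriv hBi hB hBs hr
  refine ⟨PoissonLie.isPoissonLie_poissonLieTensor hBi hB hBs hr,
    hq.isPoissonDirac hη hi.submanifold (PoissonLie.mcForm_rTriv hBi hB hBs hr), ?_,
    fun P' Q' hP' hQ' => ⟨?_, ?_, ?_, ?_⟩⟩
  · have := hq'.isPoissonDirac hQ.isCocycle hj.submanifold hQ.mcForm_eq_zero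
    rwa [PoissonLie.ofTriv_triv] at this
  · exact fun u X hX Y hY => PoissonLie.diracBracket_thetaR h hB hr hq hqp hP' u hX hY
  · exact fun c hc _ p m hF u X hX Y hY =>
      PoissonLie.diracBracket_factorizable h hB hr hQ hq' hqp' hQ' hc hF u hX hY
  · exact fun _ p x hT u X hX Y hY =>
      PoissonLie.diracBracket_triangular h hB hr hQ hq' hqp' hQ' hT u hX hY
  · exact PoissonLie.isDualPair_diracBracket h hB hr hq hqp hP' hQ hq' hqp' hQ' hi hj
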